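/- **Setting.** Let $g\ge 2$, let $\Gamma$ be a Fuchsian group acting freely on the unit disc $\mathbb D$, and let $\mathcal F\subset\mathbb D$ be a closed fundamental polygon for $\Gamma$ with $8g-4$ sides, labelled counterclockwise with indices modulo $8g-4$; side $i$ joins the vertices $V_i$ and $V_{i+1}$. Let $P_i,Q_{i+1}\in\mathbb S=\partial\mathbb D$ be the endpoints of the geodesic extending side $i$. Assume that these points lie counterclockwise on $\mathbb S$ in the order $P_1,Q_1,P_2,Q_2,\dots,P_{8g-4},Q_{8g-4}$ and that the geodesics extending the sides never meet the interior of a tile $\gamma\mathcal F$, $\gamma\in\Gamma$. Put $$\sigma(i)=\begin{cases}4g-i& i\text{ odd}\\ 2-i& i\text{ even}\end{cases},\qquad \rho(i)=\sigma(i)+1,\qquad \tau(i)=i+4g-2 \pmod{8g-4},$$ and let $T_i\in\Gamma$ be the side-pairing Möbius transformations: $T_i(V_i)=V_{\rho(i)}$, $T_{\sigma(i)}T_i=\mathrm{Id}$, $T_{\rho^3(i)}T_{\rho^2(i)}T_{\rho(i)}T_i=\mathrm{Id}$. (Then $\Gamma\backslash\mathbb D$ is a compact surface of genus $g$.) Arcs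 $[a,b]\subset\mathbb S$ are counterclockwise, and $(u,w)$ with $u\ne w$ in $\mathbb S$ denotes the oriented geodesic from $u$ to $w$. Möbius transformations act diagonally on pairs. **The maps.** $\Omega_{\rm geo}$ is the set of $(u,w)$ whose geodesic meets $\mathcal F$, and $F_{\rm geo}(u,w)=(T_iu,T_iw)$ if the geodesic $(u,w)$ exits $\mathcal F$ through side $i$. If it exits through a vertex, either of the two sides at that vertex may be used. Let $\bar A=\{A_i\}$ be extremal, i.e. $A_i\in\{P_i,Q_i\}$ for every $i$, and let $F_{\bar A}(u,w)=(T_iu,T_iw)$ if $w\in[A_i,A_{i+1})$. Consider the system for points $G_i\in[P_i,P_{i+1}]$ $$(\ast)\qquad G_{\sigma(i)}=T_iG_{i-2}\ \text{ if }A_i=P_i,\qquad G_{\sigma(i)}=T_{\tau(i)+1}G_{\tau(i)}\ \text{ if }A_i=Q_i .$$ Given a solution, put $U_i=T_{\sigma(i-1)}T_{\tau(i)}$, $H_i=U_iG_{\tau(i)-1}$, $$\Omega_{\bar A}=\bigcup_{i}\,[H_{i+1},G_{i-2}]\times[P_i,Q_i]\ \cup\ [H_{i+1},G_{i-1}]\times[Q_i,P_{i+1}],$$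 $$\mathcal B_i=(\Omega_{\rm geo}\setminus\Omega_{\bar A})\cap([Q_{i+1},Q_{i+2}]\times[P_i,P_{i+1}]),\quad \mathcal B^i=(\Omega_{\rm geo}\setminus\Omega_{\bar A})\cap([P_{i-1},P_i]\times[Q_i,Q_{i+1}]),$$ and let $\Phi$ be the map on $\Omega_{\rm geo}$ equal to $\mathrm{Id}$ on $\Omega_{\rm geo}\cap\Omega_{\bar A}$, to $U_{\tau(i)+1}$ on $\mathcal B_i$ and to $U_{\tau(i)}$ on $\mathcal B^i$. **Proposition.** The system $(\ast)$ has exactly one solution. For it, $F_{\rm geo}$ maps $\Omega_{\rm geo}$ into itself, and $\Phi$ maps $\Omega_{\rm geo}$ into $\Omega_{\bar A}$. Up to boundaries $\Phi$ is a conjugacy between $F_{\rm geo}$ and $F_{\bar A}$: 1. $\Phi$ restricts to a bijection from $\operatorname{int}(\Omega_{\rm geo})\setminus\partial\Omega_{\bar A}$ onto $\operatorname{int}(\Omega_{\bar A})\setminus\partial\Omega_{\rm geo}$. 2. $\Phi(F_{\rm geo}(u,w))=F_{\bar A}(\Phi(u,w))$ for every $(u,w)\in\Omega_{\rm geo}$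 whose geodesic does not exit $\mathcal F$ through a vertex and such that neither $(u,w)$ nor $F_{\rm geo}(u,w)$ lies on $\partial\Omega_{\bar A}$. Interiors and boundaries are taken in $\mathbb S\times\mathbb S$. -/

import Mathlib

open Set Topology

noncomputable section

/-- The group `SU(1,1)` of matrices `!![a, b; conj b, conj a]` of determinant one. Acting on the unit
disc by fractional linear maps it induces the full group of orientation preserving isometries of the
hyperbolic metric; the only elements acting trivially are `1` and `-1`. -/
def SU11 : Subgroup (Matrix.SpecialLinearGroup (Fin 2) ℂ) where
  carrier := {M | M.1 1 1 = star (M.1 0 0) ∧ M.1 1 0 = star (M.1 0 1)}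
  one_mem' := by simp
  mul_mem' := by
    rintro A B ⟨h1, h2⟩ ⟨h3, h4⟩
    simp only [Matrix.SpecialLinearGroup.coe_mul, Set.mem_ofPred_eq, Matrix.mul_apply,
      Fin.sum_univ_two, h1, h2, h3, h4, star_add, star_mul', star_star]
    constructor <;> ring
  inv_mem' := by
    rintro A ⟨h1, h2⟩
    simp [Matrix.SpecialLinearGroup.coe_inv, Matrix.adjugate_fin_two, h1, h2]

/-- The Möbius transformation `z ↦ (a z + b) / (conj b z + conj a)`. -/
def mob (M : SU11) (z : ℂ) : ℂ :=
  (M.1.1 0 0 * z + M.1.1 0 1) / (M.1.1 1 0 * z + M.1.1 1 1)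

theorem norm_mob_circle (M : SU11) (x : Circle) : ‖mob M x‖ = 1 := by
  obtain ⟨M, h1, h2⟩ := M
  have hdet := M.2
  rw [Matrix.det_fin_two, h1, h2] at hdet
  have hx : (x : ℂ) * star (x : ℂ) = 1 := by
    simpa using Complex.mul_conj (x : ℂ)
  have key : M.1 1 0 * (x : ℂ) + M.1 1 1 = x * star (M.1 0 0 * (x : ℂ) + M.1 0 1) := by
    rw [h1, h2, star_add, star_mul']
    linear_combination (-(star (M.1 0 0))) * hx
  have hne : M.1 0 0 * (x : ℂ) + M.1 0 1 ≠ 0 := by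
    intro h0
    have hb : M.1 0 1 = -(M.1 0 0 * (x : ℂ)) := by linear_combination h0
    rw [hb] at hdet
    simp only [star_neg, star_mul'] at hdet
    have : (0 : ℂ) = 1 := by
      linear_combination hdet + (M.1 0 0 * star (M.1 0 0)) * hx
    exact zero_ne_one this
  change ‖(M.1 0 0 * (x : ℂ) + M.1 0 1) / (M.1 1 0 * (x : ℂ) + M.1 1 1)‖ = 1
  rw [key, norm_div, norm_mul, norm_star, Circle.norm_coe, one_mul]
  exact div_self (norm_ne_zero_iff.mpr hne)

/-- The action on the circle at infinity. -/
def onCircle (M : SU11) (x : Circle) : Circle :=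
  ⟨mob M x, mem_sphere_zero_iff_norm.mpr (norm_mob_circle M x)⟩

/-- The diagonal action on pairs of points at infinity, i.e. on oriented geodesics. -/
def onPair (M : SU11) (p : Circle × Circle) : Circle × Circle :=
  (onCircle M p.1, onCircle M p.2)

/-- The Möbius transformation of `M` is the identity (that is, `M = 1` or `M = -1`). -/
def ActsTrivially (M : SU11) : Prop := ∀ z : ℂ, ‖z‖ < 1 → mob M z = z

/-! ### The circle at infinity and geodesics -/

/-- `a, x, b` are distinct and met in this order when moving counterclockwise along the unit circle,
that is, the Euclidean triangle `a, x, b` is positively oriented. -/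
def CCW (a x b : Circle) : Prop :=
  0 < (star ((x : ℂ) - a) * ((b : ℂ) - a)).im

/-- The closed counterclockwise arc `[a, b]` of the circle. -/
def arcCC (a b : Circle) : Set Circle := {x | x = a ∨ x = b ∨ CCW a x b}

/-- The half-open counterclockwise arc `[a, b)` of the circle. -/
def arcCO (a b : Circle) : Set Circle := {x | x = a ∨ CCW a x b}

/-- For `u ≠ w` the zero set of this function is the circle orthogonal to the unit circle through `u`
and `w` (the line through `u` and `w` if `w = -u`). In the unit disc the function is positive
exactly to the left of the geodesic oriented from `u` to `w`. -/
def sideFn (u w : Circle) (z : ℂ) : ℝ :=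
  (star ((w : ℂ) - u) * (2 * z - (1 + (‖z‖ : ℂ) ^ 2) * u)).im

/-- The geodesic of the unit disc with endpoints `u ≠ w`. -/
def geodesic (u w : Circle) : Set ℂ := {z | ‖z‖ < 1 ∧ sideFn u w z = 0}

/-! ### The index maps -/

/-- The side pairing rule, with indices modulo `8g-4`: `4g - i` for odd `i`, `2 - i` for even `i`. -/
def sigmaIdx (g : ℕ) (i : ZMod (8 * g - 4)) : ZMod (8 * g - 4) :=
  if Even i.val then 2 - i else 4 * (g : ZMod (8 * g - 4)) - i

/-- `ρ(i) = σ(i) + 1`. -/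
def rhoIdx (g : ℕ) (i : ZMod (8 * g - 4)) : ZMod (8 * g - 4) := sigmaIdx g i + 1

/-- `τ(i) = i + (4g-2)`. -/
def tauIdx (g : ℕ) (i : ZMod (8 * g - 4)) : ZMod (8 * g - 4) :=
  i + (4 * (g : ZMod (8 * g - 4)) - 2)

/-- The sequence `P₀, Q₀, P₁, Q₁, P₂, Q₂, …`. -/
def interleave {n : ℕ} (P Q : ZMod n → Circle) (m : ℕ) : Circle :=
  if Even m then P ((m / 2 : ℕ) : ZMod n) else Q ((m / 2 : ℕ) : ZMod n)

/-- The closed region of the disc to the left of all the geodesics from `P i` to `Q (i+1)`. -/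
def polygonRegion {n : ℕ} (P Q : ZMod n → Circle) : Set ℂ :=
  {z | ‖z‖ < 1 ∧ ∀ i, 0 ≤ sideFn (P i) (Q (i + 1)) z}

/-- A surface group `Γ` of genus `g` together with an `(8g-4)`-sided fundamental polygon satisfying the
extension condition, its vertices `V i`, the endpoints `P i`, `Q (i+1)` of the geodesic extending the
side from `V i` to `V (i+1)`, and its side-pairing transformations `T i`. -/
structure SurfacePolygon (g : ℕ) where
  Γ : Subgroup SU11
  P : ZMod (8 * g - 4) → Circle
  Q : ZMod (8 * g - 4) → Circle
  V : ZMod (8 * g - 4) → ℂ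
  T : ZMod (8 * g - 4) → SU11
  /-- `Γ` is a Fuchsian group. -/
  discrete : DiscreteTopology Γ
  /-- `Γ` acts freely on the disc. -/
  free : ∀ γ ∈ Γ, ∀ z : ℂ, ‖z‖ < 1 → mob γ z = z → ActsTrivially γ
  T_mem : ∀ i, T i ∈ Γ
  /-- The counterclockwise order of the endpoints is `P₁, Q₁, P₂, Q₂, …`. -/
  order : ∀ a b c : ℕ, a < b → b < c → c < 2 * (8 * g - 4) →
    CCW (interleave P Q a) (interleave P Q b) (interleave P Q c)
  /-- `V i` is the common vertex of sides `i-1` and `i`. -/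
  V_mem : ∀ i, V i ∈ geodesic (P (i - 1)) (Q i) ∩ geodesic (P i) (Q (i + 1))
  /-- The polygon is a fundamental domain: its images cover the disc … -/
  cover : ∀ z : ℂ, ‖z‖ < 1 → ∃ γ ∈ Γ, z ∈ mob γ '' polygonRegion P Q
  /-- … and have disjoint interiors. -/
  disjoint : ∀ γ ∈ Γ,
    (interior (polygonRegion P Q) ∩ mob γ '' interior (polygonRegion P Q)).Nonempty →
      ActsTrivially γ
  /-- The extension condition: the geodesics extending the sides never meet the interior of a
  tile. -/
  extension : ∀ i, ∀ γ ∈ Γ,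
    Disjoint (geodesic (P i) (Q (i + 1))) (mob γ '' interior (polygonRegion P Q))
  /-- The side pairing. -/
  T_vertex : ∀ i, mob (T i) (V i) = V (rhoIdx g i)
  T_inverse : ∀ i, ActsTrivially (T (sigmaIdx g i) * T i)
  T_cycle : ∀ i, ActsTrivially (T (rhoIdx g (rhoIdx g (rhoIdx g i))) *
    T (rhoIdx g (rhoIdx g i)) * T (rhoIdx g i) * T i)

namespace SurfacePolygon

variable {g : ℕ} (D : SurfacePolygon g)

/-- The closed fundamental polygon. -/
def F : Set ℂ := polygonRegion D.P D.Q

/-- Side `i` of the polygon, with its two endpoints. -/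
def side (i : ZMod (8 * g - 4)) : Set ℂ := D.F ∩ geodesic (D.P i) (D.Q (i + 1))

/-! ### The geometric map -/

/-- The oriented geodesics `(u, w)`, `u ≠ w`, that intersect the polygon. -/
def OmegaGeo : Set (Circle × Circle) :=
  {p | p.1 ≠ p.2 ∧ (geodesic p.1 p.2 ∩ D.F).Nonempty}

/-- `z` is the point where the oriented geodesic `p = (u, w)` exits the polygon, i.e. the last of its
points in the polygon. (The Euclidean distance to `w` strictly decreases along the geodesic.) -/
def IsExitPoint (p : Circle × Circle) (z : ℂ) : Prop :=
  z ∈ geodesic p.1 p.2 ∩ D.F ∧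
    ∀ z' ∈ geodesic p.1 p.2 ∩ D.F, ‖z - (p.2 : ℂ)‖ ≤ ‖z' - (p.2 : ℂ)‖

/-- The set of oriented geodesics that exit the polygon through side `i`. -/
def exitSet (i : ZMod (8 * g - 4)) : Set (Circle × Circle) :=
  {p | p.1 ≠ p.2 ∧ ∃ z ∈ D.side i, D.IsExitPoint p z}

open scoped Classical in
/-- The geometric map: `T i` on the geodesics that exit through side `i`. The side is unique unless
the geodesic exits through a vertex. (Identity outside `OmegaGeo`, a junk value.) -/
def FGeo (p : Circle × Circle) : Circle × Circle :=
  if h : ∃ i, p ∈ D.exitSet i then onPair (D.T h.choose) p else p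

/-! ### The arithmetic map -/

/-- Extremal parameters: each `A i` is `P i` or `Q i`. -/
def IsExtremal (A : ZMod (8 * g - 4) → Circle) : Prop := ∀ i, A i = D.P i ∨ A i = D.Q i

open scoped Classical in
/-- The arithmetic map: `(u, w) ↦ (T i u, T i w)` if `w ∈ [A i, A (i+1))`. For extremal parameters
these arcs partition the circle. -/
def FArith (A : ZMod (8 * g - 4) → Circle) (p : Circle × Circle) : Circle × Circle :=
  if h : ∃ i, p.2 ∈ arcCO (A i) (A (i + 1)) then onPair (D.T h.choose) p else p

/-- The system of equations that determines the points `G i`. -/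
structure IsCornerSystem (A G : ZMod (8 * g - 4) → Circle) : Prop where
  mem : ∀ i, G i ∈ arcCC (D.P i) (D.P (i + 1))
  eq_of_P : ∀ i, A i = D.P i → G (sigmaIdx g i) = onCircle (D.T i) (G (i - 2))
  eq_of_Q : ∀ i, A i = D.Q i →
    G (sigmaIdx g i) = onCircle (D.T (tauIdx g i + 1)) (G (tauIdx g i))

/-- `U i = T (σ (i-1)) T (τ i)`. -/
def U (i : ZMod (8 * g - 4)) : SU11 := D.T (sigmaIdx g (i - 1)) * D.T (tauIdx g i)

/-- `H i = U i (G (τ i - 1))`. -/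
def H (G : ZMod (8 * g - 4) → Circle) (i : ZMod (8 * g - 4)) : Circle :=
  onCircle (D.U i) (G (tauIdx g i - 1))

/-- The domain of the natural extension of the boundary map. -/
def OmegaArith (G : ZMod (8 * g - 4) → Circle) : Set (Circle × Circle) :=
  ⋃ i, arcCC (D.H G (i + 1)) (G (i - 2)) ×ˢ arcCC (D.P i) (D.Q i) ∪
    arcCC (D.H G (i + 1)) (G (i - 1)) ×ˢ arcCC (D.Q i) (D.P (i + 1))

/-! ### The conjugacy -/

/-- The lower bulge with index `i`. -/
def lowerBulge (G : ZMod (8 * g - 4) → Circle) (i : ZMod (8 * g - 4)) : Set (Circle × Circle) :=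
  (D.OmegaGeo \ D.OmegaArith G) ∩
    (arcCC (D.Q (i + 1)) (D.Q (i + 2)) ×ˢ arcCC (D.P i) (D.P (i + 1)))

/-- The upper bulge with index `i`. -/
def upperBulge (G : ZMod (8 * g - 4) → Circle) (i : ZMod (8 * g - 4)) : Set (Circle × Circle) :=
  (D.OmegaGeo \ D.OmegaArith G) ∩
    (arcCC (D.P (i - 1)) (D.P i) ×ˢ arcCC (D.Q i) (D.Q (i + 1)))

open scoped Classical in
/-- The map `Φ`: the identity on `Ω_geo ∩ Ω_A`, the transformation `U (τ i + 1)` on the lower bulge `i`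
and `U (τ i)` on the upper bulge `i`. (Identity outside `OmegaGeo`, a junk value.) -/
def Phi (G : ZMod (8 * g - 4) → Circle) (p : Circle × Circle) : Circle × Circle :=
  if p ∈ D.OmegaGeo ∩ D.OmegaArith G then p
  else if h : ∃ i, p ∈ D.lowerBulge G i then onPair (D.U (tauIdx g h.choose + 1)) p
  else if h : ∃ i, p ∈ D.upperBulge G i then onPair (D.U (tauIdx g h.choose)) p
  else p

end SurfacePolygon

end

/-! ### Orientation of triples and the linear model of the disc -/

/-! The action of the side pairings on the endpoints `P`, `Q` and the shape of the two domains near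
each vertex turn the statement into combinatorics of the circular order.

Signs. Send `z` to the vector `(2z, 1 + ‖z‖²)` of `ℂ × ℝ`. There `sideFn` is a determinant,
`SU(1,1)` acts linearly up to positive factors, and a point of a geodesic is a positive combination
of its two ends. Incidences between geodesics, sides and vertices thus become linear inequalities
between values of `orient`. On the circle only the cyclic order matters, and `exists_cut` and
`exists_chain` replace it by the order of the reals.

Endpoints. By the extension condition no extended side enters the interior of a tile. This gives one
inequality for each tile around a vertex, and the cycle relation turns these inequalities into
equalities (`T_P_pred`). So every `T i` sends the nearby `P` and `Q` to explicit `P` and `Q`, and `U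
m` carries the two extended sides at `V (τ m)` to those at `V m`.

Corner points. The system for `G` is a finite system of maps of arcs into arcs. A solution exists by
monotonicity (`exists_fixed_of_arcs`). It is unique because a Möbius invariant measure of the
separation of two solutions would strictly increase along the system (`eq_of_arc_contraction`).

Domains. The two domains differ only in two rectangles at each vertex `V m`. In them the geometric
domain is bounded by the geodesics through `V m`, the arithmetic one by the line `u = H m` or `u = G
(m - 1)`. `U (τ m)` carries `Q m`, `H m`, `P (m - 1)`, `P m`, `V m` to `P (τ m - 1)`, `G (τ m - 1)`,
`Q (τ m)`, `Q (τ m + 1)`, `V (τ m)`. Hence it moves each bulge of the geometric domain onto a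
missing corner of the arithmetic one, up to boundaries (`mapsTo_Phi`, `bijOn_Phi`).

Conjugacy. For a pair in the arithmetic domain the exit side `i` and the arithmetic index differ by
at most one. Since `U (τ (σ i)) T i = T (i + 1)` and `U (τ (σ i + 1)) T i = T (i - 1)`, a
discrepancy of indices is exactly what `Φ` corrects. That `Φ` applies the right correction follows
from the invariance of the arithmetic domain (`onPair_T_mem_OmegaArith`). Pairs in a bulge are
treated alike, using `T (τ m) U (τ m) = T (m - 1)` and `T (τ m - 1) U (τ m) = T m`. -/

/-- Twice the signed area of the triangle `a, b, c`. -/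
def orient (a b c : Circle) : ℝ := (star ((b : ℂ) - a) * ((c : ℂ) - a)).im

theorem ccw_iff {a b c : Circle} : CCW a b c ↔ 0 < orient a b c := Iff.rfl

theorem orient_eq (a b c : Circle) : orient a b c =
    ((b : ℂ).re - (a : ℂ).re) * ((c : ℂ).im - (a : ℂ).im) -
      ((b : ℂ).im - (a : ℂ).im) * ((c : ℂ).re - (a : ℂ).re) := by
  simp [orient, Complex.mul_im]; ring

/-- The determinant of three vectors of `ℂ × ℝ`. -/
def det3 (x y z : ℂ) (r s t : ℝ) : ℝ :=
  r * (y.re * z.im - y.im * z.re) + s * (z.re * x.im - z.im * x.re) +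
    t * (x.re * y.im - x.im * y.re)

/-- The lift `(2z, 1 + ‖z‖²)` places the disc inside the light cone and the circle on it. Geodesics
become planes through the origin, so the side of a geodesic is the sign of a determinant. -/
theorem sideFn_eq_det3 (u w : Circle) (z : ℂ) :
    sideFn u w z = det3 u w (2 * z) 1 1 (1 + ‖z‖ ^ 2) := by
  have h1 : (1 + (‖z‖ : ℂ) ^ 2) = ((1 + ‖z‖ ^ 2 : ℝ) : ℂ) := by push_cast; rfl
  simp only [sideFn, det3, h1]
  generalize 1 + ‖z‖ ^ 2 = t
  simp [Complex.mul_im, Complex.mul_re]; ring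

theorem orient_eq_det3 (a b c : Circle) : orient a b c = det3 a b c 1 1 1 := by
  rw [orient_eq, det3]; ring

theorem sideFn_circle (a b c : Circle) : sideFn a b c = 2 * orient a b c := by
  rw [sideFn_eq_det3, orient_eq_det3, Circle.norm_coe]
  simp [det3]; ring

/-- The linear action of `SU(1,1)` on the lifts `(2 z, 1 + ‖z‖ ^ 2)`, first component. -/
def linX (a b x : ℂ) (t : ℝ) : ℂ := a ^ 2 * x + b ^ 2 * star x + 2 * a * b * t

/-- The linear action of `SU(1,1)` on the lifts `(2 z, 1 + ‖z‖ ^ 2)`, second component. -/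
def linT (a b x : ℂ) (t : ℝ) : ℝ :=
  (Complex.normSq a + Complex.normSq b) * t + 2 * (a * star b * x).re

/-- The factor is the determinant of the linear action. It equals one on `SU(1,1)` by
`SU11.normSq_sub`. -/
theorem det3_lin (a b x y z : ℂ) (r s t : ℝ) :
    det3 (linX a b x r) (linX a b y s) (linX a b z t) (linT a b x r) (linT a b y s) (linT a b z t) =
      (Complex.normSq a - Complex.normSq b) ^ 3 * det3 x y z r s t := by
  obtain ⟨a1, a2⟩ := a
  obtain ⟨b1, b2⟩ := b
  obtain ⟨x1, x2⟩ := x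
  obtain ⟨y1, y2⟩ := y
  obtain ⟨z1, z2⟩ := z
  simp [det3, linX, linT, Complex.normSq_apply, pow_two]
  ring

namespace SU11

/-- The automorphy factor. -/
def den (M : SU11) (z : ℂ) : ℂ := M.1.1 1 0 * z + M.1.1 1 1

theorem normSq_sub (M : SU11) :
    Complex.normSq (M.1.1 0 0) - Complex.normSq (M.1.1 0 1) = 1 := by
  obtain ⟨M, h1, h2⟩ := M
  have hdet := M.2
  rw [Matrix.det_fin_two, h1, h2] at hdet
  have := congrArg Complex.re hdet
  simpa [Complex.normSq_apply, Complex.mul_re] using this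

theorem den_ne_zero (M : SU11) {z : ℂ} (hz : ‖z‖ ≤ 1) : den M z ≠ 0 := by
  intro h
  have hd := normSq_sub M
  obtain ⟨M, h1, h2⟩ := M
  simp only [den, h1, h2] at h hd
  have h3 : star (M.1 0 1) * z = - star (M.1 0 0) := by linear_combination h
  have h4 := congrArg norm h3
  simp only [norm_mul, norm_star, norm_neg] at h4
  rw [Complex.normSq_eq_norm_sq, Complex.normSq_eq_norm_sq] at hd
  have h5 : ‖M.1 0 0‖ ≤ ‖M.1 0 1‖ := by
    rw [← h4]; exact mul_le_of_le_one_right (norm_nonneg _) hz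
  nlinarith [norm_nonneg (M.1 0 0), norm_nonneg (M.1 0 1)]

theorem normSq_den_pos (M : SU11) {z : ℂ} (hz : ‖z‖ ≤ 1) : 0 < Complex.normSq (den M z) :=
  Complex.normSq_pos.2 (den_ne_zero M hz)

theorem mob_mul_den (M : SU11) {z : ℂ} (hz : ‖z‖ ≤ 1) :
    mob M z * den M z = M.1.1 0 0 * z + M.1.1 0 1 := div_mul_cancel₀ _ (den_ne_zero M hz)

/-- Together with `linT_lift`: the linear action sends the lift of `z` to the lift of its image
times the positive number `normSq (den M z)`. This is why signs of side functions are invariant. -/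
theorem linX_lift (M : SU11) {z : ℂ} (hz : ‖z‖ ≤ 1) :
    linX (M.1.1 0 0) (M.1.1 0 1) (2 * z) (1 + ‖z‖ ^ 2) =
      Complex.normSq (den M z) * (2 * mob M z) := by
  have h := mob_mul_den M hz
  rw [Complex.normSq_eq_conj_mul_self]
  have e : (starRingEnd ℂ) (den M z) * den M z * (2 * mob M z) =
      2 * (starRingEnd ℂ) (den M z) * (M.1.1 0 0 * z + M.1.1 0 1) := by rw [← h]; ring
  rw [e]
  obtain ⟨M, h1, h2⟩ := M
  simp only [linX, den, h1, h2]
  have hn : ((‖z‖ : ℂ)) ^ 2 = z * star z := by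
    rw [Complex.star_def, Complex.mul_conj, Complex.normSq_eq_norm_sq]; push_cast; rfl
  push_cast
  rw [hn]
  simp
  ring

theorem linT_lift (M : SU11) {z : ℂ} (hz : ‖z‖ ≤ 1) :
    linT (M.1.1 0 0) (M.1.1 0 1) (2 * z) (1 + ‖z‖ ^ 2) =
      Complex.normSq (den M z) * (1 + ‖mob M z‖ ^ 2) := by
  have h := congrArg Complex.normSq (mob_mul_den M hz)
  rw [Complex.normSq_mul] at h
  rw [← Complex.normSq_eq_norm_sq, ← Complex.normSq_eq_norm_sq, mul_add, mul_one,
    mul_comm _ (Complex.normSq (mob M z)), h]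
  obtain ⟨M, h1, h2⟩ := M
  simp only [linT, den, h1, h2]
  simp [Complex.normSq_apply, Complex.mul_re, Complex.mul_im]
  ring

theorem norm_mob_lt (M : SU11) {z : ℂ} (hz : ‖z‖ < 1) : ‖mob M z‖ < 1 := by
  have h := congrArg Complex.normSq (mob_mul_den M hz.le)
  rw [Complex.normSq_mul] at h
  have hp := normSq_den_pos M hz.le
  have hd := normSq_sub M
  have hz2 : Complex.normSq z < 1 := by
    rw [Complex.normSq_eq_norm_sq]; nlinarith [norm_nonneg z]
  have key : Complex.normSq (den M z) - Complex.normSq (M.1.1 0 0 * z + M.1.1 0 1) =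
      (Complex.normSq (M.1.1 0 0) - Complex.normSq (M.1.1 0 1)) * (1 - Complex.normSq z) := by
    obtain ⟨M, h1, h2⟩ := M
    simp only [den, h1, h2]
    simp [Complex.normSq_apply, Complex.mul_re, Complex.mul_im]
    ring
  rw [hd, ← h] at key
  have : Complex.normSq (mob M z) < 1 := by
    by_contra hc
    push Not at hc
    nlinarith
  rw [Complex.normSq_eq_norm_sq] at this
  nlinarith [norm_nonneg (mob M z)]

theorem sideFn_mob_eq (M : SU11) (u w : Circle) {z : ℂ} (hz : ‖z‖ ≤ 1) :
    sideFn u w z = Complex.normSq (den M u) * Complex.normSq (den M w) *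
      Complex.normSq (den M z) * sideFn (onCircle M u) (onCircle M w) (mob M z) := by
  have hu : ‖(u : ℂ)‖ ≤ 1 := (Circle.norm_coe u).le
  have hw : ‖(w : ℂ)‖ ≤ 1 := (Circle.norm_coe w).le
  have h := det3_lin (M.1.1 0 0) (M.1.1 0 1) (2 * u) (2 * w) (2 * z) (1 + ‖(u : ℂ)‖ ^ 2)
    (1 + ‖(w : ℂ)‖ ^ 2) (1 + ‖z‖ ^ 2)
  rw [linX_lift M hu, linX_lift M hw, linX_lift M hz, linT_lift M hu, linT_lift M hw,
    linT_lift M hz, normSq_sub M, norm_mob_circle, norm_mob_circle] at h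
  rw [sideFn_eq_det3, sideFn_eq_det3]
  change _ = _ * det3 (mob M u) (mob M w) _ _ _ _
  simp only [det3, Circle.norm_coe, Complex.ofReal_re, Complex.ofReal_im, Complex.mul_re,
    Complex.mul_im, Complex.re_ofNat, Complex.im_ofNat] at h ⊢
  linear_combination -h / 4

theorem sideFn_mob (M : SU11) (u w : Circle) {z : ℂ} (hz : ‖z‖ ≤ 1) :
    ∃ c : ℝ, 0 < c ∧ sideFn u w z = c * sideFn (onCircle M u) (onCircle M w) (mob M z) :=
  ⟨_, mul_pos (mul_pos (normSq_den_pos M (Circle.norm_coe u).le)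
    (normSq_den_pos M (Circle.norm_coe w).le)) (normSq_den_pos M hz), sideFn_mob_eq M u w hz⟩

theorem mob_mul (M N : SU11) {z : ℂ} (hz : ‖z‖ ≤ 1) : mob (M * N) z = mob M (mob N z) := by
  have hN := den_ne_zero N hz
  have h := mob_mul_den N hz
  have hM : ‖mob N z‖ ≤ 1 := by
    rcases hz.lt_or_eq with h | h
    · exact (norm_mob_lt N h).le
    · exact (norm_mob_circle N ⟨z, mem_sphere_zero_iff_norm.mpr h⟩).le
  have h2 := mob_mul_den M hM
  have h3 := mob_mul_den (M * N) hz
  have h4 := den_ne_zero (M * N) hz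
  have e1 : den (M * N) z = den M (mob N z) * den N z := by
    have : den M (mob N z) * den N z = M.1.1 1 0 * (mob N z * den N z) + M.1.1 1 1 * den N z := by
      simp only [den]; ring
    rw [this, h]
    simp [den, Matrix.mul_apply, Fin.sum_univ_two]; ring
  have e2 : mob (M * N) z * den (M * N) z = mob M (mob N z) * den (M * N) z := by
    rw [h3, e1, ← mul_assoc, h2]
    have : (M.1.1 0 0 * mob N z + M.1.1 0 1) * den N z =
      M.1.1 0 0 * (mob N z * den N z) + M.1.1 0 1 * den N z := by ring
    rw [this, h]
    simp [den, Matrix.mul_apply, Fin.sum_univ_two]; ring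
  exact mul_right_cancel₀ h4 e2

theorem onCircle_mul (M N : SU11) (x : Circle) :
    onCircle (M * N) x = onCircle M (onCircle N x) :=
  Subtype.ext (mob_mul M N (Circle.norm_coe x).le)

theorem mob_one (z : ℂ) : mob 1 z = z := by simp [mob]

theorem onCircle_one (x : Circle) : onCircle 1 x = x := Subtype.ext (mob_one _)

/-- The hypothesis concerns interior points only. Fixing `0` makes the off-diagonal entries vanish
and fixing `1/2` then equates the diagonal ones, so the formula is the identity on the circle too.
-/
theorem onCircle_of_actsTrivially {M : SU11} (h : ActsTrivially M) (x : Circle) :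
    onCircle M x = x := by
  have h0 := h 0 (by simp)
  have h1 := h (1 / 2) (by norm_num)
  have d0 := den_ne_zero M (z := 0) (by simp)
  have d1 := den_ne_zero M (z := 1 / 2) (by norm_num)
  have m0 := mob_mul_den M (z := 0) (by simp)
  have m1 := mob_mul_den M (z := 1 / 2) (by norm_num)
  have mx := mob_mul_den M (z := x) (Circle.norm_coe x).le
  have dx := den_ne_zero M (z := x) (Circle.norm_coe x).le
  rw [h0] at m0
  rw [h1] at m1
  obtain ⟨M, e1, e2⟩ := M
  have b0 : M.1 0 1 = 0 := by simpa using m0.symm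
  have c0 : M.1 1 0 = 0 := by rw [e2, b0, star_zero]
  simp only [den, b0, c0] at m1 mx dx
  have e : M.1 1 1 = M.1 0 0 := by linear_combination 2 * m1
  apply Subtype.ext
  simp only [zero_mul, zero_add, add_zero] at mx dx
  apply mul_right_cancel₀ dx
  change mob _ (x : ℂ) * _ = _
  linear_combination mx - (x : ℂ) * e

theorem onCircle_injective (M : SU11) : Function.Injective (onCircle M) := by
  intro x y h
  have := congrArg (onCircle M⁻¹) h
  rwa [← onCircle_mul, ← onCircle_mul, inv_mul_cancel, onCircle_one, onCircle_one] at this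

theorem orient_onCircle (M : SU11) (a b c : Circle) : ∃ k : ℝ, 0 < k ∧
    orient a b c = k * orient (onCircle M a) (onCircle M b) (onCircle M c) := by
  obtain ⟨k, hk, h⟩ := sideFn_mob M a b (z := c) (Circle.norm_coe c).le
  refine ⟨k, hk, ?_⟩
  have e : mob M c = (onCircle M c : ℂ) := rfl
  rw [e, sideFn_circle, sideFn_circle] at h
  linarith

theorem ccw_iff (M : SU11) {a b c : Circle} :
    CCW (onCircle M a) (onCircle M b) (onCircle M c) ↔ CCW a b c := by
  obtain ⟨k, hk, h⟩ := orient_onCircle M a b c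
  rw [_root_.ccw_iff, _root_.ccw_iff, h, mul_pos_iff_of_pos_left hk]

theorem arcCC_iff (M : SU11) {a b x : Circle} :
    onCircle M x ∈ arcCC (onCircle M a) (onCircle M b) ↔ x ∈ arcCC a b := by
  simp only [arcCC, mem_ofPred_eq, SU11.ccw_iff M, (onCircle_injective M).eq_iff]

theorem sideFn_mob_pos (M : SU11) {u w : Circle} {z : ℂ} (hz : ‖z‖ < 1) :
    0 < sideFn (onCircle M u) (onCircle M w) (mob M z) ↔ 0 < sideFn u w z := by
  obtain ⟨k, hk, h⟩ := sideFn_mob M u w hz.le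
  rw [h, mul_pos_iff_of_pos_left hk]

theorem sideFn_mob_eq_zero (M : SU11) {u w : Circle} {z : ℂ} (hz : ‖z‖ < 1) :
    sideFn (onCircle M u) (onCircle M w) (mob M z) = 0 ↔ sideFn u w z = 0 := by
  obtain ⟨k, hk, h⟩ := sideFn_mob M u w hz.le
  rw [h, mul_eq_zero, or_iff_right hk.ne']

theorem sideFn_mob_neg (M : SU11) {u w : Circle} {z : ℂ} (hz : ‖z‖ < 1) :
    sideFn (onCircle M u) (onCircle M w) (mob M z) < 0 ↔ sideFn u w z < 0 := by
  obtain ⟨k, hk, h⟩ := sideFn_mob M u w hz.le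
  rw [h, mul_neg_iff]
  constructor
  · intro h; exact Or.inl ⟨hk, h⟩
  · rintro (h | h)
    · exact h.2
    · linarith [h.1]

theorem mob_mem_geodesic (M : SU11) {u w : Circle} {z : ℂ} (hz : z ∈ geodesic u w) :
    mob M z ∈ geodesic (onCircle M u) (onCircle M w) :=
  ⟨norm_mob_lt M hz.1, (sideFn_mob_eq_zero M hz.1).2 hz.2⟩

end SU11

noncomputable section

/-! ### Circular order -/

/-- The angle in `[0, 2π)` of a point of the circle, measured from the base point `b`. -/
def angleFrom (b x : Circle) : ℝ :=
  if Complex.arg ((x / b : Circle) : ℂ) < 0 then Complex.arg ((x / b : Circle) : ℂ) + 2 * Real.pi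
  else Complex.arg ((x / b : Circle) : ℂ)

theorem angleFrom_nonneg (b x : Circle) : 0 ≤ angleFrom b x := by
  have := Complex.neg_pi_lt_arg ((x / b : Circle) : ℂ)
  have := Real.pi_pos
  unfold angleFrom; split_ifs <;> linarith

theorem angleFrom_lt (b x : Circle) : angleFrom b x < 2 * Real.pi := by
  have := Complex.arg_le_pi ((x / b : Circle) : ℂ)
  have := Real.pi_pos
  unfold angleFrom; split_ifs <;> linarith

theorem mul_exp_angleFrom (b x : Circle) : b * Circle.exp (angleFrom b x) = x := by
  have h : Circle.exp (Complex.arg ((x / b : Circle) : ℂ)) = x / b := Circle.exp_arg _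
  have : Circle.exp (angleFrom b x) = x / b := by
    unfold angleFrom; split_ifs
    · rw [Circle.exp_add, h, Circle.exp_two_pi, mul_one]
    · exact h
  rw [this, mul_div_cancel]

theorem angleFrom_self (b : Circle) : angleFrom b b = 0 := by
  simp [angleFrom]

theorem angleFrom_injective (b : Circle) : Function.Injective (angleFrom b) := by
  intro x y h
  rw [← mul_exp_angleFrom b x, h, mul_exp_angleFrom]

/-- The half differences of angles from a common cut lie in `(-π, π)`, so the sign of each sine is
the sign of a difference of angles and the product encodes the order. -/
theorem orient_mul_exp (b : Circle) (p q r : ℝ) :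
    orient (b * Circle.exp p) (b * Circle.exp q) (b * Circle.exp r) =
      4 * Real.sin ((q - p) / 2) * Real.sin ((r - q) / 2) * Real.sin ((r - p) / 2) := by
  have e : 4 * Real.sin ((q - p) / 2) * Real.sin ((r - q) / 2) * Real.sin ((r - p) / 2) =
      Real.sin (q - p) + Real.sin (r - q) - Real.sin (r - p) := by
    obtain ⟨A, hA⟩ : ∃ A, A = (q - p) / 2 := ⟨_, rfl⟩
    obtain ⟨B, hB⟩ : ∃ B, B = (r - q) / 2 := ⟨_, rfl⟩
    have e1 : (r - p) / 2 = A + B := by rw [hA, hB]; ring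
    have e2 : r - p = 2 * (A + B) := by rw [hA, hB]; ring
    have e3 : q - p = 2 * A := by rw [hA]; ring
    have e4 : r - q = 2 * B := by rw [hB]; ring
    rw [← hA, ← hB, e1, e2, e3, e4, Real.sin_two_mul, Real.sin_two_mul, Real.sin_two_mul,
      Real.sin_add, Real.cos_add]
    linear_combination (2 * Real.sin A * Real.cos A) * Real.sin_sq_add_cos_sq B +
      (2 * Real.sin B * Real.cos B) * Real.sin_sq_add_cos_sq A
  have hb : (b : ℂ).re * (b : ℂ).re + (b : ℂ).im * (b : ℂ).im = 1 := by
    have := Circle.normSq_coe b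
    rwa [Complex.normSq_apply] at this
  rw [e, orient_eq, Real.sin_sub, Real.sin_sub, Real.sin_sub]
  simp only [Circle.coe_mul, Circle.coe_exp, Complex.mul_re, Complex.mul_im,
    Complex.exp_ofReal_mul_I_re, Complex.exp_ofReal_mul_I_im]
  linear_combination (Real.sin q * Real.cos p - Real.cos q * Real.sin p + (Real.sin r * Real.cos q
    - Real.cos r * Real.sin q) - (Real.sin r * Real.cos p - Real.cos r * Real.sin p)) * hb

theorem sin_half_pos_iff {d : ℝ} (h1 : -(2 * Real.pi) < d) (h2 : d < 2 * Real.pi) :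
    0 < Real.sin (d / 2) ↔ 0 < d := by
  constructor
  · intro h
    by_contra hc
    have := Real.sin_nonpos_of_nonpos_of_neg_pi_le (x := d / 2) (by linarith) (by linarith)
    linarith
  · intro h
    exact Real.sin_pos_of_pos_of_lt_pi (by linarith) (by linarith)

theorem sin_half_neg_iff {d : ℝ} (h1 : -(2 * Real.pi) < d) (h2 : d < 2 * Real.pi) :
    Real.sin (d / 2) < 0 ↔ d < 0 := by
  have := sin_half_pos_iff (d := -d) (by linarith) (by linarith)
  rw [neg_div, Real.sin_neg] at this
  simpa using this

/-- Cutting the circle at `b` turns the circular order into the order of real numbers. -/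
theorem ccw_iff_angleFrom (b x y z : Circle) : CCW x y z ↔
    (angleFrom b x < angleFrom b y ∧ angleFrom b y < angleFrom b z) ∨
    (angleFrom b y < angleFrom b z ∧ angleFrom b z < angleFrom b x) ∨
    (angleFrom b z < angleFrom b x ∧ angleFrom b x < angleFrom b y) := by
  have hx := angleFrom_nonneg b x
  have hy := angleFrom_nonneg b y
  have hz := angleFrom_nonneg b z
  have hx' := angleFrom_lt b x
  have hy' := angleFrom_lt b y
  have hz' := angleFrom_lt b z
  have h := orient_mul_exp b (angleFrom b x) (angleFrom b y) (angleFrom b z)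
  rw [mul_exp_angleFrom, mul_exp_angleFrom, mul_exp_angleFrom] at h
  rw [ccw_iff, h, mul_assoc, mul_assoc, mul_pos_iff_of_pos_left (by norm_num), mul_pos_iff,
    mul_pos_iff, mul_neg_iff, sin_half_pos_iff (by linarith) (by linarith),
    sin_half_pos_iff (by linarith) (by linarith), sin_half_pos_iff (by linarith) (by linarith),
    sin_half_neg_iff (by linarith) (by linarith),
    sin_half_neg_iff (by linarith) (by linarith), sin_half_neg_iff (by linarith) (by linarith)]
  simp only [sub_pos, sub_neg]
  generalize angleFrom b x = p
  generalize angleFrom b y = q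
  generalize angleFrom b z = r
  grind

/-- Hides the trigonometry: later order questions are questions about finitely many real numbers. -/
theorem exists_cut (b : Circle) : ∃ f : Circle → ℝ, Function.Injective f ∧ f b = 0 ∧
    (∀ x, 0 ≤ f x) ∧ ∀ x y z, CCW x y z ↔
      (f x < f y ∧ f y < f z) ∨ (f y < f z ∧ f z < f x) ∨ (f z < f x ∧ f x < f y) :=
  ⟨angleFrom b, angleFrom_injective b, angleFrom_self b, angleFrom_nonneg b, ccw_iff_angleFrom b⟩

/-! ### One-sided approach to a point of the circle, and symmetries of the orientation. -/

theorem tendsto_mul_exp (u : Circle) (s : ℝ) :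
    Filter.Tendsto (fun t : ℝ => u * Circle.exp (s * t)) (𝓝[>] 0) (𝓝 u) := by
  have : Continuous (fun t : ℝ => u * Circle.exp (s * t)) := by fun_prop
  have h := this.tendsto 0
  simp only [mul_zero, Circle.exp_zero, mul_one] at h
  exact h.mono_left nhdsWithin_le_nhds

theorem mem_closure_ccw_left {w u : Circle} (h : w ≠ u) : u ∈ closure {x | CCW w x u} := by
  refine mem_closure_of_tendsto (tendsto_mul_exp u (-1)) ?_
  have hp : 0 < angleFrom w u := (angleFrom_nonneg w u).lt_of_ne fun h0 =>
    h (angleFrom_injective w ((angleFrom_self w).trans h0))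
  have hl := angleFrom_lt w u
  filter_upwards [Ioo_mem_nhdsGT hp] with t ht
  have := orient_mul_exp w 0 (angleFrom w u + (-1) * t) (angleFrom w u)
  rw [Circle.exp_zero, mul_one, Circle.exp_add, ← mul_assoc, mul_exp_angleFrom] at this
  change 0 < orient _ _ _
  rw [this]
  have h1 := ht.1
  have h2 := ht.2
  refine mul_pos (mul_pos (mul_pos (by norm_num) ?_) ?_) ?_ <;>
    exact Real.sin_pos_of_pos_of_lt_pi (by linarith) (by linarith)

theorem mem_closure_ccw_right {w u : Circle} (h : w ≠ u) : u ∈ closure {x | CCW u x w} := by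
  refine mem_closure_of_tendsto (tendsto_mul_exp u 1) ?_
  have hp : 0 < angleFrom u w := (angleFrom_nonneg u w).lt_of_ne fun h0 =>
    h (angleFrom_injective u ((angleFrom_self u).trans h0)).symm
  have hl := angleFrom_lt u w
  filter_upwards [Ioo_mem_nhdsGT hp] with t ht
  have := orient_mul_exp u 0 (1 * t) (angleFrom u w)
  rw [Circle.exp_zero, mul_one, mul_exp_angleFrom] at this
  change 0 < orient _ _ _
  rw [this]
  have h1 := ht.1
  have h2 := ht.2
  refine mul_pos (mul_pos (mul_pos (by norm_num) ?_) ?_) ?_ <;>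
    exact Real.sin_pos_of_pos_of_lt_pi (by linarith) (by linarith)

theorem orient_rotate (a b c : Circle) : orient a b c = orient b c a := by
  simp only [orient_eq]; ring

theorem orient_swap (a b c : Circle) : orient b a c = - orient a b c := by
  simp only [orient_eq]; ring

theorem orient_self_left (a c : Circle) : orient a a c = 0 := by simp [orient_eq]

theorem orient_self_right (a c : Circle) : orient a c c = 0 := by
  rw [orient_rotate, orient_rotate, orient_rotate]
  simp only [orient_eq]; ring

theorem orient_self_mid (a c : Circle) : orient a c a = 0 := by simp [orient_eq]

theorem ccw_rotate {a b c : Circle} : CCW a b c ↔ CCW b c a := by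
  rw [ccw_iff, ccw_iff, orient_rotate]

theorem orient_neg_iff {a b c : Circle} : orient a b c < 0 ↔ CCW b a c := by
  rw [ccw_iff, orient_swap]; simp

theorem orient_eq_zero_iff {a b c : Circle} : orient a b c = 0 ↔ a = b ∨ b = c ∨ a = c := by
  constructor
  · intro h
    obtain ⟨f, hf, -, -, hc⟩ := exists_cut a
    have h1 : ¬ CCW a b c := by rw [ccw_iff]; linarith
    have h2 : ¬ CCW b a c := by rw [← orient_neg_iff]; linarith
    rw [hc] at h1 h2
    rw [← hf.eq_iff, ← hf.eq_iff (a := b), ← hf.eq_iff (b := c)]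
    grind
  · rintro (rfl | rfl | rfl)
    · exact orient_self_left _ _
    · exact orient_self_right _ _
    · exact orient_self_mid _ _

/-! ### Lifts of points of geodesics -/

theorem norm_sq_comb (u w : Circle) (α β : ℝ) :
    ‖(α * u + β * w : ℂ)‖ ^ 2 = (α + β) ^ 2 - α * β * ‖(u - w : ℂ)‖ ^ 2 := by
  have hu := Circle.normSq_coe u
  have hw := Circle.normSq_coe w
  rw [← Complex.normSq_eq_norm_sq, ← Complex.normSq_eq_norm_sq]
  rw [Complex.normSq_apply] at hu hw ⊢
  rw [Complex.normSq_apply]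
  simp only [Complex.add_re, Complex.add_im, Complex.sub_re, Complex.sub_im,
    Complex.re_ofReal_mul, Complex.im_ofReal_mul]
  linear_combination (α ^ 2 + α * β) * hu + (β ^ 2 + α * β) * hw

theorem norm_sub_pos {u w : Circle} (h : u ≠ w) : 0 < ‖(u - w : ℂ)‖ :=
  norm_pos_iff.2 (sub_ne_zero.2 fun e => h (Circle.ext e))

/-- The vanishing of `sideFn` makes `2z - (1 + ‖z‖²)u` a real multiple of `w - u`, which yields the
coefficients. As `‖z‖ < 1`, the lift lies strictly inside the cone, which forces `αβ > 0`; the sign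
follows from `α + β > 0`. -/
theorem geodesic_lift {u w : Circle} (h : u ≠ w) {z : ℂ} (hz : z ∈ geodesic u w) :
    ∃ α β : ℝ, 0 < α ∧ 0 < β ∧ 2 * z = α * u + β * w ∧ 1 + ‖z‖ ^ 2 = α + β := by
  obtain ⟨hz1, hz0⟩ := hz
  have hd := norm_sub_pos h
  have hw0 : (w - u : ℂ) ≠ 0 := by
    rw [← norm_pos_iff, norm_sub_rev]; exact hd
  obtain ⟨q, hq⟩ : ∃ q, q = 2 * z - (1 + (‖z‖ : ℂ) ^ 2) * u := ⟨_, rfl⟩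
  obtain ⟨β, hβ⟩ : ∃ β : ℝ, q = β * (w - u) := by
    refine ⟨(star ((w : ℂ) - u) * q).re / Complex.normSq ((w : ℂ) - u), ?_⟩
    have h1 : star ((w : ℂ) - u) * q = ((star ((w : ℂ) - u) * q).re : ℂ) := by
      apply Complex.ext
      · simp
      · rw [Complex.ofReal_im, hq]; exact hz0
    push_cast
    rw [← h1, Complex.normSq_eq_conj_mul_self]
    have : (starRingEnd ℂ) ((w : ℂ) - u) ≠ 0 :=
      (map_ne_zero (starRingEnd ℂ)).2 hw0
    rw [Complex.star_def]
    field_simp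
  obtain ⟨α, hα⟩ : ∃ α : ℝ, α = 1 + ‖z‖ ^ 2 - β := ⟨_, rfl⟩
  have e1 : 2 * z = α * u + β * w := by
    rw [hα]; push_cast; linear_combination -hq + hβ
  have e2 : 1 + ‖z‖ ^ 2 = α + β := by rw [hα]; ring
  have e3 := norm_sq_comb u w α β
  rw [← e1, ← e2, norm_mul] at e3
  have hz2 : ‖z‖ ^ 2 < 1 := by nlinarith [norm_nonneg z]
  have e4 : 0 < α * β := by
    have : α * β * ‖(u - w : ℂ)‖ ^ 2 = (1 - ‖z‖ ^ 2) ^ 2 := by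
      simp at e3; linear_combination e3
    have h3 : 0 < α * β * ‖(u - w : ℂ)‖ ^ 2 := by
      rw [this]; exact pow_pos (by linarith) 2
    exact pos_of_mul_pos_left h3 (by positivity)
  have e5 : 0 < α + β := by rw [← e2]; positivity
  refine ⟨α, β, ?_, ?_, e1, e2⟩ <;> rcases mul_pos_iff.1 e4 with h | h <;> linarith [h.1, h.2]

theorem exists_lift {x : ℂ} {t : ℝ} (h : ‖x‖ < t) :
    ∃ z : ℂ, ‖z‖ < 1 ∧ ∃ c : ℝ, 0 < c ∧ 2 * z = c * x ∧ 1 + ‖z‖ ^ 2 = c * t := by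
  have hx := norm_nonneg x
  have ht : 0 < t := by linarith
  obtain ⟨s, hs⟩ : ∃ s, s = Real.sqrt (t ^ 2 - ‖x‖ ^ 2) := ⟨_, rfl⟩
  have hs0 : 0 ≤ s := by rw [hs]; positivity
  have hs2 : s ^ 2 = t ^ 2 - ‖x‖ ^ 2 := by rw [hs, Real.sq_sqrt]; nlinarith
  have hp : 0 < t + s := by linarith
  have hn : ‖((1 / (t + s) : ℝ) * x : ℂ)‖ = ‖x‖ / (t + s) := by
    rw [norm_mul, Complex.norm_real, Real.norm_of_nonneg (by positivity)]; ring
  -- The conditions on `z` give a quadratic equation for the scale `c`; this root is the one with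
  -- `z` inside the disc.
  refine ⟨(1 / (t + s) : ℝ) * x, ?_, 2 / (t + s), by positivity, ?_, ?_⟩
  · rw [hn, div_lt_one hp]; linarith
  · push_cast; ring
  · rw [hn]; field_simp; linarith

theorem norm_comb_lt {u w : Circle} (h : u ≠ w) {α β : ℝ} (hα : 0 < α) (hβ : 0 < β) :
    ‖(α * u + β * w : ℂ)‖ < α + β := by
  have h1 := norm_sq_comb u w α β
  have h2 : 0 < α * β * ‖(u - w : ℂ)‖ ^ 2 := by
    have := norm_sub_pos h
    positivity
  exact lt_of_pow_lt_pow_left₀ 2 (by positivity) (by linarith)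

theorem sideFn_of_lift {z x y : ℂ} {α β s t : ℝ} (a b : Circle) (h1 : 2 * z = α * x + β * y)
    (h2 : 1 + ‖z‖ ^ 2 = α * s + β * t) :
    sideFn a b z = α * det3 a b x 1 1 s + β * det3 a b y 1 1 t := by
  rw [sideFn_eq_det3, h1, h2]
  simp only [det3, Complex.add_re, Complex.add_im, Complex.re_ofReal_mul, Complex.im_ofReal_mul]
  ring

theorem sideFn_of_circle_lift {z : ℂ} {u w : Circle} {α β : ℝ} (a b : Circle)
    (h1 : 2 * z = α * u + β * w) (h2 : 1 + ‖z‖ ^ 2 = α + β) :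
    sideFn a b z = α * orient a b u + β * orient a b w := by
  rw [sideFn_of_lift a b h1 (s := 1) (t := 1) (by linarith), orient_eq_det3, orient_eq_det3]

/-- The point of this form is that the coefficients do not depend on `a` and `b`: one pair serves
for all side functions at once. -/
theorem geodesic_comb {u w : Circle} (h : u ≠ w) {z : ℂ} (hz : z ∈ geodesic u w) :
    ∃ α β : ℝ, 0 < α ∧ 0 < β ∧ ∀ a b, sideFn a b z = α * orient a b u + β * orient a b w := by
  obtain ⟨α, β, hα, hβ, h1, h2⟩ := geodesic_lift h hz
  exact ⟨α, β, hα, hβ, fun a b => sideFn_of_circle_lift a b h1 h2⟩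

theorem exists_mem_geodesic {u w : Circle} (h : u ≠ w) {α β : ℝ} (hα : 0 < α) (hβ : 0 < β) :
    ∃ z ∈ geodesic u w, ∃ c : ℝ, 0 < c ∧ 2 * z = (c * α : ℝ) * u + (c * β : ℝ) * w ∧
      1 + ‖z‖ ^ 2 = c * α + c * β ∧
      ∀ a b, sideFn a b z = c * (α * orient a b u + β * orient a b w) := by
  obtain ⟨z, hz, c, hc, h1, h2⟩ := exists_lift (norm_comb_lt h hα hβ)
  have h1' : 2 * z = (c * α : ℝ) * u + (c * β : ℝ) * w := by rw [h1]; push_cast; ring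
  have h2' : 1 + ‖z‖ ^ 2 = c * α + c * β := by rw [h2]; ring
  have h3 := fun a b => sideFn_of_circle_lift a b h1' h2'
  refine ⟨z, ⟨hz, ?_⟩, c, hc, h1', h2', fun a b => by rw [h3]; ring⟩
  rw [h3, orient_self_mid, orient_self_right]; ring

/-- Points on the hyperbolic segment between two points. -/
theorem exists_combination {z₁ z₂ : ℂ} (h₁ : ‖z₁‖ < 1) (h₂ : ‖z₂‖ ≤ 1) {α β : ℝ} (hα : 0 < α)
    (hβ : 0 ≤ β) : ∃ z : ℂ, ‖z‖ < 1 ∧ ∃ c : ℝ, 0 < c ∧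
      ∀ a b, sideFn a b z = c * (α * sideFn a b z₁ + β * sideFn a b z₂) := by
  have k1 : ‖(2 * z₁ : ℂ)‖ < 1 + ‖z₁‖ ^ 2 := by
    rw [norm_mul, Complex.norm_ofNat]; nlinarith [norm_nonneg z₁]
  have k2 : ‖(2 * z₂ : ℂ)‖ ≤ 1 + ‖z₂‖ ^ 2 := by
    rw [norm_mul, Complex.norm_ofNat]; nlinarith [norm_nonneg z₂]
  have k : ‖(α * (2 * z₁) + β * (2 * z₂) : ℂ)‖ < α * (1 + ‖z₁‖ ^ 2) + β * (1 + ‖z₂‖ ^ 2) := by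
    refine (norm_add_le _ _).trans_lt ?_
    rw [norm_mul, norm_mul (β : ℂ), Complex.norm_real, Complex.norm_real,
      Real.norm_of_nonneg hα.le, Real.norm_of_nonneg hβ]
    have := mul_lt_mul_of_pos_left k1 hα
    have := mul_le_mul_of_nonneg_left k2 hβ
    linarith
  obtain ⟨z, hz, c, hc, h1, h2⟩ := exists_lift k
  refine ⟨z, hz, c, hc, fun a b => ?_⟩
  rw [sideFn_of_lift a b (x := 2 * z₁) (y := 2 * z₂) (α := c * α) (β := c * β)
    (s := 1 + ‖z₁‖ ^ 2) (t := 1 + ‖z₂‖ ^ 2) (by rw [h1]; push_cast; ring) (h2.trans (by ring)),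
    sideFn_eq_det3, sideFn_eq_det3]
  ring

/-- Along a geodesic the distance to the endpoint decreases. -/
theorem lift_lt_of_norm_le {u w : Circle} (h : u ≠ w) {z z' : ℂ} {α β α' β' : ℝ}
    (hz : ‖z‖ < 1) (hz' : ‖z'‖ < 1)
    (hα : 0 < α) (hβ : 0 < β) (hα' : 0 < α') (hβ' : 0 < β')
    (h1 : 2 * z = α * u + β * w) (h2 : 1 + ‖z‖ ^ 2 = α + β)
    (h1' : 2 * z' = α' * u + β' * w) (h2' : 1 + ‖z'‖ ^ 2 = α' + β') :
    ‖z - w‖ ≤ ‖z' - w‖ ↔ α * β' ≤ α' * β := by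
  have hd := norm_sub_pos h
  -- The distance to `w` depends on `α` alone.
  have dist : ∀ {z : ℂ} {α β : ℝ}, 2 * z = α * u + β * w → 1 + ‖z‖ ^ 2 = α + β →
      ‖z - w‖ ^ 2 = α * (‖(u - w : ℂ)‖ ^ 2 / 2) := by
    intro z α β h1 h2
    have hu := Circle.normSq_coe u
    have hw := Circle.normSq_coe w
    have hr := congrArg Complex.re h1
    have hi := congrArg Complex.im h1
    rw [← Complex.normSq_eq_norm_sq] at h2 ⊢
    rw [← Complex.normSq_eq_norm_sq]
    rw [Complex.normSq_apply] at hu hw h2 ⊢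
    rw [Complex.normSq_apply]
    simp only [Complex.add_re, Complex.add_im, Complex.ofReal_re, Complex.ofReal_im,
      Complex.mul_re, Complex.mul_im, Complex.re_ofNat, Complex.im_ofNat, Complex.sub_re,
      Complex.sub_im] at hr hi ⊢
    linear_combination h2 - (w : ℂ).re * hr - (w : ℂ).im * hi + (1 - β - α / 2) * hw -
      α / 2 * hu
  -- The relation between the two components of a lift ties `β` to `α`.
  have norm : ∀ {z : ℂ} {α β : ℝ}, 2 * z = α * u + β * w → 1 + ‖z‖ ^ 2 = α + β →
      (2 - (α + β)) ^ 2 = α * β * ‖(u - w : ℂ)‖ ^ 2 := by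
    intro z α β h1 h2
    have e3 := norm_sq_comb u w α β
    rw [← h1, ← h2, norm_mul, Complex.norm_ofNat] at e3
    rw [← h2]
    linear_combination -e3
  have n := norm h1 h2
  have n' := norm h1' h2'
  have e1 : ‖z - w‖ ≤ ‖z' - w‖ ↔ α ≤ α' := by
    rw [← pow_le_pow_iff_left₀ (norm_nonneg _) (norm_nonneg _) two_ne_zero, dist h1 h2,
      dist h1' h2', mul_le_mul_iff_left₀ (by positivity)]
  have s : α + β < 2 := by rw [← h2]; nlinarith [norm_nonneg z]
  have s' : α' + β' < 2 := by rw [← h2']; nlinarith [norm_nonneg z']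
  -- If both coefficients grew, the left side of the relation would strictly decrease while the
  -- right side would not.
  have mono : ∀ {α β α' β' : ℝ}, 0 < α → 0 < β → 0 < α' → 0 < β' → α + β < 2 → α' + β' < 2 →
      (2 - (α + β)) ^ 2 = α * β * ‖(u - w : ℂ)‖ ^ 2 →
      (2 - (α' + β')) ^ 2 = α' * β' * ‖(u - w : ℂ)‖ ^ 2 → α < α' → β' < β := by
    intro α β α' β' hα hβ hα' hβ' s s' n n' hlt
    by_contra hc
    push Not at hc
    have i1 : (2 - (α' + β')) ^ 2 < (2 - (α + β)) ^ 2 := by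
      apply pow_lt_pow_left₀ (by linarith) (by linarith) two_ne_zero
    have i2 : α * β ≤ α' * β' := mul_le_mul hlt.le hc hβ.le hα'.le
    have i3 := mul_le_mul_of_nonneg_right i2 (sq_nonneg ‖(u - w : ℂ)‖)
    linarith
  rw [e1]
  constructor
  · intro hle
    rcases hle.lt_or_eq with hlt | rfl
    · have := mono hα hβ hα' hβ' s s' n n' hlt
      nlinarith
    · by_contra hc
      push Not at hc
      have : β < β' := lt_of_mul_lt_mul_left hc hα.le
      have i1 : (2 - (α + β')) ^ 2 < (2 - (α + β)) ^ 2 := by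
        apply pow_lt_pow_left₀ (by linarith) (by linarith) two_ne_zero
      have i3 := mul_le_mul_of_nonneg_right (mul_lt_mul_of_pos_left this hα).le
        (sq_nonneg ‖(u - w : ℂ)‖)
      linarith
  · intro hle
    by_contra hc
    push Not at hc
    have := mono hα' hβ' hα hβ s' s n' n hc
    nlinarith

/-! ### Index arithmetic -/

section Index

variable {g : ℕ}

theorem two_dvd_index (hg : 2 ≤ g) : 2 ∣ 8 * g - 4 := ⟨4 * g - 2, by omega⟩

theorem neZero_index (hg : 2 ≤ g) : NeZero (8 * g - 4) := ⟨by omega⟩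

theorem even_val_iff (hg : 2 ≤ g) (i : ZMod (8 * g - 4)) :
    Even i.val ↔ ZMod.castHom (two_dvd_index hg) (ZMod 2) i = 0 := by
  have := neZero_index hg
  conv_rhs => rw [← ZMod.natCast_zmod_val i]
  rw [map_natCast, ZMod.natCast_eq_zero_iff_even]

theorem sigmaIdx_of_even (hg : 2 ≤ g) {i : ZMod (8 * g - 4)}
    (h : ZMod.castHom (two_dvd_index hg) (ZMod 2) i = 0) : sigmaIdx g i = 2 - i :=
  if_pos ((even_val_iff hg i).2 h)

theorem sigmaIdx_of_odd (hg : 2 ≤ g) {i : ZMod (8 * g - 4)}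
    (h : ZMod.castHom (two_dvd_index hg) (ZMod 2) i = 1) :
    sigmaIdx g i = 4 * (g : ZMod (8 * g - 4)) - i :=
  if_neg fun h' => by rw [(even_val_iff hg i).1 h'] at h; exact zero_ne_one h

theorem eight_g (hg : 2 ≤ g) : 8 * (g : ZMod (8 * g - 4)) = 4 := by
  have h : ((8 * g - 4 : ℕ) : ZMod (8 * g - 4)) = 0 := ZMod.natCast_self _
  rw [Nat.cast_sub (by omega)] at h
  push_cast at h
  linear_combination h

theorem castHom_index_g (hg : 2 ≤ g) :
    ZMod.castHom (two_dvd_index hg) (ZMod 2) (4 * (g : ZMod (8 * g - 4))) = 0 := by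
  rw [map_mul, map_ofNat, show (4 : ZMod 2) = 0 from rfl, zero_mul]

theorem castHom_index_two (hg : 2 ≤ g) :
    ZMod.castHom (two_dvd_index hg) (ZMod 2) 2 = 0 := by
  rw [map_ofNat]; rfl

theorem zmod_two_cases (x : ZMod 2) : x = 0 ∨ x = 1 := by
  revert x; decide

theorem sigma_sigma (hg : 2 ≤ g) (i : ZMod (8 * g - 4)) : sigmaIdx g (sigmaIdx g i) = i := by
  have h4 := castHom_index_g hg
  have h2 := castHom_index_two hg
  rcases zmod_two_cases (ZMod.castHom (two_dvd_index hg) (ZMod 2) i) with h | h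
  · rw [sigmaIdx_of_even hg h, sigmaIdx_of_even hg (by rw [map_sub, h2, h, sub_zero])]; ring
  · rw [sigmaIdx_of_odd hg h, sigmaIdx_of_odd hg (by rw [map_sub, h4, h]; rfl)]; ring

theorem tau_tau (hg : 2 ≤ g) (i : ZMod (8 * g - 4)) : tauIdx g (tauIdx g i) = i := by
  simp only [tauIdx]; linear_combination eight_g hg

theorem tau_add_one (i : ZMod (8 * g - 4)) : tauIdx g (i + 1) = tauIdx g i + 1 := by
  simp only [tauIdx]; ring

theorem tau_sub_one (i : ZMod (8 * g - 4)) : tauIdx g (i - 1) = tauIdx g i - 1 := by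
  simp only [tauIdx]; ring

/-- Since `4g - 2` is even, `τ(i) + 1` and `i` have opposite parity. The two formulas for `σ` are
exchanged, and their difference `4g - 2` absorbs the shift. -/
theorem sigma_tau_add_one (hg : 2 ≤ g) (i : ZMod (8 * g - 4)) :
    sigmaIdx g (tauIdx g i + 1) = sigmaIdx g i - 1 := by
  have h4 := castHom_index_g hg
  have h2 := castHom_index_two hg
  have h8 := eight_g hg
  have e : ZMod.castHom (two_dvd_index hg) (ZMod 2) (tauIdx g i + 1) =
      ZMod.castHom (two_dvd_index hg) (ZMod 2) i + 1 := by
    rw [tauIdx, map_add, map_add, map_sub, h4, h2, map_one, sub_zero, add_zero]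
  rcases zmod_two_cases (ZMod.castHom (two_dvd_index hg) (ZMod 2) i) with h | h
  · rw [sigmaIdx_of_even hg h, sigmaIdx_of_odd hg (by rw [e, h, zero_add]), tauIdx]; ring
  · rw [sigmaIdx_of_odd hg h, sigmaIdx_of_even hg (by rw [e, h]; rfl), tauIdx]
    linear_combination -h8

theorem sigma_tau_eq (hg : 2 ≤ g) (i : ZMod (8 * g - 4)) :
    sigmaIdx g (tauIdx g i) = sigmaIdx g (i - 1) - 1 := by
  rw [← sigma_tau_add_one hg, tau_sub_one, sub_add_cancel]

theorem sigma_sigma_add_one (hg : 2 ≤ g) (i : ZMod (8 * g - 4)) :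
    sigmaIdx g (sigmaIdx g i + 1) = tauIdx g i - 1 := by
  have h := sigma_tau_add_one hg (tauIdx g i - 1 - 1 + 1)
  rw [tau_add_one, tau_sub_one, tau_sub_one, tau_tau hg] at h
  have h' := congrArg (sigmaIdx g) (sigma_tau_eq hg i)
  rw [sigma_sigma hg] at h'
  have k := sigma_tau_eq hg (tauIdx g i)
  rw [tau_tau hg] at k
  rw [k, sub_add_cancel, sigma_sigma hg]

theorem sigma_sigma_sub_one (hg : 2 ≤ g) (i : ZMod (8 * g - 4)) :
    sigmaIdx g (sigmaIdx g i - 1) = tauIdx g i + 1 := by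
  rw [← sigma_tau_add_one hg, sigma_sigma hg]

/-- There are at least twelve sides when `g ≥ 2`. -/
theorem natCast_index_ne (hg : 2 ≤ g) {m : ℕ} (h0 : m ≠ 0) (h : m < 12) :
    (m : ZMod (8 * g - 4)) ≠ 0 := by
  rw [Ne, ZMod.natCast_eq_zero_iff]
  exact fun hd => by have := Nat.le_of_dvd (by omega) hd; omega

end Index

namespace SurfacePolygon

variable {g : ℕ} (D : SurfacePolygon g)

/-! ### The cyclic order of the endpoints -/

theorem interleave_two_mul (P Q : ZMod (8 * g - 4) → Circle) (m : ℕ) :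
    interleave P Q (2 * m) = P m := by simp [interleave]

theorem interleave_two_mul_add_one (P Q : ZMod (8 * g - 4) → Circle) (m : ℕ) :
    interleave P Q (2 * m + 1) = Q m := by
  simp only [interleave, Nat.not_even_bit1, if_false]
  rw [show (2 * m + 1) / 2 = m by omega]

theorem interleave_add (P Q : ZMod (8 * g - 4) → Circle) (m : ℕ) :
    interleave P Q (m + 2 * (8 * g - 4)) = interleave P Q m := by
  have h : (m + 2 * (8 * g - 4)) / 2 = m / 2 + (8 * g - 4) := by omega
  simp only [interleave, Nat.even_add, even_two_mul, iff_true, h, Nat.cast_add, ZMod.natCast_self,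
    add_zero]

/-- The hypothesis `order` concerns one period; running past its end costs a cyclic rotation of the
triple. -/
theorem order_interleave {k s t : ℕ} (hk : k < 2 * (8 * g - 4)) (hs : 0 < s) (hst : s < t)
    (ht : t < 2 * (8 * g - 4)) : CCW (interleave D.P D.Q k) (interleave D.P D.Q (k + s))
      (interleave D.P D.Q (k + t)) := by
  by_cases h1 : k + t < 2 * (8 * g - 4)
  · exact D.order _ _ _ (by omega) (by omega) h1
  have e1 := interleave_add D.P D.Q (k + t - 2 * (8 * g - 4))
  rw [show k + t - 2 * (8 * g - 4) + 2 * (8 * g - 4) = k + t by omega] at e1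
  rw [e1]
  by_cases h2 : k + s < 2 * (8 * g - 4)
  · rw [← ccw_rotate]
    exact D.order _ _ _ (by omega) (by omega) h2
  have e2 := interleave_add D.P D.Q (k + s - 2 * (8 * g - 4))
  rw [show k + s - 2 * (8 * g - 4) + 2 * (8 * g - 4) = k + s by omega] at e2
  rw [e2, ccw_rotate]
  exact D.order _ _ _ (by omega) (by omega) hk

theorem exists_cut_index (hg : 2 ≤ g) (j : ZMod (8 * g - 4)) : ∃ f : Circle → ℝ,
    Function.Injective f ∧ (∀ x, f (D.P j) ≤ f x) ∧ (∀ x y z, CCW x y z ↔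
      (f x < f y ∧ f y < f z) ∨ (f y < f z ∧ f z < f x) ∨ (f z < f x ∧ f x < f y)) ∧
    (∀ s : ℕ, s < 8 * g - 4 → f (D.P (j + s)) < f (D.Q (j + s))) ∧
    (∀ s t : ℕ, s < t → t < 8 * g - 4 → f (D.Q (j + s)) < f (D.P (j + t))) := by
  have := neZero_index hg
  obtain ⟨f, hf, h0, hn, hc⟩ := exists_cut (D.P j)
  have hk := ZMod.val_lt j
  obtain ⟨k, hk'⟩ : ∃ k, k = j.val := ⟨_, rfl⟩
  have hj : (k : ZMod (8 * g - 4)) = j := by rw [hk']; exact ZMod.natCast_zmod_val j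
  have e0 : D.P j = interleave D.P D.Q (2 * k) := by rw [interleave_two_mul, hj]
  have eP : ∀ s : ℕ, D.P (j + s) = interleave D.P D.Q (2 * k + 2 * s) := by
    intro s; rw [← mul_add, interleave_two_mul]; push_cast; rw [hj]
  have eQ : ∀ s : ℕ, D.Q (j + s) = interleave D.P D.Q (2 * k + (2 * s + 1)) := by
    intro s; rw [← add_assoc, ← mul_add, interleave_two_mul_add_one]; push_cast; rw [hj]
  have key : ∀ s t : ℕ, s < t → t < 2 * (8 * g - 4) →
      f (interleave D.P D.Q (2 * k + s)) < f (interleave D.P D.Q (2 * k + t)) := by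
    have pos : ∀ s t : ℕ, 0 < s → s < t → t < 2 * (8 * g - 4) →
        0 < f (interleave D.P D.Q (2 * k + s)) ∧
        f (interleave D.P D.Q (2 * k + s)) < f (interleave D.P D.Q (2 * k + t)) := by
      intro s t hs hst ht
      have h := D.order_interleave (k := 2 * k) (by omega) hs hst ht
      rw [hc, ← e0, h0] at h
      have h1 := hn (interleave D.P D.Q (2 * k + s))
      have h2 := hn (interleave D.P D.Q (2 * k + t))
      rcases h with h | h | h
      · exact h
      · linarith [h.2]
      · linarith [h.1]
    intro s t hst ht
    rcases Nat.eq_zero_or_pos s with rfl | hs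
    · rw [add_zero, ← e0, h0]
      by_cases h1 : t = 1
      · subst h1
        exact (pos 1 2 (by omega) (by omega) (by omega)).1
      · have h := pos 1 t (by omega) (by omega) ht
        exact h.1.trans h.2
    · exact (pos s t hs hst ht).2
  refine ⟨f, hf, fun x => h0.le.trans (hn x), hc, ?_, ?_⟩
  · intro s hs
    rw [eP, eQ]
    exact key _ _ (by omega) (by omega)
  · intro s t hst ht
    rw [eP, eQ]
    exact key _ _ (by omega) (by omega)

/-- The real coordinate obtained by cutting the circle at `P (i - 5)`, together with the order of the
endpoints with indices near `i`. -/
theorem exists_chain (hg : 2 ≤ g) (i : ZMod (8 * g - 4)) : ∃ f : Circle → ℝ,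
    Function.Injective f ∧ (∀ x y z, CCW x y z ↔
      (f x < f y ∧ f y < f z) ∨ (f y < f z ∧ f z < f x) ∨ (f z < f x ∧ f x < f y)) ∧
    (∀ x, f (D.P (i - 5)) ≤ f x) ∧
    (f (D.P (i - 5)) < f (D.Q (i - 5)) ∧ f (D.Q (i - 5)) < f (D.P (i - 4)) ∧
    f (D.P (i - 4)) < f (D.Q (i - 4)) ∧ f (D.Q (i - 4)) < f (D.P (i - 3)) ∧
    f (D.P (i - 3)) < f (D.Q (i - 3)) ∧ f (D.Q (i - 3)) < f (D.P (i - 2)) ∧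
    f (D.P (i - 2)) < f (D.Q (i - 2)) ∧ f (D.Q (i - 2)) < f (D.P (i - 1)) ∧
    f (D.P (i - 1)) < f (D.Q (i - 1)) ∧ f (D.Q (i - 1)) < f (D.P i) ∧
    f (D.P i) < f (D.Q i) ∧ f (D.Q i) < f (D.P (i + 1)) ∧
    f (D.P (i + 1)) < f (D.Q (i + 1)) ∧ f (D.Q (i + 1)) < f (D.P (i + 2)) ∧
    f (D.P (i + 2)) < f (D.Q (i + 2)) ∧ f (D.Q (i + 2)) < f (D.P (i + 3)) ∧
    f (D.P (i + 3)) < f (D.Q (i + 3)) ∧ f (D.Q (i + 3)) < f (D.P (i + 4)) ∧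
    f (D.P (i + 4)) < f (D.Q (i + 4)) ∧ f (D.Q (i + 4)) < f (D.P (i + 5)) ∧
    f (D.P (i + 5)) < f (D.Q (i + 5))) := by
  obtain ⟨f, hf, hn, hc, h1, h2⟩ := D.exists_cut_index hg (i - 5)
  refine ⟨f, hf, hc, hn, ?_⟩
  -- The window from `i - 5` to `i + 5` has eleven indices and so does not overlap itself.
  have k1 := fun s : ℕ => fun hs : s < 11 => h1 s (by omega)
  have k2 := fun s : ℕ => fun hs : s < 11 => h2 s (s + 1) (by omega) (by omega)
  have e : ∀ s : ℕ, ∀ c : ZMod (8 * g - 4), i - 5 + s = c → s < 11 → f (D.P c) < f (D.Q c) ∧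
      f (D.Q c) < f (D.P (c + 1)) := by
    rintro s c rfl hs
    refine ⟨k1 s hs, ?_⟩
    have := k2 s hs
    rwa [Nat.cast_add, Nat.cast_one, ← add_assoc] at this
  have a0 := e 0 (i - 5) (by push_cast; ring) (by omega)
  have a1 := e 1 (i - 4) (by push_cast; ring) (by omega)
  have a2 := e 2 (i - 3) (by push_cast; ring) (by omega)
  have a3 := e 3 (i - 2) (by push_cast; ring) (by omega)
  have a4 := e 4 (i - 1) (by push_cast; ring) (by omega)
  have a5 := e 5 i (by push_cast; ring) (by omega)
  have a6 := e 6 (i + 1) (by push_cast; ring) (by omega)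
  have a7 := e 7 (i + 2) (by push_cast; ring) (by omega)
  have a8 := e 8 (i + 3) (by push_cast; ring) (by omega)
  have a9 := e 9 (i + 4) (by push_cast; ring) (by omega)
  have a10 := e 10 (i + 5) (by push_cast; ring) (by omega)
  rw [show i - 5 + 1 = i - 4 by ring] at a0
  rw [show i - 4 + 1 = i - 3 by ring] at a1
  rw [show i - 3 + 1 = i - 2 by ring] at a2
  rw [show i - 2 + 1 = i - 1 by ring] at a3
  rw [show i - 1 + 1 = i by ring] at a4
  rw [show i + 1 + 1 = i + 2 by ring] at a6
  rw [show i + 2 + 1 = i + 3 by ring] at a7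
  rw [show i + 3 + 1 = i + 4 by ring] at a8
  rw [show i + 4 + 1 = i + 5 by ring] at a9
  exact ⟨a0.1, a0.2, a1.1, a1.2, a2.1, a2.2, a3.1, a3.2, a4.1, a4.2, a5.1, a5.2, a6.1, a6.2, a7.1,
    a7.2, a8.1, a8.2, a9.1, a9.2, a10.1⟩

/-- Strictly between `P k` and `Q (k + 1)` the cyclic list contains only `Q k` and `P (k + 1)`. -/
theorem ccw_P_outside (hg : 2 ≤ g) {k m : ZMod (8 * g - 4)} (h0 : m ≠ k) (h1 : m ≠ k + 1) :
    CCW (D.P k) (D.Q (k + 1)) (D.P m) := by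
  have := neZero_index hg
  obtain ⟨f, -, -, hc, hPQ, hQP⟩ := D.exists_cut_index hg k
  obtain ⟨t, ht⟩ : ∃ t, t = (m - k).val := ⟨_, rfl⟩
  have htN : t < 8 * g - 4 := by rw [ht]; exact ZMod.val_lt _
  have hm : m = k + (t : ℕ) := by rw [ht, ZMod.natCast_zmod_val]; ring
  have ht0 : t ≠ 0 := by rintro rfl; exact h0 (by simpa using hm)
  have ht1 : t ≠ 1 := by rintro rfl; exact h1 (by simpa using hm)
  have a := hPQ 0 (by omega)
  have b := hQP 0 1 (by omega) (by omega)
  have c := hPQ 1 (by omega)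
  have d := hQP 1 t (by omega) htN
  rw [← hm] at d
  simp only [Nat.cast_zero, add_zero, Nat.cast_one] at a b c d
  rw [hc]
  left; constructor <;> linarith

theorem ccw_Q_outside (hg : 2 ≤ g) {k m : ZMod (8 * g - 4)} (h0 : m ≠ k) (h1 : m ≠ k + 1) :
    CCW (D.P k) (D.Q (k + 1)) (D.Q m) := by
  have := neZero_index hg
  obtain ⟨f, -, -, hc, hPQ, hQP⟩ := D.exists_cut_index hg k
  obtain ⟨t, ht⟩ : ∃ t, t = (m - k).val := ⟨_, rfl⟩
  have htN : t < 8 * g - 4 := by rw [ht]; exact ZMod.val_lt _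
  have hm : m = k + (t : ℕ) := by rw [ht, ZMod.natCast_zmod_val]; ring
  have ht0 : t ≠ 0 := by rintro rfl; exact h0 (by simpa using hm)
  have ht1 : t ≠ 1 := by rintro rfl; exact h1 (by simpa using hm)
  have a := hPQ 0 (by omega)
  have b := hQP 0 1 (by omega) (by omega)
  have c := hPQ 1 (by omega)
  have d := hQP 1 t (by omega) htN
  have e := hPQ t htN
  rw [← hm] at d e
  simp only [Nat.cast_zero, add_zero, Nat.cast_one] at a b c d
  rw [hc]
  left; constructor <;> linarith

theorem P_ne_Q (hg : 2 ≤ g) (k : ZMod (8 * g - 4)) : D.P k ≠ D.Q (k + 1) := by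
  obtain ⟨f, hf, hc, -, h⟩ := D.exists_chain hg k
  intro e
  have := congrArg f e
  grind

/-! ### Vertices -/

theorem V_comb_left (hg : 2 ≤ g) (i : ZMod (8 * g - 4)) : ∃ α β : ℝ, 0 < α ∧ 0 < β ∧ ∀ a b,
    sideFn a b (D.V i) = α * orient a b (D.P (i - 1)) + β * orient a b (D.Q i) := by
  have h := D.P_ne_Q hg (i - 1)
  rw [sub_add_cancel] at h
  exact geodesic_comb h (D.V_mem i).1

theorem V_comb_right (hg : 2 ≤ g) (i : ZMod (8 * g - 4)) : ∃ α β : ℝ, 0 < α ∧ 0 < β ∧ ∀ a b,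
    sideFn a b (D.V i) = α * orient a b (D.P i) + β * orient a b (D.Q (i + 1)) :=
  geodesic_comb (D.P_ne_Q hg i) (D.V_mem i).2

theorem norm_V_lt (i : ZMod (8 * g - 4)) : ‖D.V i‖ < 1 := (D.V_mem i).1.1

theorem sideFn_V_left (i : ZMod (8 * g - 4)) : sideFn (D.P (i - 1)) (D.Q i) (D.V i) = 0 :=
  (D.V_mem i).1.2

theorem sideFn_V_right (i : ZMod (8 * g - 4)) : sideFn (D.P i) (D.Q (i + 1)) (D.V i) = 0 :=
  (D.V_mem i).2.2

theorem one_ne_zero_index (hg : 2 ≤ g) : (1 : ZMod (8 * g - 4)) ≠ 0 := by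
  simpa using natCast_index_ne hg (m := 1) (by omega) (by omega)

/-- A vertex is a positive combination of the ends of either extended side through it, and one of
these two pairs lies in front of side `k`. For `i = k + 2` the left pair contains `P (k + 1)`, so
the right pair is used. -/
theorem sideFn_V_pos (hg : 2 ≤ g) {i k : ZMod (8 * g - 4)} (h0 : k ≠ i) (h1 : k ≠ i - 1) :
    0 < sideFn (D.P k) (D.Q (k + 1)) (D.V i) := by
  have n1 := one_ne_zero_index hg
  have n2 : (2 : ZMod (8 * g - 4)) ≠ 0 := by
    simpa using natCast_index_ne hg (m := 2) (by omega) (by omega)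
  have n3 : (3 : ZMod (8 * g - 4)) ≠ 0 := by
    simpa using natCast_index_ne hg (m := 3) (by omega) (by omega)
  have hi : i ≠ k + 1 := fun e => h1 (by rw [e]; ring)
  by_cases h : i = k + 2
  · obtain ⟨α, β, hα, hβ, hV⟩ := D.V_comb_right hg i
    rw [hV]
    have a := D.ccw_P_outside hg h0.symm hi
    have b := D.ccw_Q_outside hg (k := k) (m := i + 1)
      (fun e => n3 (by rw [h] at e; linear_combination e))
      (fun e => n2 (by rw [h] at e; linear_combination e))
    exact add_pos (mul_pos hα a) (mul_pos hβ b)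
  · obtain ⟨α, β, hα, hβ, hV⟩ := D.V_comb_left hg i
    rw [hV]
    have a := D.ccw_P_outside hg (k := k) (m := i - 1) h1.symm
      (fun e => h (by linear_combination e))
    have b := D.ccw_Q_outside hg h0.symm hi
    exact add_pos (mul_pos hα a) (mul_pos hβ b)

theorem sideFn_V_nonneg (hg : 2 ≤ g) (i k : ZMod (8 * g - 4)) :
    0 ≤ sideFn (D.P k) (D.Q (k + 1)) (D.V i) := by
  by_cases h0 : k = i
  · rw [h0, sideFn_V_right]
  by_cases h1 : k = i - 1
  · rw [h1, sub_add_cancel, sideFn_V_left]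
  exact (D.sideFn_V_pos hg h0 h1).le

theorem V_mem_F (hg : 2 ≤ g) (i : ZMod (8 * g - 4)) : D.V i ∈ D.F :=
  ⟨D.norm_V_lt i, D.sideFn_V_nonneg hg i⟩

end SurfacePolygon

/-! ### Continuity and small perturbations. -/

theorem continuous_sideFn (u w : Circle) : Continuous (sideFn u w) := by
  unfold sideFn
  fun_prop

/-- If each `a k` is positive, or zero with positive slope `b k`, then all `a k + β * b k` are
positive for some small `β > 0`. -/
theorem exists_small_pos {ι : Type*} [Finite ι] (a b : ι → ℝ)
    (h : ∀ k, 0 < a k ∨ (a k = 0 ∧ 0 < b k)) : ∃ β : ℝ, 0 < β ∧ ∀ k, 0 < a k + β * b k := by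
  have h1 : ∀ᶠ β : ℝ in 𝓝[>] 0, ∀ k, 0 < a k + β * b k := by
    rw [Filter.eventually_all]
    intro k
    rcases h k with h | ⟨h0, h⟩
    · have hc : Continuous fun β : ℝ => a k + β * b k := by fun_prop
      have ht := hc.tendsto 0
      simp only [zero_mul, add_zero] at ht
      exact (ht.mono_left nhdsWithin_le_nhds).eventually (lt_mem_nhds h)
    · filter_upwards [self_mem_nhdsWithin] with β hβ
      rw [h0, zero_add]
      exact mul_pos hβ h
  obtain ⟨β, hβ, hp⟩ := (h1.and self_mem_nhdsWithin).exists
  exact ⟨β, hp, hβ⟩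

namespace SurfacePolygon

variable {g : ℕ} (D : SurfacePolygon g)

/-! ### The action of the side pairings on the endpoints -/

theorem onCircle_T_sigma (i : ZMod (8 * g - 4)) (x : Circle) :
    onCircle (D.T (sigmaIdx g i)) (onCircle (D.T i) x) = x := by
  rw [← SU11.onCircle_mul]
  exact SU11.onCircle_of_actsTrivially (D.T_inverse i) x

theorem onCircle_T_sigma' (hg : 2 ≤ g) (i : ZMod (8 * g - 4)) (x : Circle) :
    onCircle (D.T i) (onCircle (D.T (sigmaIdx g i)) x) = x := by
  have := D.onCircle_T_sigma (sigmaIdx g i) x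
  rwa [sigma_sigma hg] at this

theorem mob_T_V (i : ZMod (8 * g - 4)) : mob (D.T i) (D.V i) = D.V (sigmaIdx g i + 1) :=
  D.T_vertex i

theorem mob_T_V_succ (hg : 2 ≤ g) (i : ZMod (8 * g - 4)) :
    mob (D.T i) (D.V (i + 1)) = D.V (sigmaIdx g i) := by
  have h := D.mob_T_V (sigmaIdx g i)
  have h2 := D.T_inverse (sigmaIdx g i) (D.V (sigmaIdx g i)) (D.norm_V_lt _)
  rw [sigma_sigma hg] at h h2
  rw [← h, ← SU11.mob_mul _ _ (D.norm_V_lt _).le, h2]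

/-- The image of the extended side `i` contains both vertices of side `σ i`, so it extends that
side. Which end goes where is decided by the order of the two vertices along it. -/
theorem T_side_endpoints (hg : 2 ≤ g) (i : ZMod (8 * g - 4)) :
    onCircle (D.T i) (D.P i) = D.Q (sigmaIdx g i + 1) ∧
    onCircle (D.T i) (D.Q (i + 1)) = D.P (sigmaIdx g i) := by
  have n1 := one_ne_zero_index hg
  obtain ⟨s, hs⟩ : ∃ s, s = sigmaIdx g i := ⟨_, rfl⟩
  have hV1 := D.mob_T_V i
  have hV0 := D.mob_T_V_succ hg i
  rw [← hs] at hV1 hV0 ⊢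
  obtain ⟨M, hM⟩ : ∃ M, M = D.T i := ⟨_, rfl⟩
  rw [← hM] at hV1 hV0 ⊢
  obtain ⟨u, hu⟩ : ∃ u, u = onCircle M (D.P i) := ⟨_, rfl⟩
  obtain ⟨w, hw⟩ : ∃ w, w = onCircle M (D.Q (i + 1)) := ⟨_, rfl⟩
  rw [← hu, ← hw]
  have huw : u ≠ w := by
    rw [hu, hw]; exact fun e => D.P_ne_Q hg i (SU11.onCircle_injective M e)
  have g1 : D.V (s + 1) ∈ geodesic u w := by
    rw [← hV1, hu, hw]; exact SU11.mob_mem_geodesic M (D.V_mem i).2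
  have g0 : D.V s ∈ geodesic u w := by
    rw [← hV0, hu, hw]
    refine SU11.mob_mem_geodesic M ?_
    have := (D.V_mem (i + 1)).1
    rwa [add_sub_cancel_right] at this
  obtain ⟨α, β, hα, hβ, h1⟩ := geodesic_comb huw g1
  obtain ⟨γ, δ, hγ, hδ, h0⟩ := geodesic_comb huw g0
  have l1 := h1 (D.P s) (D.Q (s + 1))
  have l0 := h0 (D.P s) (D.Q (s + 1))
  have ll := D.sideFn_V_left (s + 1)
  rw [add_sub_cancel_right] at ll
  rw [ll] at l1
  rw [D.sideFn_V_right] at l0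
  have m1 := h1 (onCircle M (D.P (i + 1))) (onCircle M (D.Q (i + 1 + 1)))
  have m0 := h0 (onCircle M (D.P (i + 1))) (onCircle M (D.Q (i + 1 + 1)))
  have mp1 : 0 < sideFn (onCircle M (D.P (i + 1))) (onCircle M (D.Q (i + 1 + 1))) (D.V (s + 1)) := by
    rw [← hV1, SU11.sideFn_mob_pos M (D.norm_V_lt i)]
    exact D.sideFn_V_pos hg (fun e => n1 (by linear_combination e))
      (fun e => by
        have := natCast_index_ne hg (m := 2) (by omega) (by omega)
        apply this; push_cast; linear_combination e)
  have mp0 : sideFn (onCircle M (D.P (i + 1))) (onCircle M (D.Q (i + 1 + 1))) (D.V s) = 0 := by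
    rw [← hV0, SU11.sideFn_mob_eq_zero M (D.norm_V_lt _)]
    exact D.sideFn_V_right _
  have mu : 0 < orient (onCircle M (D.P (i + 1))) (onCircle M (D.Q (i + 1 + 1))) u := by
    rw [hu]
    refine (SU11.ccw_iff M).2 (D.ccw_P_outside hg (fun e => n1 (by linear_combination -e)) ?_)
    intro e
    have := natCast_index_ne hg (m := 2) (by omega) (by omega)
    apply this; push_cast; linear_combination -e
  rw [m1] at mp1
  rw [m0] at mp0
  generalize orient (onCircle M (D.P (i + 1))) (onCircle M (D.Q (i + 1 + 1))) u = mu' at *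
  generalize orient (onCircle M (D.P (i + 1))) (onCircle M (D.Q (i + 1 + 1))) w = mw' at *
  -- `V (s + 1)` precedes `V s` on the way from `u` to `w`. This is read off from the image of side
  -- `i + 1`, which vanishes at `V s` and is positive at `V (s + 1)` and at `u`.
  have hdet : 0 < α * δ - β * γ := by
    have : 0 < (α * δ - β * γ) * mu' := by
      have := mul_pos hδ mp1
      linear_combination this + β * mp0
    exact pos_of_mul_pos_left this mu.le
  have lu : orient (D.P s) (D.Q (s + 1)) u = 0 := by
    have : (α * δ - β * γ) * orient (D.P s) (D.Q (s + 1)) u = 0 := by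
      linear_combination β * l0 - δ * l1
    exact (mul_eq_zero.1 this).resolve_left hdet.ne'
  have lw : orient (D.P s) (D.Q (s + 1)) w = 0 := by
    rw [lu, mul_zero, zero_add] at l1
    exact (mul_eq_zero.1 l1.symm).resolve_left hβ.ne'
  rw [orient_eq_zero_iff] at lu lw
  have hPQ := D.P_ne_Q hg s
  rcases lu with h | h | h
  · exact absurd h hPQ
  · rcases lw with h' | h' | h'
    · exact absurd h' hPQ
    · exact absurd (h.symm.trans h') huw
    · exact ⟨h.symm, h'.symm⟩
  · rcases lw with h' | h' | h'
    · exact absurd h' hPQ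
    -- The wrong matching of ends. The extended side `s - 1` contains `V s` and has `V (s + 1)` in
    -- front of it, so `u` would be in front of it as well; `P s` is not.
    · exfalso
      have k1 := h1 (D.P (s - 1)) (D.Q (s - 1 + 1))
      have k0 := h0 (D.P (s - 1)) (D.Q (s - 1 + 1))
      have kp1 := D.sideFn_V_pos hg (i := s + 1) (k := s - 1) (fun e => by
        have := natCast_index_ne hg (m := 2) (by omega) (by omega)
        apply this; push_cast; linear_combination -e) (fun e => n1 (by linear_combination -e))
      have kp0 := D.sideFn_V_left s
      rw [k1] at kp1
      rw [sub_add_cancel] at k0 kp1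
      rw [kp0] at k0
      have hn : orient (D.P (s - 1)) (D.Q s) u < 0 := by
        rw [← h, orient_neg_iff]
        obtain ⟨f, hf, hc, -, hh⟩ := D.exists_chain hg s
        rw [hc]; grind
      have : 0 < (α * δ - β * γ) * orient (D.P (s - 1)) (D.Q s) u := by
        have := mul_pos hδ kp1
        linear_combination this - β * k0
      have := pos_of_mul_pos_right this hdet.le
      linarith
    · exact absurd (h.symm.trans h') huw

theorem T_P (hg : 2 ≤ g) (i : ZMod (8 * g - 4)) :
    onCircle (D.T i) (D.P i) = D.Q (sigmaIdx g i + 1) := (D.T_side_endpoints hg i).1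

theorem T_Q_succ (hg : 2 ≤ g) (i : ZMod (8 * g - 4)) :
    onCircle (D.T i) (D.Q (i + 1)) = D.P (sigmaIdx g i) := (D.T_side_endpoints hg i).2

theorem mem_interior_polygonRegion {z : ℂ} (hz : ‖z‖ < 1)
    (h : ∀ k, 0 < sideFn (D.P k) (D.Q (k + 1)) z) (hg : 2 ≤ g) :
    z ∈ interior (polygonRegion D.P D.Q) := by
  have := neZero_index hg
  rw [mem_interior]
  refine ⟨{z | ‖z‖ < 1} ∩ ⋂ k, {z | 0 < sideFn (D.P k) (D.Q (k + 1)) z}, ?_, ?_, ?_⟩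
  · rintro y ⟨h1, h2⟩
    exact ⟨h1, fun k => (mem_iInter.1 h2 k).le⟩
  · exact (isOpen_lt continuous_norm continuous_const).inter
      (isOpen_iInter_of_finite fun k => isOpen_lt continuous_const (continuous_sideFn _ _))
  · exact ⟨hz, mem_iInter.2 h⟩

/-- A geodesic through the vertex `V i` that enters the interior angle at `V i`, moved by `T i`, is
not a side of the tessellation. -/
theorem T_ray_not_interior (hg : 2 ≤ g) (i : ZMod (8 * g - 4)) {R : Circle}
    (hR : CCW (D.Q (i + 1)) R (D.P (i - 1))) :
    onCircle (D.T i) R ≠ D.P (sigmaIdx g i + 1) := by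
  have := neZero_index hg
  intro e
  obtain ⟨f, hf, hc, -, hh⟩ := D.exists_chain hg i
  have r1 : 0 < orient (D.P i) (D.Q (i + 1)) R := by
    rw [← ccw_iff]; rw [hc] at hR ⊢; grind
  have r0 : 0 < orient (D.P (i - 1)) (D.Q i) R := by
    rw [← ccw_iff]; rw [hc] at hR ⊢; grind
  -- A point slightly past `V i` towards `R`: only the functions of sides `i - 1` and `i` vanish at
  -- `V i`, and both increase in this direction.
  obtain ⟨β, hβ, hpos⟩ := exists_small_pos
    (fun k => sideFn (D.P k) (D.Q (k + 1)) (D.V i)) (fun k => sideFn (D.P k) (D.Q (k + 1)) R) (by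
      intro k
      by_cases h0 : k = i
      · right; subst h0
        exact ⟨D.sideFn_V_right _, by rw [sideFn_circle]; linarith⟩
      by_cases h1 : k = i - 1
      · right; subst h1
        rw [sub_add_cancel]
        exact ⟨D.sideFn_V_left _, by rw [sideFn_circle]; linarith⟩
      · exact Or.inl (D.sideFn_V_pos hg h0 h1))
  obtain ⟨z, hz, c, hc', h⟩ := exists_combination (D.norm_V_lt i) (Circle.norm_coe R).le
    one_pos hβ.le
  have hzint := D.mem_interior_polygonRegion hz (fun k => by
    rw [h, one_mul]; exact mul_pos hc' (hpos k)) hg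
  have hdis := D.extension (sigmaIdx g i + 1) (D.T i) (D.T_mem i)
  refine Set.disjoint_left.1 hdis ?_ ⟨z, hzint, rfl⟩
  refine ⟨SU11.norm_mob_lt _ hz, ?_⟩
  -- With this `R'`, `T i` carries the geodesic through `R` and `R'` to the extended side `σ i + 1`.
  obtain ⟨R', hR'⟩ : ∃ R', onCircle (D.T i) R' = D.Q (sigmaIdx g i + 1 + 1) :=
    ⟨_, D.onCircle_T_sigma' hg i _⟩
  rw [← e, ← hR', SU11.sideFn_mob_eq_zero _ hz, h, sideFn_circle, orient_self_mid]
  have : sideFn R R' (D.V i) = 0 := by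
    rw [← SU11.sideFn_mob_eq_zero (D.T i) (D.norm_V_lt i), e, hR', D.mob_T_V]
    exact D.sideFn_V_right _
  rw [this]; ring

/-- If `P (σ i + 1)` lay strictly between `P (σ i)` and the image of `P (i - 1)`, its preimage would
be a direction inside the angle at `V i`, against `T_ray_not_interior`. -/
theorem T_P_pred_mem (hg : 2 ≤ g) (i : ZMod (8 * g - 4)) :
    onCircle (D.T i) (D.P (i - 1)) = D.P (sigmaIdx g i + 1) ∨
    CCW (D.P (sigmaIdx g i)) (onCircle (D.T i) (D.P (i - 1))) (D.P (sigmaIdx g i + 1)) := by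
  obtain ⟨f, hf, hc, -, hh⟩ := D.exists_chain hg i
  obtain ⟨f', hf', hc', -, hh'⟩ := D.exists_chain hg (sigmaIdx g i)
  have c1 : CCW (D.P (i - 1)) (D.P i) (D.Q (i + 1)) := by rw [hc]; grind
  rw [← SU11.ccw_iff (D.T i), D.T_P hg, D.T_Q_succ hg] at c1
  obtain ⟨R, hR⟩ : ∃ R, onCircle (D.T i) R = D.P (sigmaIdx g i + 1) :=
    ⟨_, D.onCircle_T_sigma' hg i _⟩
  have h := fun h => D.T_ray_not_interior hg i (R := R) h hR
  rw [← SU11.ccw_iff (D.T i), hR, D.T_Q_succ hg] at h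
  rw [← hf'.eq_iff]
  rw [hc'] at h c1 ⊢
  grind

/-- The image geodesic passes through `V (σ i + 1)`. Its first end is not strictly behind side `σ i
+ 1`, so its second end is not strictly in front. -/
theorem T_Q_mem (hg : 2 ≤ g) (i : ZMod (8 * g - 4)) :
    onCircle (D.T i) (D.Q i) = D.Q (sigmaIdx g i + 2) ∨
    CCW (D.Q (sigmaIdx g i + 1)) (onCircle (D.T i) (D.Q i)) (D.Q (sigmaIdx g i + 2)) := by
  have hX := D.T_P_pred_mem hg i
  have hne : D.P (i - 1) ≠ D.Q i := by
    have := D.P_ne_Q hg (i - 1); rwa [sub_add_cancel] at this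
  have hV : D.V (sigmaIdx g i + 1) ∈
      geodesic (onCircle (D.T i) (D.P (i - 1))) (onCircle (D.T i) (D.Q i)) := by
    rw [← D.mob_T_V]
    exact SU11.mob_mem_geodesic _ (D.V_mem i).1
  obtain ⟨α, β, hα, hβ, h⟩ := geodesic_comb (fun e => hne (SU11.onCircle_injective _ e)) hV
  have h0 := h (D.P (sigmaIdx g i + 1)) (D.Q (sigmaIdx g i + 1 + 1))
  rw [D.sideFn_V_right] at h0
  obtain ⟨f, hf, hc, -, hh⟩ := D.exists_chain hg i
  obtain ⟨f', hf', hc', -, hh'⟩ := D.exists_chain hg (sigmaIdx g i)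
  have c1 : CCW (D.P i) (D.Q i) (D.Q (i + 1)) := by rw [hc]; grind
  rw [← SU11.ccw_iff (D.T i), D.T_P hg, D.T_Q_succ hg] at c1
  rw [show sigmaIdx g i + 1 + 1 = sigmaIdx g i + 2 by ring] at h0
  generalize onCircle (D.T i) (D.P (i - 1)) = X at *
  generalize onCircle (D.T i) (D.Q i) = Y at *
  have hXn : ¬ orient (D.P (sigmaIdx g i + 1)) (D.Q (sigmaIdx g i + 2)) X < 0 := by
    rw [orient_neg_iff, hc']
    rw [hc', ← hf'.eq_iff] at hX
    grind
  have hYn : ¬ 0 < orient (D.P (sigmaIdx g i + 1)) (D.Q (sigmaIdx g i + 2)) Y := by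
    intro hp
    have := mul_pos hβ hp
    have := mul_nonneg hα.le (not_lt.1 hXn)
    linarith
  rw [← ccw_iff, hc'] at hYn
  rw [hc'] at c1 ⊢
  rw [← hf'.eq_iff]
  grind

theorem rho_rho (hg : 2 ≤ g) (i : ZMod (8 * g - 4)) :
    sigmaIdx g (sigmaIdx g i + 1) + 1 = tauIdx g i := by
  rw [sigma_sigma_add_one hg, sub_add_cancel]

theorem rho_tau (hg : 2 ≤ g) (i : ZMod (8 * g - 4)) :
    sigmaIdx g (tauIdx g i) + 1 = sigmaIdx g (i - 1) := by
  rw [sigma_tau_eq hg, sub_add_cancel]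

theorem onCircle_T_cycle (hg : 2 ≤ g) (i : ZMod (8 * g - 4)) (x : Circle) :
    onCircle (D.T (sigmaIdx g (i - 1))) (onCircle (D.T (tauIdx g i))
      (onCircle (D.T (sigmaIdx g i + 1)) (onCircle (D.T i) x))) = x := by
  have h := SU11.onCircle_of_actsTrivially (D.T_cycle i) x
  simp only [rhoIdx, SU11.onCircle_mul] at h
  rwa [rho_rho hg i, rho_tau hg] at h

/-- Here the extension condition becomes an equality. Around a vertex the images can only lag behind
the expected endpoints, and the cycle relation closes the loop, so a strict lag at the first step
cannot be made up later. -/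
theorem T_P_pred (hg : 2 ≤ g) (i : ZMod (8 * g - 4)) :
    onCircle (D.T i) (D.P (i - 1)) = D.P (sigmaIdx g i + 1) := by
  obtain ⟨j, hj⟩ : ∃ j, j = sigmaIdx g i + 1 := ⟨_, rfl⟩
  obtain ⟨k, hk⟩ : ∃ k, k = tauIdx g i := ⟨_, rfl⟩
  obtain ⟨l, hl⟩ : ∃ l, l = sigmaIdx g (i - 1) := ⟨_, rfl⟩
  have hcyc := D.onCircle_T_cycle hg i (D.P (i - 1))
  have hij : sigmaIdx g i = j - 1 := by rw [hj]; ring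
  have hjk : sigmaIdx g j = k - 1 := by rw [hj, hk, sigma_sigma_add_one hg]
  have hkl : sigmaIdx g k = l - 1 := by rw [hk, hl, sigma_tau_eq hg]
  have hli : sigmaIdx g l = i - 1 := by rw [hl, sigma_sigma hg]
  rw [← hl, ← hk, ← hj] at hcyc
  have hX1 := D.T_P_pred_mem hg i
  have hX2 := D.T_P_pred_mem hg j
  have hX3 := D.T_P_pred_mem hg k
  have hY3 := D.T_Q_mem hg k
  have hP2 := D.T_P hg j
  have hQ4 := D.T_Q_succ hg l
  rw [hli] at hQ4
  rw [hkl] at hX3 hY3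
  rw [hjk, sub_add_cancel] at hX2 hP2
  rw [hij, sub_add_cancel] at hX1
  rw [← hj]
  rw [sub_add_cancel, show l - 1 + 2 = l + 1 by ring] at hY3
  rw [sub_add_cancel] at hX3
  -- The cycle relation, pulled back through `T l`, places the moved point exactly at `Q (l + 1)`. A
  -- strict lag would put it strictly before the image of `Q k`, which does not pass `Q (l + 1)`.
  have h3 := SU11.onCircle_injective _ (hcyc.trans hQ4.symm)
  rcases hX1 with h | h
  · exact h
  exfalso
  rw [← SU11.ccw_iff (D.T j), hP2] at h
  generalize onCircle (D.T j) (onCircle (D.T i) (D.P (i - 1))) = x2 at *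
  generalize onCircle (D.T j) (D.P (j - 1)) = X2 at *
  obtain ⟨f, hf, hc, -, hh⟩ := D.exists_chain hg k
  obtain ⟨f', hf', hc', -, hh'⟩ := D.exists_chain hg l
  have h' : CCW (D.P (k - 1)) x2 (D.Q k) := by
    rw [hc, ← hf.eq_iff] at hX2
    rw [hc] at h ⊢
    grind
  rw [← SU11.ccw_iff (D.T k), h3] at h'
  generalize onCircle (D.T k) (D.P (k - 1)) = X3 at *
  generalize onCircle (D.T k) (D.Q k) = Y3 at *
  rw [hc', ← hf'.eq_iff] at hX3 hY3
  rw [hc'] at h'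
  grind

/-- The image geodesic and the extended side `σ i + 1` now share an end and the point `V (σ i + 1)`,
so they share the other end. -/
theorem T_Q (hg : 2 ≤ g) (i : ZMod (8 * g - 4)) :
    onCircle (D.T i) (D.Q i) = D.Q (sigmaIdx g i + 2) := by
  have hne : D.P (i - 1) ≠ D.Q i := by
    have := D.P_ne_Q hg (i - 1); rwa [sub_add_cancel] at this
  have hV : D.V (sigmaIdx g i + 1) ∈
      geodesic (onCircle (D.T i) (D.P (i - 1))) (onCircle (D.T i) (D.Q i)) := by
    rw [← D.mob_T_V]
    exact SU11.mob_mem_geodesic _ (D.V_mem i).1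
  have hne' := fun e => hne (SU11.onCircle_injective (D.T i) e)
  obtain ⟨α, β, hα, hβ, h⟩ := geodesic_comb hne' hV
  have h0 := h (D.P (sigmaIdx g i + 1)) (D.Q (sigmaIdx g i + 1 + 1))
  rw [D.T_P_pred hg] at h0 hne'
  rw [D.sideFn_V_right, orient_self_mid, mul_zero, zero_add] at h0
  have := (mul_eq_zero.1 h0.symm).resolve_left hβ.ne'
  rw [orient_eq_zero_iff] at this
  rcases this with h | h | h
  · exact absurd h (D.P_ne_Q hg _)
  · rw [← h, add_assoc, one_add_one_eq_two]
  · exact absurd h hne'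

theorem T_P_succ (hg : 2 ≤ g) (i : ZMod (8 * g - 4)) :
    onCircle (D.T i) (D.P (i + 1)) = D.P (sigmaIdx g i - 1) := by
  have h := D.T_P_pred hg (sigmaIdx g i)
  rw [sigma_sigma hg] at h
  rw [← h, D.onCircle_T_sigma' hg]

theorem T_Q_succ_succ (hg : 2 ≤ g) (i : ZMod (8 * g - 4)) :
    onCircle (D.T i) (D.Q (i + 2)) = D.Q (sigmaIdx g i) := by
  have h := D.T_Q hg (sigmaIdx g i)
  rw [sigma_sigma hg] at h
  rw [← h, D.onCircle_T_sigma' hg]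

end SurfacePolygon

/-! ### Contraction of arcs -/

theorem SU11.orient_eq_mul (M : SU11) (a b c : Circle) :
    orient a b c = Complex.normSq (SU11.den M a) * Complex.normSq (SU11.den M b) *
      Complex.normSq (SU11.den M c) * orient (onCircle M a) (onCircle M b) (onCircle M c) := by
  have h := SU11.sideFn_mob_eq M a b (z := c) (Circle.norm_coe c).le
  have e : mob M c = (onCircle M c : ℂ) := rfl
  rw [e, sideFn_circle, sideFn_circle] at h
  linarith

theorem SU11.normSq_sub_eq_mul (M : SU11) (a b : Circle) :
    Complex.normSq (a - b : ℂ) = Complex.normSq (SU11.den M a) * Complex.normSq (SU11.den M b) *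
      Complex.normSq (onCircle M a - onCircle M b : ℂ) := by
  rw [← Complex.normSq_mul, ← Complex.normSq_mul]
  congr 1
  have ha := SU11.mob_mul_den M (Circle.norm_coe a).le
  have hb := SU11.mob_mul_den M (Circle.norm_coe b).le
  have e : SU11.den M a * SU11.den M b * ((onCircle M a : ℂ) - onCircle M b) =
      (mob M a * SU11.den M a) * SU11.den M b - SU11.den M a * (mob M b * SU11.den M b) := by
    change SU11.den M a * SU11.den M b * (mob M a - mob M b) = _
    ring
  have hd := M.1.2
  rw [Matrix.det_fin_two] at hd
  rw [e, ha, hb, SU11.den, SU11.den]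
  linear_combination -((a : ℂ) - b) * hd

/-- The hyperbolic density at `x` of the arc from `c` to `d`. -/
def arcDensity (c x d : Circle) : ℝ := Complex.normSq (d - c : ℂ) / orient c x d

theorem arcDensity_pos {c x d : Circle} (h : CCW c x d) : 0 < arcDensity c x d := by
  refine div_pos (Complex.normSq_pos.2 (sub_ne_zero.2 fun e => ?_)) h
  have : c = d := (Circle.ext e).symm
  rw [ccw_iff, this, orient_self_mid] at h
  exact lt_irrefl _ h

/-- With `SU11.normSq_sub_eq_mul` this makes `|x - y|² ρ(x) ρ(y)` Möbius invariant, where `ρ` is the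
density of an arc containing `x` and `y`. -/
theorem arcDensity_onCircle (M : SU11) (c x d : Circle) :
    arcDensity (onCircle M c) (onCircle M x) (onCircle M d) =
      Complex.normSq (SU11.den M x) * arcDensity c x d := by
  rw [arcDensity, arcDensity, SU11.normSq_sub_eq_mul M d c, SU11.orient_eq_mul M c x d]
  have hc := (SU11.normSq_den_pos M (Circle.norm_coe c).le).ne'
  have hd := (SU11.normSq_den_pos M (Circle.norm_coe d).le).ne'
  have hx := (SU11.normSq_den_pos M (Circle.norm_coe x).le).ne'
  by_cases h : orient (onCircle M c) (onCircle M x) (onCircle M d) = 0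
  · simp [h]
  · field_simp

theorem normSq_mul_exp_sub (b : Circle) (p r : ℝ) :
    Complex.normSq ((b * Circle.exp r : Circle) - (b * Circle.exp p : Circle) : ℂ) =
      4 * Real.sin ((r - p) / 2) ^ 2 := by
  have e := Real.cos_sq_add_sin_sq ((r - p) / 2)
  have e2 : Real.cos (r - p) = 2 * Real.cos ((r - p) / 2) ^ 2 - 1 := by
    rw [← Real.cos_two_mul]; congr 1; ring
  rw [Circle.coe_mul, Circle.coe_mul, ← mul_sub, Complex.normSq_mul, Circle.normSq_coe, one_mul,
    Circle.coe_exp, Circle.coe_exp, Complex.normSq_apply]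
  simp only [Complex.sub_re, Complex.sub_im, Complex.exp_ofReal_mul_I_re,
    Complex.exp_ofReal_mul_I_im]
  rw [Real.cos_sub] at e2
  linear_combination Real.cos_sq_add_sin_sq r + Real.cos_sq_add_sin_sq p - 2 * e2 - 4 * e

/-- The sum separates the influence of the two ends. As the cotangent decreases, enlarging the arc
lowers the density. -/
theorem arcDensity_mul_exp (b : Circle) {p q r : ℝ} (h1 : p < q) (h2 : q < r)
    (h3 : r < p + 2 * Real.pi) :
    arcDensity (b * Circle.exp p) (b * Circle.exp q) (b * Circle.exp r) =
      Real.cos ((q - p) / 2) / Real.sin ((q - p) / 2) +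
        Real.cos ((r - q) / 2) / Real.sin ((r - q) / 2) := by
  have s1 : 0 < Real.sin ((q - p) / 2) :=
    Real.sin_pos_of_pos_of_lt_pi (by linarith) (by linarith)
  have s2 : 0 < Real.sin ((r - q) / 2) :=
    Real.sin_pos_of_pos_of_lt_pi (by linarith) (by linarith)
  have s3 : 0 < Real.sin ((r - p) / 2) :=
    Real.sin_pos_of_pos_of_lt_pi (by linarith) (by linarith)
  rw [arcDensity, orient_mul_exp, normSq_mul_exp_sub]
  have e : Real.sin ((r - p) / 2) = Real.sin ((q - p) / 2) * Real.cos ((r - q) / 2) +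
      Real.cos ((q - p) / 2) * Real.sin ((r - q) / 2) := by
    rw [← Real.sin_add]; congr 1; ring
  field_simp
  linear_combination e

theorem cot_lt_cot {A B : ℝ} (h0 : 0 < A) (h : A < B) (hB : B < Real.pi) :
    Real.cos B / Real.sin B < Real.cos A / Real.sin A := by
  have sA := Real.sin_pos_of_pos_of_lt_pi h0 (h.trans hB)
  have sB := Real.sin_pos_of_pos_of_lt_pi (h0.trans h) hB
  have s := Real.sin_pos_of_pos_of_lt_pi (sub_pos.2 h) (by linarith)
  rw [div_lt_div_iff₀ sB sA]
  rw [Real.sin_sub] at s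
  linarith

theorem arcDensity_lt {c d c' d' x : Circle} (h : CCW c x d) (h' : CCW c' x d')
    (hc : CCW c' c x)
    (hd : d = d' ∨ CCW x d d') : arcDensity c' x d' < arcDensity c x d := by
  have e := angleFrom_self c'
  have hx' := angleFrom_lt c' d'
  have n1 := angleFrom_nonneg c' d'
  have n2 := angleFrom_nonneg c' c
  have n3 := angleFrom_nonneg c' d
  have n4 := angleFrom_nonneg c' x
  rw [ccw_iff_angleFrom c'] at h h' hc
  rw [ccw_iff_angleFrom c', ← (angleFrom_injective c').eq_iff] at hd
  rw [← mul_exp_angleFrom c' c, ← mul_exp_angleFrom c' d, ← mul_exp_angleFrom c' d',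
    ← mul_exp_angleFrom c' x]
  have i1 : 0 < angleFrom c' c := by grind
  have i2 : angleFrom c' c < angleFrom c' x := by grind
  have i3 : angleFrom c' x < angleFrom c' d := by grind
  have i4 : angleFrom c' d ≤ angleFrom c' d' := by grind
  nth_rewrite 1 [← mul_one c']
  rw [← Circle.exp_zero, arcDensity_mul_exp c' i2 i3 (by linarith),
    arcDensity_mul_exp c' (by linarith) (by linarith) (by linarith)]
  have j1 := cot_lt_cot (A := (angleFrom c' x - angleFrom c' c) / 2) (B := (angleFrom c' x - 0) / 2)
    (by linarith) (by linarith) (by linarith)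
  rcases i4.lt_or_eq with i5 | i5
  · have j2 := cot_lt_cot (A := (angleFrom c' d - angleFrom c' x) / 2)
      (B := (angleFrom c' d' - angleFrom c' x) / 2) (by linarith) (by linarith) (by linarith)
    linarith
  · rw [i5]; linarith

/-- A finite system of contractions of arcs has at most one solution. -/
theorem eq_of_arc_contraction {ι : Type*} [Finite ι] (c d : ι → Circle) (M : ι → SU11) (π : ι → ι)
    (hM : ∀ k x, CCW (c (π k)) x (d (π k)) →
      CCW (c k) (onCircle (M k) x) (d k) ∧
      CCW (c k) (onCircle (M k) (c (π k))) (onCircle (M k) x) ∧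
      (onCircle (M k) (d (π k)) = d k ∨ CCW (onCircle (M k) x) (onCircle (M k) (d (π k))) (d k)))
    (G G' : ι → Circle) (hG : ∀ k, CCW (c k) (G k) (d k)) (hG' : ∀ k, CCW (c k) (G' k) (d k))
    (eG : ∀ k, G k = onCircle (M k) (G (π k))) (eG' : ∀ k, G' k = onCircle (M k) (G' (π k))) :
    G = G' := by
  by_contra hne
  obtain ⟨k₀, hk₀⟩ := Function.ne_iff.1 hne
  have : Nonempty ι := ⟨k₀⟩
  -- Passing from `k` to `π k` strictly increases this invariant unless `G k = G' k`, so its maximum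
  -- must be zero.
  obtain ⟨k, hk⟩ := Finite.exists_max fun k => Complex.normSq (G k - G' k : ℂ) *
    (arcDensity (c k) (G k) (d k) * arcDensity (c k) (G' k) (d k))
  have hlt : G k ≠ G' k → Complex.normSq (G k - G' k : ℂ) *
      (arcDensity (c k) (G k) (d k) * arcDensity (c k) (G' k) (d k)) <
      Complex.normSq (G (π k) - G' (π k) : ℂ) * (arcDensity (c (π k)) (G (π k)) (d (π k)) *
        arcDensity (c (π k)) (G' (π k)) (d (π k))) := by
    intro hn
    have hp : 0 < Complex.normSq (G k - G' k : ℂ) :=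
      Complex.normSq_pos.2 (sub_ne_zero.2 fun e => hn (Circle.ext e))
    obtain ⟨a1, a2, a3⟩ := hM k _ (hG (π k))
    obtain ⟨b1, b2, b3⟩ := hM k _ (hG' (π k))
    have l1 := arcDensity_lt ((SU11.ccw_iff (M k)).2 (hG (π k))) a1 a2 a3
    have l2 := arcDensity_lt ((SU11.ccw_iff (M k)).2 (hG' (π k))) b1 b2 b3
    have e := SU11.normSq_sub_eq_mul (M k) (G (π k)) (G' (π k))
    rw [arcDensity_onCircle] at l1 l2
    rw [← eG k] at a1 l1 e
    rw [← eG' k] at b1 l2 e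
    rw [e]
    refine (mul_lt_mul_of_pos_left (mul_lt_mul'' l1 l2 (arcDensity_pos a1).le
      (arcDensity_pos b1).le) hp).trans_eq ?_
    ring
  have h1 : G k = G' k := by
    by_contra hn
    exact absurd (hk (π k)) (not_le.2 (hlt hn))
  have h2 := hk k₀
  simp only [h1, sub_self, map_zero, zero_mul] at h2
  have h3 : 0 < Complex.normSq (G k₀ - G' k₀ : ℂ) :=
      Complex.normSq_pos.2 (sub_ne_zero.2 fun e => hk₀ (Circle.ext e))
  have := mul_pos h3 (mul_pos (arcDensity_pos (hG k₀)) (arcDensity_pos (hG' k₀)))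
  linarith

/-! ### Fixed points of monotone systems of arc maps. -/

theorem angleFrom_mul_exp (b : Circle) {t : ℝ} (h0 : 0 ≤ t) (h1 : t < 2 * Real.pi) :
    angleFrom b (b * Circle.exp t) = t := by
  rw [angleFrom, mul_div_cancel_left]
  by_cases h : t ≤ Real.pi
  · rw [Circle.arg_exp (by linarith [Real.pi_pos]) h, if_neg (not_lt.2 h0)]
  · have e : Circle.exp t = Circle.exp (t - 2 * Real.pi) := by
      rw [Circle.exp_sub, Circle.exp_two_pi, div_one]
    rw [e, Circle.arg_exp (by linarith) (by linarith), if_pos (by linarith)]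
    ring

/-- A system of orientation preserving self-maps of arcs has a solution. -/
theorem exists_fixed_of_arcs {ι : Type*} (a b : ι → Circle) (M : ι → SU11)
    (π : ι → ι) (hab : ∀ k, a k ≠ b k)
    (hMa : ∀ k, onCircle (M k) (a (π k)) = a k ∨
      CCW (a k) (onCircle (M k) (a (π k))) (onCircle (M k) (b (π k))))
    (hMb : ∀ k, onCircle (M k) (b (π k)) = b k ∨ CCW (a k) (onCircle (M k) (b (π k))) (b k)) :
    ∃ G : ι → Circle, (∀ k, G k ∈ arcCC (a k) (b k)) ∧ ∀ k, G k = onCircle (M k) (G (π k)) := by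
  obtain ⟨β, hβ⟩ : ∃ β : ι → ℝ, β = fun k => angleFrom (a k) (b k) := ⟨_, rfl⟩
  have hβ0 : ∀ k, 0 ≤ β k := fun k => hβ ▸ angleFrom_nonneg _ _
  have hβ2 : ∀ k, β k < 2 * Real.pi := fun k => hβ ▸ angleFrom_lt _ _
  have hlt : ∀ k, angleFrom (a k) (onCircle (M k) (a (π k))) <
      angleFrom (a k) (onCircle (M k) (b (π k))) ∧
      angleFrom (a k) (onCircle (M k) (b (π k))) ≤ β k := by
    intro k
    have e := angleFrom_self (a k)
    have n1 := angleFrom_nonneg (a k) (onCircle (M k) (a (π k)))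
    have n2 := angleFrom_nonneg (a k) (onCircle (M k) (b (π k)))
    have n3 := angleFrom_nonneg (a k) (b k)
    have ne : angleFrom (a k) (onCircle (M k) (a (π k))) ≠
        angleFrom (a k) (onCircle (M k) (b (π k))) := fun h =>
      hab (π k) (SU11.onCircle_injective _ (angleFrom_injective _ h))
    have h1 := hMa k
    have h2 := hMb k
    rw [ccw_iff_angleFrom (a k), ← (angleFrom_injective (a k)).eq_iff] at h1 h2
    rw [hβ]
    constructor <;> grind
  -- In angles measured from the left ends, each map is monotone and stays within the target arc.
  have key : ∀ k (s t : ℝ), 0 ≤ s → s ≤ t → t ≤ β (π k) →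
      angleFrom (a k) (onCircle (M k) (a (π k) * Circle.exp s)) ≤
      angleFrom (a k) (onCircle (M k) (a (π k) * Circle.exp t)) ∧
      angleFrom (a k) (onCircle (M k) (a (π k) * Circle.exp t)) ≤ β k := by
    intro k s t hs hst ht
    have hb2 := hβ2 (π k)
    obtain ⟨x, hx⟩ : ∃ x, x = a (π k) * Circle.exp s := ⟨_, rfl⟩
    obtain ⟨y, hy⟩ : ∃ y, y = a (π k) * Circle.exp t := ⟨_, rfl⟩
    have ex : angleFrom (a (π k)) x = s := by rw [hx, angleFrom_mul_exp _ hs (by linarith)]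
    have ey : angleFrom (a (π k)) y = t := by rw [hy, angleFrom_mul_exp _ (by linarith) (by linarith)]
    rw [← hx, ← hy]
    have e0 := angleFrom_self (a (π k))
    have eb : angleFrom (a (π k)) (b (π k)) = β (π k) := by rw [hβ]
    have bp : 0 < β (π k) := (hβ0 _).lt_of_ne fun h => hab (π k)
      (angleFrom_injective (a (π k)) (by rw [e0, eb, h]))
    have c1 : a (π k) = x ∨ x = y ∨ CCW (a (π k)) x y := by
      rw [ccw_iff_angleFrom (a (π k)), ← (angleFrom_injective (a (π k))).eq_iff,
        ← (angleFrom_injective (a (π k))).eq_iff]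
      grind
    have c2 : a (π k) = x ∨ x = b (π k) ∨ CCW (a (π k)) x (b (π k)) := by
      rw [ccw_iff_angleFrom (a (π k)), ← (angleFrom_injective (a (π k))).eq_iff,
        ← (angleFrom_injective (a (π k))).eq_iff]
      grind
    have c3 : a (π k) = y ∨ y = b (π k) ∨ CCW (a (π k)) y (b (π k)) := by
      rw [ccw_iff_angleFrom (a (π k)), ← (angleFrom_injective (a (π k))).eq_iff,
        ← (angleFrom_injective (a (π k))).eq_iff]
      grind
    have c4 : x = b (π k) → y = b (π k) := by
      rw [← (angleFrom_injective (a (π k))).eq_iff,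
        ← (angleFrom_injective (a (π k))).eq_iff]
      grind
    have h := hlt k
    have tr : ∀ {p q r : Circle}, p = q ∨ q = r ∨ CCW p q r →
        onCircle (M k) p = onCircle (M k) q ∨ onCircle (M k) q = onCircle (M k) r ∨
          CCW (onCircle (M k) p) (onCircle (M k) q) (onCircle (M k) r) := fun h =>
      h.imp (congrArg _) (Or.imp (congrArg _) (SU11.ccw_iff (M k)).2)
    replace c1 := tr c1
    replace c2 := tr c2
    replace c3 := tr c3
    rw [← (SU11.onCircle_injective (M k)).eq_iff (a := x),
      ← (SU11.onCircle_injective (M k)).eq_iff (a := y),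
      ← (angleFrom_injective (a k)).eq_iff, ← (angleFrom_injective (a k)).eq_iff] at c4
    rw [ccw_iff_angleFrom (a k),
      ← (angleFrom_injective (a k)).eq_iff, ← (angleFrom_injective (a k)).eq_iff] at c1 c2 c3
    clear tr hlt hMa hMb hab hβ hβ0 hβ2 hx hy ex ey e0 eb bp
    constructor <;> grind
  -- These instances make the product of intervals a complete lattice, so Knaster–Tarski applies to
  -- the monotone map `Ψ`.
  have : ∀ k, Fact ((0 : ℝ) ≤ β k) := fun k => ⟨hβ0 k⟩
  let Ψ : (∀ k, Icc (0 : ℝ) (β k)) →o (∀ k, Icc (0 : ℝ) (β k)) :=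
    { toFun := fun t k => ⟨angleFrom (a k) (onCircle (M k) (a (π k) * Circle.exp (t (π k)))),
        angleFrom_nonneg _ _, (key k _ _ (t (π k)).2.1 le_rfl (t (π k)).2.2).2⟩
      monotone' := fun s t hst k => (key k _ _ (s (π k)).2.1 (hst (π k)) (t (π k)).2.2).1 }
  obtain ⟨t, ht⟩ : ∃ t, Ψ t = t := ⟨_, OrderHom.map_lfp Ψ⟩
  refine ⟨fun k => a k * Circle.exp (t k), fun k => ?_, fun k => ?_⟩
  · have h0 := angleFrom_mul_exp (a k) (t k).2.1 ((t k).2.2.trans_lt (hβ2 k))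
    have h1 := (t k).2.1
    have h2 := (t k).2.2
    have e0 := angleFrom_self (a k)
    have eb : angleFrom (a k) (b k) = β k := by rw [hβ]
    simp only [arcCC, mem_ofPred_eq]
    rw [ccw_iff_angleFrom (a k), ← (angleFrom_injective (a k)).eq_iff,
      ← (angleFrom_injective (a k)).eq_iff]
    grind
  · have h := congrArg Subtype.val (congrFun ht k)
    change angleFrom (a k) (onCircle (M k) (a (π k) * Circle.exp (t (π k)))) = t k at h
    change a k * Circle.exp (t k) = _
    rw [← h, mul_exp_angleFrom]

namespace SurfacePolygon

variable {g : ℕ} (D : SurfacePolygon g)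

/-! ### The transformations `U i` -/

theorem onCircle_U (i : ZMod (8 * g - 4)) (x : Circle) : onCircle (D.U i) x =
    onCircle (D.T (sigmaIdx g (i - 1))) (onCircle (D.T (tauIdx g i)) x) :=
  SU11.onCircle_mul _ _ _

/-- This and the next three lemmas say that `U i` takes the two extended sides through `V (τ i)` to
those through `V i`, with directions reversed. Geometrically it moves the polygon to the tile
opposite it at `V i`. -/
theorem U_P_tau_pred (hg : 2 ≤ g) (i : ZMod (8 * g - 4)) :
    onCircle (D.U i) (D.P (tauIdx g i - 1)) = D.Q i := by
  rw [onCircle_U, D.T_P_pred hg, sigma_tau_eq hg, sub_add_cancel, D.T_P hg, sigma_sigma hg,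
    sub_add_cancel]

theorem U_P_tau (hg : 2 ≤ g) (i : ZMod (8 * g - 4)) :
    onCircle (D.U i) (D.P (tauIdx g i)) = D.Q (i + 1) := by
  rw [onCircle_U, D.T_P hg, sigma_tau_eq hg, sub_add_cancel, D.T_Q hg, sigma_sigma hg]
  congr 1; ring

theorem U_Q_tau (hg : 2 ≤ g) (i : ZMod (8 * g - 4)) :
    onCircle (D.U i) (D.Q (tauIdx g i)) = D.P (i - 1) := by
  rw [onCircle_U, D.T_Q hg, sigma_tau_eq hg, show sigmaIdx g (i - 1) - 1 + 2 =
    sigmaIdx g (i - 1) + 1 by ring, D.T_Q_succ hg, sigma_sigma hg]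

theorem U_Q_tau_succ (hg : 2 ≤ g) (i : ZMod (8 * g - 4)) :
    onCircle (D.U i) (D.Q (tauIdx g i + 1)) = D.P i := by
  rw [onCircle_U, D.T_Q_succ hg, sigma_tau_eq hg, D.T_P_pred hg, sigma_sigma hg, sub_add_cancel]

theorem U_V (hg : 2 ≤ g) (i : ZMod (8 * g - 4)) : mob (D.U i) (D.V (tauIdx g i)) = D.V i := by
  rw [U, SU11.mob_mul _ _ (D.norm_V_lt _).le, D.mob_T_V, sigma_tau_eq hg, sub_add_cancel, D.mob_T_V,
    sigma_sigma hg, sub_add_cancel]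

theorem U_tau_U (hg : 2 ≤ g) (i : ZMod (8 * g - 4)) (x : Circle) :
    onCircle (D.U (tauIdx g i)) (onCircle (D.U i) x) = x := by
  have h := D.onCircle_T_cycle hg (tauIdx g i) x
  rw [tau_tau hg, sigma_tau_eq hg, sub_add_cancel] at h
  rw [onCircle_U, onCircle_U, tau_tau hg]
  exact h

theorem U_U_tau (hg : 2 ≤ g) (i : ZMod (8 * g - 4)) (x : Circle) :
    onCircle (D.U i) (onCircle (D.U (tauIdx g i)) x) = x := by
  have := D.U_tau_U hg (tauIdx g i) x
  rwa [tau_tau hg] at this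

/-- This and the next three identities are the algebra of the conjugacy. A suitable `U` applied
after `T i` shifts its index by one; applied before `T (τ m)` or `T (τ m - 1)`, it yields `T (m -
1)` or `T m`. -/
theorem T_tau_U_tau (hg : 2 ≤ g) (m : ZMod (8 * g - 4)) (x : Circle) :
    onCircle (D.T (tauIdx g m)) (onCircle (D.U (tauIdx g m)) x) = onCircle (D.T (m - 1)) x := by
  have h := D.U_U_tau hg m x
  rw [onCircle_U] at h
  conv_rhs => rw [← h]
  rw [D.onCircle_T_sigma' hg]

theorem T_tau_pred_U_tau (hg : 2 ≤ g) (m : ZMod (8 * g - 4)) (x : Circle) :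
    onCircle (D.T (tauIdx g m - 1)) (onCircle (D.U (tauIdx g m)) x) = onCircle (D.T m) x := by
  rw [onCircle_U, D.onCircle_T_sigma' hg, tau_tau hg]

theorem U_tau_sigma_T (hg : 2 ≤ g) (i : ZMod (8 * g - 4)) (x : Circle) :
    onCircle (D.U (tauIdx g (sigmaIdx g i))) (onCircle (D.T i) x) = onCircle (D.T (i + 1)) x := by
  have e : sigmaIdx g (tauIdx g (sigmaIdx g i) - 1) = i + 1 := by
    rw [← sigma_sigma_add_one hg, sigma_sigma hg, sigma_sigma hg]
  rw [onCircle_U, e, tau_tau hg, D.onCircle_T_sigma]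

theorem U_tau_sigma_succ_T (hg : 2 ≤ g) (i : ZMod (8 * g - 4)) (x : Circle) :
    onCircle (D.U (tauIdx g (sigmaIdx g i + 1))) (onCircle (D.T i) x) =
      onCircle (D.T (i - 1)) x := by
  have e : sigmaIdx g (tauIdx g (sigmaIdx g i + 1) - 1) = tauIdx g i := by
    rw [tau_add_one, add_sub_cancel_right, sigma_tau_eq hg, sigma_sigma_sub_one hg,
      add_sub_cancel_right]
  rw [onCircle_U, e, tau_tau hg]
  have h := D.onCircle_T_cycle hg i x
  conv_rhs => rw [← h]
  rw [D.onCircle_T_sigma' hg]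

/-- Used in `conj_low` and `conj_up` to rule out that the exit side and the arithmetic index of the
moved pair are both shifted. -/
theorem U_P_tau_succ_mem (hg : 2 ≤ g) (m : ZMod (8 * g - 4)) :
    CCW (D.Q (m - 1)) (onCircle (D.U m) (D.P (tauIdx g m + 1))) (D.P m) := by
  obtain ⟨s, hs⟩ : ∃ s, s = sigmaIdx g (m - 1) := ⟨_, rfl⟩
  have e : sigmaIdx g s = m - 1 := by rw [hs, sigma_sigma hg]
  obtain ⟨f, hf, hc, -, hh⟩ := D.exists_chain hg s
  have h : CCW (D.Q (s + 2)) (D.P (s - 2)) (D.P (s - 1)) := by rw [hc]; grind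
  rw [← SU11.ccw_iff (D.T s), D.T_Q_succ_succ hg, D.T_P_pred hg, e, sub_add_cancel] at h
  rw [onCircle_U, D.T_P_succ hg, sigma_tau_eq hg, ← hs, show s - 1 - 1 = s - 2 by ring]
  exact h

/-! ### The corner system -/

theorem P_ne_Q_self (hg : 2 ≤ g) (i : ZMod (8 * g - 4)) : D.P i ≠ D.Q i := by
  obtain ⟨f, hf, hc, -, h⟩ := D.exists_chain hg i
  intro e
  have := congrArg f e
  grind

open scoped Classical in
/-- The transformation that determines `G k`. -/
def cornerMap (A : ZMod (8 * g - 4) → Circle) (k : ZMod (8 * g - 4)) : SU11 :=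
  if A (sigmaIdx g k) = D.P (sigmaIdx g k) then D.T (sigmaIdx g k)
  else D.T (tauIdx g (sigmaIdx g k) + 1)

open scoped Classical in
/-- The index of the point that determines `G k`. -/
def cornerIdx (A : ZMod (8 * g - 4) → Circle) (k : ZMod (8 * g - 4)) : ZMod (8 * g - 4) :=
  if A (sigmaIdx g k) = D.P (sigmaIdx g k) then sigmaIdx g k - 2 else tauIdx g (sigmaIdx g k)

/-- As `σ` is an involution, indexing by `k = σ i` merges the two families of equations into one
recursion. -/
theorem isCornerSystem_iff (hg : 2 ≤ g) {A : ZMod (8 * g - 4) → Circle} (hA : D.IsExtremal A)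
    (G : ZMod (8 * g - 4) → Circle) : D.IsCornerSystem A G ↔
      (∀ i, G i ∈ arcCC (D.P i) (D.P (i + 1))) ∧
      ∀ k, G k = onCircle (D.cornerMap A k) (G (D.cornerIdx A k)) := by
  constructor
  · rintro ⟨h1, h2, h3⟩
    refine ⟨h1, fun k => ?_⟩
    simp only [cornerMap, cornerIdx]
    split_ifs with h
    · have := h2 _ h
      rwa [sigma_sigma hg] at this
    · have := h3 _ ((hA _).resolve_left h)
      rwa [sigma_sigma hg] at this
  · rintro ⟨h1, h2⟩
    refine ⟨h1, fun i hi => ?_, fun i hi => ?_⟩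
    · have := h2 (sigmaIdx g i)
      rwa [cornerMap, cornerIdx, sigma_sigma hg, if_pos hi, if_pos hi] at this
    · have hi' : A i ≠ D.P i := fun e => D.P_ne_Q_self hg i (e.symm.trans hi)
      have := h2 (sigmaIdx g i)
      rwa [cornerMap, cornerIdx, sigma_sigma hg, if_neg hi', if_neg hi'] at this

/-- For existence the arcs `[P k, P (k + 1)]` are used; the maps send them into one another with one
end in common. For uniqueness they are enlarged to `(Q (k - 1), Q (k + 1))`: solutions are then
interior, and the inclusion of images is strict at the left end. -/
theorem existsUnique_cornerSystem (hg : 2 ≤ g) {A : ZMod (8 * g - 4) → Circle}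
    (hA : D.IsExtremal A) : ∃! G : ZMod (8 * g - 4) → Circle, D.IsCornerSystem A G := by
  have := neZero_index hg
  have hQ : ∀ k : ZMod (8 * g - 4), sigmaIdx g (tauIdx g (sigmaIdx g k) + 1) = k - 1 := fun k => by
    rw [sigma_tau_add_one hg, sigma_sigma hg]
  obtain ⟨G, hG1, hG2⟩ := exists_fixed_of_arcs D.P (fun k => D.P (k + 1)) (D.cornerMap A)
    (D.cornerIdx A) (fun k e => by
      obtain ⟨f, hf, hc, -, hh⟩ := D.exists_chain hg k
      have := congrArg f e
      grind) (fun k => by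
      simp only [cornerMap, cornerIdx]
      split_ifs with h
      · right
        obtain ⟨s, hs⟩ : ∃ s, s = sigmaIdx g k := ⟨_, rfl⟩
        have e : sigmaIdx g s = k := by rw [hs, sigma_sigma hg]
        obtain ⟨f, hf, hc, -, hh⟩ := D.exists_chain hg s
        obtain ⟨f', hf', hc', -, hh'⟩ := D.exists_chain hg k
        have h : CCW (D.Q (s + 2)) (D.P (s - 2)) (D.P (s - 1)) := by rw [hc]; grind
        rw [← SU11.ccw_iff (D.T s), D.T_Q_succ_succ hg, D.T_P_pred hg, e] at h
        rw [← hs, show s - 2 + 1 = s - 1 by ring, D.T_P_pred hg, e]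
        rw [hc'] at h ⊢
        grind
      · left
        have h := D.T_P_pred hg (tauIdx g (sigmaIdx g k) + 1)
        rwa [add_sub_cancel_right, hQ, sub_add_cancel] at h) (fun k => by
      simp only [cornerMap, cornerIdx]
      split_ifs with h
      · left
        have h := D.T_P_pred hg (sigmaIdx g k)
        rwa [sigma_sigma hg, show sigmaIdx g k - 1 = sigmaIdx g k - 2 + 1 by ring] at h
      · right
        rw [D.T_P hg, hQ, sub_add_cancel]
        obtain ⟨f', hf', hc', -, hh'⟩ := D.exists_chain hg k
        rw [hc']
        grind)
  have hin : ∀ {G : ZMod (8 * g - 4) → Circle}, (∀ i, G i ∈ arcCC (D.P i) (D.P (i + 1))) →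
      ∀ k, CCW (D.Q (k - 1)) (G k) (D.Q (k + 1)) := by
    intro G h k
    obtain ⟨f, hf, hc, -, hh⟩ := D.exists_chain hg k
    have := h k
    simp only [arcCC, mem_ofPred_eq] at this
    rw [hc, ← hf.eq_iff, ← hf.eq_iff] at this
    rw [hc]
    grind
  refine ⟨G, (D.isCornerSystem_iff hg hA G).2 ⟨hG1, hG2⟩, fun G' hG' => ?_⟩
  obtain ⟨h1, h2⟩ := (D.isCornerSystem_iff hg hA G').1 hG'
  refine eq_of_arc_contraction (fun k => D.Q (k - 1)) (fun k => D.Q (k + 1)) (D.cornerMap A)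
    (D.cornerIdx A) ?_ G' G (hin h1) (hin hG1) h2 hG2
  intro k x hx
  obtain ⟨f', hf', hc', -, hh'⟩ := D.exists_chain hg k
  simp only [cornerMap, cornerIdx] at hx ⊢
  split_ifs at hx ⊢ with h
  · obtain ⟨s, hs⟩ : ∃ s, s = sigmaIdx g k := ⟨_, rfl⟩
    have e : sigmaIdx g s = k := by rw [hs, sigma_sigma hg]
    obtain ⟨f, hf, hc, -, hh⟩ := D.exists_chain hg s
    rw [← hs, show s - 2 - 1 = s - 3 by ring, show s - 2 + 1 = s - 1 by ring] at hx ⊢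
    have k1 : CCW (D.Q (s + 2)) (D.Q (s - 3)) (D.P s) := by rw [hc]; grind
    have k2 : CCW (D.Q (s - 3)) x (D.P s) := by rw [hc] at hx ⊢; grind
    have k3 : CCW x (D.Q (s - 1)) (D.P s) := by rw [hc] at hx ⊢; grind
    rw [← SU11.ccw_iff (D.T s), D.T_P hg, e] at k1 k2 k3
    rw [D.T_Q_succ_succ hg, e] at k1
    rw [hc'] at k1 k2 k3 ⊢
    rw [hc', hc']
    grind
  · obtain ⟨t, ht⟩ : ∃ t, t = tauIdx g (sigmaIdx g k) + 1 := ⟨_, rfl⟩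
    have ht' : tauIdx g (sigmaIdx g k) = t - 1 := by rw [ht]; ring
    have e : sigmaIdx g t = k - 1 := by rw [ht, hQ]
    obtain ⟨f, hf, hc, -, hh⟩ := D.exists_chain hg t
    rw [ht', sub_add_cancel, show t - 1 - 1 = t - 2 by ring] at hx ⊢
    have k1 : CCW (D.Q (t + 2)) (D.Q (t - 2)) (D.Q t) := by rw [hc]; grind
    have k3 := hx
    rw [← SU11.ccw_iff (D.T t), D.T_Q hg, e] at k1 k3
    rw [D.T_Q_succ_succ hg, e] at k1
    rw [D.T_Q hg, e]
    rw [show k - 1 + 2 = k + 1 by ring] at k1 k3 ⊢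
    rw [hc'] at k1 k3 ⊢
    rw [hc', hc']
    grind

variable {A G : ZMod (8 * g - 4) → Circle}

theorem H_mem (hg : 2 ≤ g) (hG : ∀ i, G i ∈ arcCC (D.P i) (D.P (i + 1))) (i : ZMod (8 * g - 4)) :
    D.H G i ∈ arcCC (D.Q i) (D.Q (i + 1)) := by
  have h := hG (tauIdx g i - 1)
  rw [← SU11.arcCC_iff (D.U i), sub_add_cancel, D.U_P_tau_pred hg, D.U_P_tau hg] at h
  exact h

theorem U_tau_H (hg : 2 ≤ g) (i : ZMod (8 * g - 4)) :
    onCircle (D.U (tauIdx g i)) (D.H G i) = G (tauIdx g i - 1) := D.U_tau_U hg i _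

/-- Consequently the equation for `A i = Q i` reads `G (σ i) = T i (H (i + 1))`, in parallel with
`eq_of_P`. -/
theorem T_H_succ (hg : 2 ≤ g) (i : ZMod (8 * g - 4)) :
    onCircle (D.T i) (D.H G (i + 1)) = onCircle (D.T (tauIdx g i + 1)) (G (tauIdx g i)) := by
  rw [H, onCircle_U, add_sub_cancel_right, D.onCircle_T_sigma' hg, tau_add_one,
    add_sub_cancel_right]

theorem U_sigma_T_succ (hg : 2 ≤ g) (i : ZMod (8 * g - 4)) (x : Circle) :
    onCircle (D.U (sigmaIdx g i)) (onCircle (D.T (i + 1)) x) = onCircle (D.T i) x := by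
  rw [← D.U_tau_sigma_T hg, D.U_U_tau hg]

theorem tau_sigma_sub_one (hg : 2 ≤ g) (i : ZMod (8 * g - 4)) :
    tauIdx g (sigmaIdx g i) - 1 = sigmaIdx g (i + 1) := by
  rw [← sigma_sigma_add_one hg, sigma_sigma hg]

/-- The equation of index `i + 1` for `G`, transported by `U (σ i)`. With `H_sigma_of_Q` it shows
that the points `H` satisfy recursions of the same kind. -/
theorem H_sigma_of_P (hg : 2 ≤ g) (h : D.IsCornerSystem A G) {i : ZMod (8 * g - 4)}
    (hA : A (i + 1) = D.P (i + 1)) : D.H G (sigmaIdx g i) = onCircle (D.T i) (G (i - 1)) := by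
  rw [H, tau_sigma_sub_one hg, h.eq_of_P _ hA, D.U_sigma_T_succ hg]
  congr 2; ring

theorem H_sigma_of_Q (hg : 2 ≤ g) (h : D.IsCornerSystem A G) {i : ZMod (8 * g - 4)}
    (hA : A (i + 1) = D.Q (i + 1)) :
    D.H G (sigmaIdx g i) = onCircle (D.T i) (D.H G (i + 2)) := by
  rw [H, tau_sigma_sub_one hg, h.eq_of_Q _ hA, ← D.T_H_succ hg, D.U_sigma_T_succ hg]
  congr 2; ring

end SurfacePolygon

/-! ### Arcs and cells of the circle. -/

theorem mem_arcCC {a b x : Circle} : x ∈ arcCC a b ↔ x = a ∨ x = b ∨ CCW a x b := Iff.rfl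

theorem sideFn_swap (u w : Circle) (z : ℂ) : sideFn w u z = - sideFn u w z := by
  rw [sideFn_eq_det3, sideFn_eq_det3]; simp only [det3]; ring

theorem geodesic_swap (u w : Circle) : geodesic w u = geodesic u w := by
  ext z; simp only [geodesic, mem_ofPred_eq, sideFn_swap u w, neg_eq_zero]

/-- The order of points in a linear coordinate determines the arc between consecutive points of a
cyclic sequence. -/
theorem cell_unique {n : ℕ} [NeZero n] {E : ZMod n → Circle} {f : Circle → ℝ}
    (hf : Function.Injective f) (hc : ∀ x y z, CCW x y z ↔
      (f x < f y ∧ f y < f z) ∨ (f y < f z ∧ f z < f x) ∨ (f z < f x ∧ f x < f y))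
    {i j : ZMod n} {w : Circle} (hmono : ∀ s t : ℕ, s < t → t < n → f (E (j + s)) < f (E (j + t)))
    (hn : 1 < n) (hi : w ∈ arcCC (E i) (E (i + 1))) (hj : CCW (E j) w (E (j + 1))) : i = j := by
  obtain ⟨t, ht⟩ : ∃ t, t = (i - j).val := ⟨_, rfl⟩
  have htN : t < n := by rw [ht]; exact ZMod.val_lt _
  have hm : i = j + (t : ℕ) := by rw [ht, ZMod.natCast_zmod_val]; ring
  rcases Nat.eq_zero_or_pos t with h0 | h0
  · rw [hm, h0]; simp
  exfalso
  have a := hmono 0 1 one_pos hn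
  have b := hmono 0 t h0 htN
  have b' : f (E (j + 1)) ≤ f (E i) := by
    rcases (Nat.succ_le_of_lt h0).eq_or_lt with h1 | h1
    · rw [hm, ← h1]; simp
    · have := hmono 1 t h1 htN
      rw [← hm] at this
      simpa using this.le
  have b'' : f (E i) < f (E (i + 1)) ∨ E (i + 1) = E j := by
    by_cases h1 : t + 1 < n
    · left
      have := hmono t (t + 1) (by omega) h1
      rwa [Nat.cast_add, Nat.cast_one, ← add_assoc, ← hm] at this
    · right
      have : t + 1 = n := by omega
      rw [hm, add_assoc, ← Nat.cast_one (R := ZMod n), ← Nat.cast_add, this, ZMod.natCast_self,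
        add_zero]
  simp only [Nat.cast_zero, add_zero, Nat.cast_one, ← hm] at a b
  rw [mem_arcCC, ← hf.eq_iff, ← hf.eq_iff, hc] at hi
  rw [hc] at hj
  rcases b'' with h | h
  · grind
  · rw [h] at hi; grind

namespace SurfacePolygon

variable {g : ℕ} (D : SurfacePolygon g)

theorem index_eq_of_P (hg : 2 ≤ g) {i j : ZMod (8 * g - 4)} {w : Circle}
    (hi : w ∈ arcCC (D.P i) (D.P (i + 1))) (hj : CCW (D.P j) w (D.P (j + 1))) : i = j := by
  have := neZero_index hg
  obtain ⟨f, hf, hn, hc, hPQ, hQP⟩ := D.exists_cut_index hg j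
  exact cell_unique hf hc (fun s t hst ht => (hPQ s (by omega)).trans (hQP s t hst ht)) (by omega)
    hi hj

theorem index_eq_of_Q (hg : 2 ≤ g) {i j : ZMod (8 * g - 4)} {w : Circle}
    (hi : w ∈ arcCC (D.Q i) (D.Q (i + 1))) (hj : CCW (D.Q j) w (D.Q (j + 1))) : i = j := by
  have := neZero_index hg
  obtain ⟨f, hf, hn, hc, hPQ, hQP⟩ := D.exists_cut_index hg j
  exact cell_unique hf hc (fun s t hst ht => (hQP s t hst ht).trans (hPQ t ht)) (by omega)
    hi hj

theorem exists_cell (hg : 2 ≤ g) (w : Circle) :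
    ∃ i, w = D.P i ∨ CCW (D.P i) w (D.P (i + 1)) := by
  have := neZero_index hg
  obtain ⟨f, hf, hn, hc, hPQ, hQP⟩ := D.exists_cut_index hg 0
  have hmono : ∀ s t : ℕ, s < t → t < 8 * g - 4 → f (D.P (0 + s)) < f (D.P (0 + t)) :=
    fun s t hst ht => (hPQ s (by omega)).trans (hQP s t hst ht)
  simp only [zero_add] at hmono
  obtain ⟨s, ⟨hs, hsw⟩, hmax⟩ : ∃ s : ℕ, (s < 8 * g - 4 ∧ f (D.P s) ≤ f w) ∧
      ∀ t : ℕ, t < 8 * g - 4 → f (D.P t) ≤ f w → t ≤ s := by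
    have hne : ((Finset.range (8 * g - 4)).filter fun s : ℕ => f (D.P s) ≤ f w).Nonempty :=
      ⟨0, by
        rw [Finset.mem_filter, Finset.mem_range]
        exact ⟨by omega, by simpa using hn w⟩⟩
    obtain ⟨s, hs, hm⟩ := Finset.exists_max_image _ id hne
    rw [Finset.mem_filter, Finset.mem_range] at hs
    refine ⟨s, hs, fun t h1 h2 => hm t ?_⟩
    rw [Finset.mem_filter, Finset.mem_range]
    exact ⟨h1, h2⟩
  refine ⟨s, ?_⟩
  rcases hsw.eq_or_lt with h | h
  · exact Or.inl (hf h).symm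
  right
  rw [hc]
  by_cases h1 : s + 1 < 8 * g - 4
  · left
    refine ⟨h, lt_of_not_ge fun hle => ?_⟩
    have := hmax (s + 1) h1 (by push_cast; exact hle)
    omega
  · right; right
    have e : (s : ZMod (8 * g - 4)) + 1 = 0 := by
      rw [← Nat.cast_one (R := ZMod (8 * g - 4)), ← Nat.cast_add, show s + 1 = 8 * g - 4 by omega,
        ZMod.natCast_self]
    rw [e]
    have := hmono 0 s (by omega) hs
    rw [Nat.cast_zero] at this
    exact ⟨this, h⟩

theorem exists_cell_PQ (hg : 2 ≤ g) (w : Circle) :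
    ∃ i, w ∈ arcCC (D.P i) (D.Q i) ∨ w ∈ arcCC (D.Q i) (D.P (i + 1)) := by
  obtain ⟨i, hi⟩ := D.exists_cell hg w
  refine ⟨i, ?_⟩
  obtain ⟨f, hf, hc, -, hh⟩ := D.exists_chain hg i
  simp only [mem_arcCC, hc, ← hf.eq_iff] at hi ⊢
  grind

/-! ### Geodesics meeting the polygon -/

theorem OmegaGeo_swap {u w : Circle} : (w, u) ∈ D.OmegaGeo ↔ (u, w) ∈ D.OmegaGeo := by
  simp only [OmegaGeo, mem_ofPred_eq, geodesic_swap u w]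
  rw [ne_comm]

/-- An explicit intermediate value on the segment between two vertices: the weights are chosen so
that `sideFn u w` cancels, and the polygon is convex in the lift. -/
theorem mem_OmegaGeo_of_signs (hg : 2 ≤ g) {u w : Circle} (h : u ≠ w) {i j : ZMod (8 * g - 4)}
    (hi : sideFn u w (D.V i) ≤ 0) (hj : 0 ≤ sideFn u w (D.V j)) : (u, w) ∈ D.OmegaGeo := by
  refine ⟨h, ?_⟩
  rcases hj.eq_or_lt with hj0 | hj
  · exact ⟨D.V j, ⟨D.norm_V_lt j, hj0.symm⟩, D.V_mem_F hg j⟩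
  obtain ⟨z, hz, c, hc, hzc⟩ := exists_combination (D.norm_V_lt i) (D.norm_V_lt j).le hj
    (neg_nonneg.2 hi)
  refine ⟨z, ⟨hz, by rw [hzc]; ring⟩, hz, fun k => ?_⟩
  rw [hzc]
  exact mul_nonneg hc.le (add_nonneg (mul_nonneg hj.le (D.sideFn_V_nonneg hg i k))
    (mul_nonneg (neg_nonneg.2 hi) (D.sideFn_V_nonneg hg j k)))

theorem orient_eq_zero_of_mem_OmegaGeo {u w : Circle} (h : (u, w) ∈ D.OmegaGeo)
    {i : ZMod (8 * g - 4)} (hu : orient (D.P i) (D.Q (i + 1)) u ≤ 0)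
    (hw : orient (D.P i) (D.Q (i + 1)) w ≤ 0) :
    orient (D.P i) (D.Q (i + 1)) u = 0 ∧ orient (D.P i) (D.Q (i + 1)) w = 0 := by
  obtain ⟨hne, z, hz, hzF⟩ := h
  obtain ⟨α, β, hα, hβ, hc⟩ := geodesic_comb hne hz
  have := hzF.2 i
  rw [hc] at this
  have h1 := mul_nonpos_of_nonneg_of_nonpos hα.le hu
  have h2 := mul_nonpos_of_nonneg_of_nonpos hβ.le hw
  exact ⟨(mul_eq_zero.1 (by linarith : α * _ = 0)).resolve_left hα.ne',
    (mul_eq_zero.1 (by linarith : β * _ = 0)).resolve_left hβ.ne'⟩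

/-- Two points of the closed arc cut off by side `i` do not span a geodesic meeting the polygon,
unless the geodesic extends the side. -/
theorem not_mem_OmegaGeo (hg : 2 ≤ g) {u w : Circle} {i : ZMod (8 * g - 4)}
    (hu : ¬ CCW (D.P i) (D.Q (i + 1)) u) (hw : ¬ CCW (D.P i) (D.Q (i + 1)) w)
    (h : (u ≠ D.P i ∧ u ≠ D.Q (i + 1)) ∨ (w ≠ D.P i ∧ w ≠ D.Q (i + 1)) ∨ u = w) :
    (u, w) ∉ D.OmegaGeo := by
  intro hG
  obtain ⟨h1, h2⟩ := D.orient_eq_zero_of_mem_OmegaGeo hG (not_lt.1 hu) (not_lt.1 hw)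
  have hPQ := D.P_ne_Q hg i
  rw [orient_eq_zero_iff] at h1 h2
  rcases h with h | h | h
  · grind
  · grind
  · exact hG.1 h

/-- For the lifts this is the Binet–Cauchy identity combined with the expansion of `(p × q) × (p' ×
q')`, a vector that represents the intersection of the two lines. -/
theorem orient_wedge (p q p' q' u w : Circle) :
    orient p q u * orient p' q' w - orient p q w * orient p' q' u =
      orient p q q' * orient u w p' - orient p q p' * orient u w q' := by
  simp only [orient_eq]; ring

/-- A common point of the geodesic and the polygon gives two inequalities for one ratio of
coefficients. Eliminating it leaves a two by two determinant, which `orient_wedge` relates to the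
intersection `V m` of the sides. -/
theorem sideFn_V_nonneg_of_mem_OmegaGeo (hg : 2 ≤ g) {u w : Circle} {m : ZMod (8 * g - 4)}
    (hu : u ∈ arcCC (D.Q m) (D.Q (m + 1))) (hw : w ∈ arcCC (D.P (m - 1)) (D.P m))
    (h : (u, w) ∈ D.OmegaGeo) : 0 ≤ sideFn u w (D.V m) := by
  obtain ⟨f, hf, hc, -, hh⟩ := D.exists_chain hg m
  obtain ⟨hne, z, hz, hzF⟩ := h
  obtain ⟨α, β, hα, hβ, hcomb⟩ := geodesic_comb hne hz
  have z1 := hzF.2 (m - 1)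
  have z2 := hzF.2 m
  rw [hcomb] at z1 z2
  rw [sub_add_cancel] at z1
  simp only [mem_arcCC, hc, ← hf.eq_iff] at hu hw
  have l1w : ¬ 0 < orient (D.P (m - 1)) (D.Q m) w := by rw [← ccw_iff, hc]; grind
  have l1u : ¬ orient (D.P (m - 1)) (D.Q m) u < 0 := by rw [orient_neg_iff, hc]; grind
  have l2w : ¬ orient (D.P m) (D.Q (m + 1)) w < 0 := by rw [orient_neg_iff, hc]; grind
  have l2u : ¬ 0 < orient (D.P m) (D.Q (m + 1)) u := by rw [← ccw_iff, hc]; grind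
  have k1 : orient (D.P (m - 1)) (D.Q m) (D.P m) < 0 := by rw [orient_neg_iff, hc]; grind
  obtain ⟨γ, δ, hγ, hδ, hV⟩ := D.V_comb_right hg m
  have hV0 := hV (D.P (m - 1)) (D.Q m)
  rw [D.sideFn_V_left] at hV0
  have key := orient_wedge (D.P (m - 1)) (D.Q m) (D.P m) (D.Q (m + 1)) u w
  rw [hV]
  push Not at l1w l1u l2w l2u
  generalize orient (D.P (m - 1)) (D.Q m) w = a at *
  generalize orient (D.P (m - 1)) (D.Q m) u = b at *
  generalize orient (D.P m) (D.Q (m + 1)) w = c at *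
  generalize orient (D.P m) (D.Q (m + 1)) u = d at *
  have hpos : 0 ≤ b * c - a * d := by
    have h1 : β * (-a) ≤ α * b := by linarith
    have h2 : α * (-d) ≤ β * c := by linarith
    have h3 := mul_le_mul h1 h2 (mul_nonneg hα.le (by linarith)) (mul_nonneg hα.le l1u)
    have h4 : 0 ≤ (α * β) * (b * c - a * d) := by linarith
    exact nonneg_of_mul_nonneg_right h4 (mul_pos hα hβ)
  rw [key] at hpos
  -- `V m` lies on the extended side `m - 1`, which fixes the ratio of `γ` and `δ`; the determinant
  -- is thus a positive multiple of `sideFn u w (V m)`.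
  have e : δ * (orient (D.P (m - 1)) (D.Q m) (D.Q (m + 1)) * orient u w (D.P m) -
      orient (D.P (m - 1)) (D.Q m) (D.P m) * orient u w (D.Q (m + 1))) =
      (- orient (D.P (m - 1)) (D.Q m) (D.P m)) *
        (γ * orient u w (D.P m) + δ * orient u w (D.Q (m + 1))) := by
    linear_combination (-orient u w (D.P m)) * hV0
  have h5 := mul_nonneg hδ.le hpos
  rw [e] at h5
  exact nonneg_of_mul_nonneg_right h5 (by linarith)

/-- Throughout this rectangle `V (m + 3)` lies to the right of the geodesic, so the polygon is met
as soon as `V m` is not strictly to the right. -/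
theorem mem_OmegaGeo_low_iff (hg : 2 ≤ g) {u w : Circle} {m : ZMod (8 * g - 4)}
    (hu : u ∈ arcCC (D.Q m) (D.Q (m + 1))) (hw : w ∈ arcCC (D.P (m - 1)) (D.P m)) :
    (u, w) ∈ D.OmegaGeo ↔ 0 ≤ sideFn u w (D.V m) := by
  refine ⟨D.sideFn_V_nonneg_of_mem_OmegaGeo hg hu hw, fun h => ?_⟩
  obtain ⟨f, hf, hc, -, hh⟩ := D.exists_chain hg m
  simp only [mem_arcCC, hc, ← hf.eq_iff] at hu hw
  refine D.mem_OmegaGeo_of_signs hg (i := m + 3) ?_ ?_ h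
  · intro e; rw [e] at hu; grind
  · obtain ⟨γ, δ, hγ, hδ, hV⟩ := D.V_comb_left hg (m + 3)
    have h1 : orient u w (D.P (m + 2)) < 0 := by rw [orient_neg_iff, hc]; grind
    have h2 : orient u w (D.Q (m + 3)) < 0 := by rw [orient_neg_iff, hc]; grind
    rw [hV, show m + 3 - 1 = m + 2 by ring]
    nlinarith

theorem mem_OmegaGeo_up_iff (hg : 2 ≤ g) {u w : Circle} {m : ZMod (8 * g - 4)}
    (hu : u ∈ arcCC (D.P (m - 1)) (D.P m)) (hw : w ∈ arcCC (D.Q m) (D.Q (m + 1))) :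
    (u, w) ∈ D.OmegaGeo ↔ sideFn u w (D.V m) ≤ 0 := by
  rw [← OmegaGeo_swap, D.mem_OmegaGeo_low_iff hg hw hu, sideFn_swap, neg_nonneg]

/-! ### The arithmetic domain -/

variable {G : ZMod (8 * g - 4) → Circle}

theorem G_mem (hG : ∀ i, G i ∈ arcCC (D.P i) (D.P (i + 1))) {i j : ZMod (8 * g - 4)}
    (h : i + 1 = j) : G i ∈ arcCC (D.P i) (D.P j) := h ▸ hG i

theorem H_mem' (hg : 2 ≤ g) (hG : ∀ i, G i ∈ arcCC (D.P i) (D.P (i + 1))) {i j : ZMod (8 * g - 4)}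
    (h : i + 1 = j) : D.H G i ∈ arcCC (D.Q i) (D.Q j) := h ▸ D.H_mem hg hG i

theorem mem_OmegaArith {u w : Circle} : (u, w) ∈ D.OmegaArith G ↔ ∃ i,
    (u ∈ arcCC (D.H G (i + 1)) (G (i - 2)) ∧ w ∈ arcCC (D.P i) (D.Q i)) ∨
    (u ∈ arcCC (D.H G (i + 1)) (G (i - 1)) ∧ w ∈ arcCC (D.Q i) (D.P (i + 1))) := by
  simp only [OmegaArith, mem_iUnion, mem_union, mem_prod]

/-- The strips of index `m - 1` cover these `w`, and both of their first arcs start at `H m` and run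
past `Q (m + 1)`. `lower_of_mem_OmegaArith` is a converse for `w` in the open cell. -/
theorem mem_OmegaArith_low (hg : 2 ≤ g) (hG : ∀ i, G i ∈ arcCC (D.P i) (D.P (i + 1)))
    {u w : Circle} {m : ZMod (8 * g - 4)} (hu : u ∈ arcCC (D.H G m) (D.Q (m + 1)))
    (hw : w ∈ arcCC (D.P (m - 1)) (D.P m)) : (u, w) ∈ D.OmegaArith G := by
  rw [mem_OmegaArith]
  refine ⟨m - 1, ?_⟩
  have hH := D.H_mem hg hG m
  have hG1 := D.G_mem hG (i := m - 3) (j := m - 2) (by ring)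
  have hG2 := D.G_mem hG (i := m - 2) (j := m - 1) (by ring)
  rw [sub_add_cancel, show m - 1 - 2 = m - 3 by ring, show m - 1 - 1 = m - 2 by ring]
  obtain ⟨f, hf, hc, -, hh⟩ := D.exists_chain hg m
  simp only [mem_arcCC, hc, ← hf.eq_iff] at *
  grind

/-- Over `[Q m, Q (m + 1)]` strips of the two indices `m` and `m + 1` occur, but the first arcs of
both end at `G (m - 1)`. `upper_of_mem_OmegaArith` is a converse for `w` in the open cell. -/
theorem mem_OmegaArith_up (hg : 2 ≤ g) (hG : ∀ i, G i ∈ arcCC (D.P i) (D.P (i + 1)))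
    {u w : Circle} {m : ZMod (8 * g - 4)} (hu : u ∈ arcCC (D.P (m - 1)) (G (m - 1)))
    (hw : w ∈ arcCC (D.Q m) (D.Q (m + 1))) : (u, w) ∈ D.OmegaArith G := by
  rw [mem_OmegaArith]
  have hH1 := D.H_mem' hg hG (i := m + 1) (j := m + 2) (by ring)
  have hH2 := D.H_mem' hg hG (i := m + 2) (j := m + 3) (by ring)
  have hG1 := D.G_mem hG (i := m - 1) (j := m) (by ring)
  obtain ⟨f, hf, hc, -, hh⟩ := D.exists_chain hg m
  by_cases h : w ∈ arcCC (D.Q m) (D.P (m + 1))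
  · refine ⟨m, Or.inr ⟨?_, h⟩⟩
    clear h hw
    simp only [mem_arcCC, hc, ← hf.eq_iff] at *
    grind
  · refine ⟨m + 1, Or.inl ?_⟩
    rw [show m + 1 + 1 = m + 2 by ring, show m + 1 - 2 = m - 1 by ring]
    simp only [mem_arcCC, hc, ← hf.eq_iff] at *
    grind

theorem lower_of_mem_OmegaArith (hg : 2 ≤ g) (hG : ∀ i, G i ∈ arcCC (D.P i) (D.P (i + 1)))
    {u w : Circle} {m : ZMod (8 * g - 4)} (hw : CCW (D.P (m - 1)) w (D.P m))
    (h : (u, w) ∈ D.OmegaArith G) : u ∈ arcCC (D.H G m) (D.P (m - 1)) := by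
  rw [mem_OmegaArith] at h
  obtain ⟨i, h⟩ := h
  have hi : i = m - 1 := by
    refine D.index_eq_of_P hg (w := w) ?_ (by rwa [sub_add_cancel])
    obtain ⟨f, hf, hc, -, hh⟩ := D.exists_chain hg i
    clear hG hw
    simp only [mem_arcCC, hc, ← hf.eq_iff] at *
    grind
  subst hi
  have hH := D.H_mem hg hG m
  have hG1 := D.G_mem hG (i := m - 3) (j := m - 2) (by ring)
  have hG2 := D.G_mem hG (i := m - 2) (j := m - 1) (by ring)
  rw [sub_add_cancel, show m - 1 - 2 = m - 3 by ring, show m - 1 - 1 = m - 2 by ring] at h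
  obtain ⟨f, hf, hc, -, hh⟩ := D.exists_chain hg m
  simp only [mem_arcCC, hc, ← hf.eq_iff] at *
  grind

theorem upper_of_mem_OmegaArith (hg : 2 ≤ g) (hG : ∀ i, G i ∈ arcCC (D.P i) (D.P (i + 1)))
    {u w : Circle} {m : ZMod (8 * g - 4)} (hw : CCW (D.Q m) w (D.Q (m + 1)))
    (h : (u, w) ∈ D.OmegaArith G) : u ∈ arcCC (D.Q (m + 1)) (G (m - 1)) := by
  rw [mem_OmegaArith] at h
  obtain ⟨i, h⟩ := h
  have hH1 := D.H_mem' hg hG (i := m + 1) (j := m + 2) (by ring)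
  have hH2 := D.H_mem' hg hG (i := m + 2) (j := m + 3) (by ring)
  have hG1 := D.G_mem hG (i := m - 1) (j := m) (by ring)
  rcases h with ⟨h1, h2⟩ | ⟨h1, h2⟩
  · have hi : i - 1 = m := by
      refine D.index_eq_of_Q hg (w := w) ?_ hw
      obtain ⟨f, hf, hc, -, hh⟩ := D.exists_chain hg i
      rw [sub_add_cancel]
      simp only [mem_arcCC, hc, ← hf.eq_iff] at h2 ⊢
      grind
    obtain rfl : i = m + 1 := by rw [← hi]; ring
    rw [show m + 1 + 1 = m + 2 by ring, show m + 1 - 2 = m - 1 by ring] at h1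
    obtain ⟨f, hf, hc, -, hh⟩ := D.exists_chain hg m
    simp only [mem_arcCC, hc, ← hf.eq_iff] at h1 hH1 hH2 hG1 ⊢
    grind
  · obtain rfl : i = m := by
      refine D.index_eq_of_Q hg (w := w) ?_ hw
      obtain ⟨f, hf, hc, -, hh⟩ := D.exists_chain hg i
      simp only [mem_arcCC, hc, ← hf.eq_iff] at h2 ⊢
      grind
    obtain ⟨f, hf, hc, -, hh⟩ := D.exists_chain hg i
    simp only [mem_arcCC, hc, ← hf.eq_iff] at h1 hH1 hH2 hG1 ⊢
    grind

end SurfacePolygon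

namespace SurfacePolygon

variable {g : ℕ} (D : SurfacePolygon g) {G : ZMod (8 * g - 4) → Circle}

/-! ### The bulges -/

/-- In the strip of `w`, leaving the arithmetic domain puts `u` in the arc around `w` from `G` to
`H`. There a geodesic with both ends behind side `i` or `i - 1` misses the polygon, unless it
extends that side; the remaining possibilities lie in rectangles at the vertices. -/
theorem mem_rect_of_not_mem_OmegaArith (hg : 2 ≤ g) (hG : ∀ i, G i ∈ arcCC (D.P i) (D.P (i + 1)))
    {u w : Circle} (h : (u, w) ∈ D.OmegaGeo) (h' : (u, w) ∉ D.OmegaArith G) : ∃ m,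
    (u ∈ arcCC (D.Q m) (D.Q (m + 1)) ∧ w ∈ arcCC (D.P (m - 1)) (D.P m)) ∨
    (u ∈ arcCC (D.P (m - 1)) (D.P m) ∧ w ∈ arcCC (D.Q m) (D.Q (m + 1))) := by
  obtain ⟨i, hw⟩ := D.exists_cell_PQ hg w
  rw [mem_OmegaArith] at h'
  push Not at h'
  have hi := h' i
  clear h'
  have hH := D.H_mem' hg hG (i := i + 1) (j := i + 2) (by ring)
  have hG1 := D.G_mem hG (i := i - 2) (j := i - 1) (by ring)
  have hG2 := D.G_mem hG (i := i - 1) (j := i) (by ring)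
  have n1 : CCW (D.P i) (D.Q (i + 1)) u ∨ CCW (D.P i) (D.Q (i + 1)) w ∨
      ¬ ((u ≠ D.P i ∧ u ≠ D.Q (i + 1)) ∨ (w ≠ D.P i ∧ w ≠ D.Q (i + 1)) ∨ u = w) := by
    by_contra hcon
    push Not at hcon
    exact D.not_mem_OmegaGeo hg hcon.1 hcon.2.1 (by grind) h
  have n2 : CCW (D.P (i - 1)) (D.Q i) u ∨ CCW (D.P (i - 1)) (D.Q i) w ∨
      ¬ ((u ≠ D.P (i - 1) ∧ u ≠ D.Q i) ∨ (w ≠ D.P (i - 1) ∧ w ≠ D.Q i) ∨ u = w) := by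
    by_contra hcon
    push Not at hcon
    refine D.not_mem_OmegaGeo hg (i := i - 1) ?_ ?_ ?_ h
    · rw [sub_add_cancel]; exact hcon.1
    · rw [sub_add_cancel]; exact hcon.2.1
    · rw [sub_add_cancel]; grind
  clear h
  have a1 : ∀ h : u ∈ arcCC (D.Q (i + 1)) (D.Q (i + 2)) ∧ w ∈ arcCC (D.P i) (D.P (i + 1)), ∃ m,
    (u ∈ arcCC (D.Q m) (D.Q (m + 1)) ∧ w ∈ arcCC (D.P (m - 1)) (D.P m)) ∨
    (u ∈ arcCC (D.P (m - 1)) (D.P m) ∧ w ∈ arcCC (D.Q m) (D.Q (m + 1))) := fun h => by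
    refine ⟨i + 1, Or.inl ?_⟩
    rwa [show i + 1 + 1 = i + 2 by ring, add_sub_cancel_right]
  have a2 : ∀ h : u ∈ arcCC (D.P (i - 1)) (D.P i) ∧ w ∈ arcCC (D.Q i) (D.Q (i + 1)), ∃ m,
    (u ∈ arcCC (D.Q m) (D.Q (m + 1)) ∧ w ∈ arcCC (D.P (m - 1)) (D.P m)) ∨
    (u ∈ arcCC (D.P (m - 1)) (D.P m) ∧ w ∈ arcCC (D.Q m) (D.Q (m + 1))) := fun h =>
    ⟨i, Or.inr h⟩
  have a3 : ∀ h : u ∈ arcCC (D.P (i - 2)) (D.P (i - 1)) ∧ w ∈ arcCC (D.Q (i - 1)) (D.Q i), ∃ m,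
    (u ∈ arcCC (D.Q m) (D.Q (m + 1)) ∧ w ∈ arcCC (D.P (m - 1)) (D.P m)) ∨
    (u ∈ arcCC (D.P (m - 1)) (D.P m) ∧ w ∈ arcCC (D.Q m) (D.Q (m + 1))) := fun h => by
    refine ⟨i - 1, Or.inr ?_⟩
    rwa [show i - 1 - 1 = i - 2 by ring, sub_add_cancel]
  by_contra hcon
  have b1 := fun h => hcon (a1 h)
  have b2 := fun h => hcon (a2 h)
  have b3 := fun h => hcon (a3 h)
  clear a1 a2 a3 hcon hG
  obtain ⟨f, hf, hc, -, hh⟩ := D.exists_chain hg i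
  simp only [mem_arcCC, hc, ← hf.eq_iff, Ne] at *
  clear hc
  have k1 : f u < f (D.P i) ∨ f (D.Q (i + 1)) ≤ f u := by
    clear b1 b2 b3 hi n2 hG1 hG2 hH
    rcases hw with hw | hw <;> grind
  rcases hw with hw | hw
  · have k2 : f u ≤ f (D.P (i - 1)) ∨ f (D.P i) ≤ f u := by
      clear b1 b2 b3 hi n1 hG1 hG2 hH
      grind
    clear n1 n2
    have hi := hi.1
    have w1 : f (D.P i) ≤ f w := by clear b1 b2 b3 hi; grind
    have w2 : f w ≤ f (D.Q i) := by clear b1 b2 b3 hi; grind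
    have k3 : f u < f (D.P (i - 2)) ∨ f (D.P (i - 1)) < f u := by clear hi b1 b2; grind
    have k4 : f u < f (D.Q (i + 1)) ∨ f (D.Q (i + 2)) < f u := by clear hi b2 b3; grind
    clear b1 b2 b3
    grind
  · clear n1 n2
    have hi := hi.2
    have w1 : f (D.Q i) ≤ f w := by clear b1 b2 b3 hi; grind
    have w2 : f w ≤ f (D.P (i + 1)) := by clear b1 b2 b3 hi; grind
    have k3 : f u < f (D.P (i - 1)) ∨ f (D.P i) < f u := by clear hi b1 b3; grind
    have k4 : f u < f (D.Q (i + 1)) ∨ f (D.Q (i + 2)) < f u := by clear hi b2 b3; grind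
    clear b1 b2 b3
    grind

/-- Outside the rectangles `u` is so far from `w` that `V (i + 1)` is not strictly to the right and
`V (i - 1)` or `V i` not strictly to the left, so the polygon is met. -/
theorem mem_rect_of_not_mem_OmegaGeo (hg : 2 ≤ g) (hG : ∀ i, G i ∈ arcCC (D.P i) (D.P (i + 1)))
    {u w : Circle} (h : (u, w) ∈ D.OmegaArith G) (h' : (u, w) ∉ D.OmegaGeo) : ∃ m,
    (u ∈ arcCC (D.H G m) (D.Q (m + 1)) ∧ w ∈ arcCC (D.P (m - 1)) (D.P m)) ∨
    (u ∈ arcCC (D.P (m - 1)) (G (m - 1)) ∧ w ∈ arcCC (D.Q m) (D.Q (m + 1))) := by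
  rw [mem_OmegaArith] at h
  obtain ⟨i, h⟩ := h
  have hH := D.H_mem' hg hG (i := i + 1) (j := i + 2) (by ring)
  have hG1 := D.G_mem hG (i := i - 2) (j := i - 1) (by ring)
  have hG2 := D.G_mem hG (i := i - 1) (j := i) (by ring)
  have a1 : ∀ h : u ∈ arcCC (D.H G (i + 1)) (D.Q (i + 2)) ∧ w ∈ arcCC (D.P i) (D.P (i + 1)), ∃ m,
    (u ∈ arcCC (D.H G m) (D.Q (m + 1)) ∧ w ∈ arcCC (D.P (m - 1)) (D.P m)) ∨
    (u ∈ arcCC (D.P (m - 1)) (G (m - 1)) ∧ w ∈ arcCC (D.Q m) (D.Q (m + 1))) := fun h => by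
    refine ⟨i + 1, Or.inl ?_⟩
    rwa [show i + 1 + 1 = i + 2 by ring, add_sub_cancel_right]
  have a3 : ∀ h : u ∈ arcCC (D.P (i - 2)) (G (i - 2)) ∧ w ∈ arcCC (D.Q (i - 1)) (D.Q i), ∃ m,
    (u ∈ arcCC (D.H G m) (D.Q (m + 1)) ∧ w ∈ arcCC (D.P (m - 1)) (D.P m)) ∨
    (u ∈ arcCC (D.P (m - 1)) (G (m - 1)) ∧ w ∈ arcCC (D.Q m) (D.Q (m + 1))) := fun h => by
    refine ⟨i - 1, Or.inr ?_⟩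
    rwa [show i - 1 - 1 = i - 2 by ring, sub_add_cancel]
  have a2 : ∀ h : u ∈ arcCC (D.P (i - 1)) (G (i - 1)) ∧ w ∈ arcCC (D.Q i) (D.Q (i + 1)), ∃ m,
    (u ∈ arcCC (D.H G m) (D.Q (m + 1)) ∧ w ∈ arcCC (D.P (m - 1)) (D.P m)) ∨
    (u ∈ arcCC (D.P (m - 1)) (G (m - 1)) ∧ w ∈ arcCC (D.Q m) (D.Q (m + 1))) := fun h =>
    ⟨i, Or.inr h⟩
  by_contra hcon
  have b1 := fun h => hcon (a1 h)
  have b2 := fun h => hcon (a2 h)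
  have b3 := fun h => hcon (a3 h)
  clear a1 a2 a3 hcon hG
  have c1 : (u ∈ arcCC (D.Q (i + 2)) (D.P (i - 2)) ∧ w ∈ arcCC (D.P i) (D.Q i)) ∨
      (u ∈ arcCC (D.Q (i + 2)) (D.P (i - 1)) ∧ w ∈ arcCC (D.Q i) (D.P (i + 1))) := by
    obtain ⟨f, hf, hc, -, hh⟩ := D.exists_chain hg i
    simp only [mem_arcCC, hc, ← hf.eq_iff] at *
    rcases h with h | h <;> grind
  clear b1 b2 b3 h
  obtain ⟨f, hf, hc, -, hh⟩ := D.exists_chain hg i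
  have hne : u ≠ w := by
    simp only [mem_arcCC, hc, ← hf.eq_iff, Ne] at c1 ⊢
    rcases c1 with h | h <;> grind
  obtain ⟨γ, δ, hγ, hδ, hV⟩ := D.V_comb_right hg (i + 1)
  rw [show i + 1 + 1 = i + 2 by ring] at hV
  have s1 : 0 ≤ sideFn u w (D.V (i + 1)) := by
    rw [hV]
    have h1 : ¬ orient u w (D.P (i + 1)) < 0 := by
      rw [orient_neg_iff, hc]
      simp only [mem_arcCC, hc, ← hf.eq_iff] at c1
      rcases c1 with h | h <;> grind
    have h2 : ¬ orient u w (D.Q (i + 2)) < 0 := by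
      rw [orient_neg_iff, hc]
      simp only [mem_arcCC, hc, ← hf.eq_iff] at c1
      rcases c1 with h | h <;> grind
    push Not at h1 h2
    positivity
  have s2 : ∃ k, sideFn u w (D.V k) ≤ 0 := by
    rcases c1 with c | c
    · refine ⟨i - 1, ?_⟩
      obtain ⟨γ, δ, hγ, hδ, hV⟩ := D.V_comb_left hg (i - 1)
      rw [hV, show i - 1 - 1 = i - 2 by ring]
      have h1 : ¬ 0 < orient u w (D.P (i - 2)) := by
        rw [← ccw_iff, hc]
        simp only [mem_arcCC, hc, ← hf.eq_iff] at c
        grind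
      have h2 : ¬ 0 < orient u w (D.Q (i - 1)) := by
        rw [← ccw_iff, hc]
        simp only [mem_arcCC, hc, ← hf.eq_iff] at c
        grind
      push Not at h1 h2
      nlinarith
    · refine ⟨i, ?_⟩
      obtain ⟨γ, δ, hγ, hδ, hV⟩ := D.V_comb_left hg i
      rw [hV]
      have h1 : ¬ 0 < orient u w (D.P (i - 1)) := by
        rw [← ccw_iff, hc]
        simp only [mem_arcCC, hc, ← hf.eq_iff] at c
        grind
      have h2 : ¬ 0 < orient u w (D.Q i) := by
        rw [← ccw_iff, hc]
        simp only [mem_arcCC, hc, ← hf.eq_iff] at c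
        grind
      push Not at h1 h2
      nlinarith
  obtain ⟨k, hk⟩ := s2
  exact h' (D.mem_OmegaGeo_of_signs hg hne hk s1)

/-- Boundary values drop out: they belong to an arithmetic strip or violate the inequality at `V m`.
The strict position of `w` makes the index of the bulge unique. -/
theorem bulge_low (hg : 2 ≤ g) (hG : ∀ i, G i ∈ arcCC (D.P i) (D.P (i + 1)))
    {u w : Circle} {m : ZMod (8 * g - 4)} (h : (u, w) ∈ D.OmegaGeo) (h' : (u, w) ∉ D.OmegaArith G)
    (hu : u ∈ arcCC (D.Q m) (D.Q (m + 1))) (hw : w ∈ arcCC (D.P (m - 1)) (D.P m)) :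
    CCW (D.Q m) u (D.H G m) ∧ CCW (D.P (m - 1)) w (D.P m) ∧ 0 ≤ sideFn u w (D.V m) := by
  have h0 := D.sideFn_V_nonneg_of_mem_OmegaGeo hg hu hw h
  have hH := D.H_mem hg hG m
  have hH1 := D.H_mem' hg hG (i := m - 1) (j := m) (by ring)
  have hG1 := D.G_mem hG (i := m - 3) (j := m - 2) (by ring)
  have n1 : w ≠ D.P (m - 1) := by
    intro e
    apply h'
    rw [mem_OmegaArith]
    refine ⟨m - 2, Or.inr ?_⟩
    rw [show m - 2 + 1 = m - 1 by ring, show m - 2 - 1 = m - 3 by ring, e]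
    refine ⟨?_, Or.inr (Or.inl rfl)⟩
    obtain ⟨f, hf, hc, -, hh⟩ := D.exists_chain hg m
    clear h h' hw hG
    simp only [mem_arcCC, hc, ← hf.eq_iff] at *
    grind
  have n2 : ¬ u ∈ arcCC (D.H G m) (D.Q (m + 1)) := fun hu' =>
    h' (D.mem_OmegaArith_low hg hG hu' hw)
  have n3 : w = D.P m → u = D.Q (m + 1) := by
    rintro rfl
    obtain ⟨γ, δ, hγ, hδ, hV⟩ := D.V_comb_right hg m
    rw [hV] at h0
    have e : orient u (D.P m) (D.P m) = 0 := by rw [orient_eq_zero_iff]; simp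
    rw [e, mul_zero, zero_add] at h0
    by_contra hne
    have : orient u (D.P m) (D.Q (m + 1)) < 0 := by
      rw [orient_neg_iff]
      obtain ⟨f, hf, hc, -, hh⟩ := D.exists_chain hg m
      clear h h' hw hG n1 n2
      simp only [mem_arcCC, hc, ← hf.eq_iff] at *
      grind
    nlinarith
  have n4 : u ≠ D.Q m := by
    rintro rfl
    obtain ⟨γ, δ, hγ, hδ, hV⟩ := D.V_comb_left hg m
    rw [hV] at h0
    have e : orient (D.Q m) w (D.Q m) = 0 := by rw [orient_eq_zero_iff]; simp
    rw [e, mul_zero, add_zero] at h0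
    have : orient (D.Q m) w (D.P (m - 1)) < 0 := by
      rw [orient_neg_iff]
      obtain ⟨f, hf, hc, -, hh⟩ := D.exists_chain hg m
      clear h h' hG n2 n3
      simp only [mem_arcCC, hc, ← hf.eq_iff] at *
      grind
    nlinarith
  clear h h' hG
  rw [← and_assoc]
  refine ⟨?_, h0⟩
  obtain ⟨f, hf, hc, -, hh⟩ := D.exists_chain hg m
  simp only [mem_arcCC, hc, ← hf.eq_iff, Ne] at *
  grind

theorem bulge_up (hg : 2 ≤ g) (hG : ∀ i, G i ∈ arcCC (D.P i) (D.P (i + 1)))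
    {u w : Circle} {m : ZMod (8 * g - 4)} (h : (u, w) ∈ D.OmegaGeo) (h' : (u, w) ∉ D.OmegaArith G)
    (hu : u ∈ arcCC (D.P (m - 1)) (D.P m)) (hw : w ∈ arcCC (D.Q m) (D.Q (m + 1))) :
    CCW (G (m - 1)) u (D.P m) ∧ CCW (D.Q m) w (D.Q (m + 1)) ∧ sideFn u w (D.V m) ≤ 0 := by
  have h0 := (D.mem_OmegaGeo_up_iff hg hu hw).1 h
  have hH2 := D.H_mem' hg hG (i := m + 2) (j := m + 3) (by ring)
  have hG1 := D.G_mem hG (i := m - 1) (j := m) (by ring)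
  have n1 : w ≠ D.Q (m + 1) := by
    intro e
    apply h'
    rw [mem_OmegaArith]
    refine ⟨m + 1, Or.inr ?_⟩
    rw [show m + 1 + 1 = m + 2 by ring, show m + 1 - 1 = m by ring, e]
    refine ⟨?_, Or.inl rfl⟩
    have hG2 := D.G_mem hG (i := m) (j := m + 1) (by ring)
    obtain ⟨f, hf, hc, -, hh⟩ := D.exists_chain hg m
    clear h h' hw hG
    simp only [mem_arcCC, hc, ← hf.eq_iff] at *
    grind
  have n2 : ¬ u ∈ arcCC (D.P (m - 1)) (G (m - 1)) := fun hu' =>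
    h' (D.mem_OmegaArith_up hg hG hu' hw)
  have n3 : w = D.Q m → u = D.P (m - 1) := by
    rintro rfl
    obtain ⟨γ, δ, hγ, hδ, hV⟩ := D.V_comb_left hg m
    rw [hV] at h0
    have e : orient u (D.Q m) (D.Q m) = 0 := by rw [orient_eq_zero_iff]; simp
    rw [e, mul_zero, add_zero] at h0
    by_contra hne
    have : 0 < orient u (D.Q m) (D.P (m - 1)) := by
      rw [← ccw_iff]
      obtain ⟨f, hf, hc, -, hh⟩ := D.exists_chain hg m
      clear h h' hw hG n1 n2
      simp only [mem_arcCC, hc, ← hf.eq_iff] at *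
      grind
    nlinarith
  have n4 : u ≠ D.P m := by
    rintro rfl
    obtain ⟨γ, δ, hγ, hδ, hV⟩ := D.V_comb_right hg m
    rw [hV] at h0
    have e : orient (D.P m) w (D.P m) = 0 := by rw [orient_eq_zero_iff]; simp
    rw [e, mul_zero, zero_add] at h0
    have : 0 < orient (D.P m) w (D.Q (m + 1)) := by
      rw [← ccw_iff]
      obtain ⟨f, hf, hc, -, hh⟩ := D.exists_chain hg m
      clear h h' hG n2 n3
      simp only [mem_arcCC, hc, ← hf.eq_iff] at *
      grind
    nlinarith
  clear h h' hG
  rw [← and_assoc]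
  refine ⟨?_, h0⟩
  obtain ⟨f, hf, hc, -, hh⟩ := D.exists_chain hg m
  simp only [mem_arcCC, hc, ← hf.eq_iff, Ne] at *
  grind

/-- The position of `w` forces `n` to be `m + 1` or `m + 2`, and then the two arcs for `u` are
disjoint. Hence lower and upper bulges do not compete in `Phi`. -/
theorem low_up_disjoint (hg : 2 ≤ g) {u w : Circle} {m n : ZMod (8 * g - 4)}
    (hu : u ∈ arcCC (D.P (m - 1)) (D.P m)) (hw : CCW (D.Q m) w (D.Q (m + 1)))
    (hu' : u ∈ arcCC (D.Q n) (D.Q (n + 1))) (hw' : CCW (D.P (n - 1)) w (D.P n)) : False := by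
  have key : w ∈ arcCC (D.P m) (D.P (m + 1)) ∨ w ∈ arcCC (D.P (m + 1)) (D.P (m + 1 + 1)) := by
    rw [show m + 1 + 1 = m + 2 by ring]
    obtain ⟨f, hf, hc, -, hh⟩ := D.exists_chain hg m
    clear hu' hw'
    simp only [mem_arcCC, hc, ← hf.eq_iff] at *
    grind
  have hn : n = m + 1 ∨ n = m + 1 + 1 := by
    rw [← sub_eq_iff_eq_add, ← sub_eq_iff_eq_add (c := m + 1)]
    have h : CCW (D.P (n - 1)) w (D.P (n - 1 + 1)) := by rwa [sub_add_cancel]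
    exact key.imp (fun k => (D.index_eq_of_P hg k h).symm) fun k => (D.index_eq_of_P hg k h).symm
  obtain ⟨f, hf, hc, -, hh⟩ := D.exists_chain hg m
  rcases hn with rfl | rfl
  · rw [show m + 1 + 1 = m + 2 by ring] at hu'
    clear key hw hw'
    simp only [mem_arcCC, hc, ← hf.eq_iff] at *
    grind
  · rw [show m + 1 + 1 + 1 = m + 3 by ring, show m + 1 + 1 = m + 2 by ring] at hu'
    clear key hw hw'
    simp only [mem_arcCC, hc, ← hf.eq_iff] at *
    grind

/-! ### The values of `Φ` -/

theorem Phi_of_mem {p : Circle × Circle} (h : p ∈ D.OmegaGeo) (h' : p ∈ D.OmegaArith G) :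
    D.Phi G p = p := if_pos ⟨h, h'⟩

theorem Phi_low (hg : 2 ≤ g) (hG : ∀ i, G i ∈ arcCC (D.P i) (D.P (i + 1)))
    {u w : Circle} {m : ZMod (8 * g - 4)} (h : (u, w) ∈ D.OmegaGeo) (h' : (u, w) ∉ D.OmegaArith G)
    (hu : u ∈ arcCC (D.Q m) (D.Q (m + 1))) (hw : w ∈ arcCC (D.P (m - 1)) (D.P m)) :
    D.Phi G (u, w) = onPair (D.U (tauIdx g m)) (u, w) := by
  have hex : ∃ i, (u, w) ∈ D.lowerBulge G i := by
    -- The lower bulge of index `i` sits at the vertex `V (i + 1)`, hence the shift.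
    refine ⟨m - 1, ⟨h, h'⟩, ?_⟩
    rw [mem_prod, sub_add_cancel, show m - 1 + 2 = m + 1 by ring]
    exact ⟨hu, hw⟩
  rw [Phi, if_neg (fun hh => h' hh.2), dif_pos hex]
  have h2 := (hex.choose_spec.2).2
  have := D.index_eq_of_P hg h2
    (show CCW (D.P (m - 1)) w (D.P (m - 1 + 1)) by
      rw [sub_add_cancel]; exact (D.bulge_low hg hG h h' hu hw).2.1)
  rw [this, tau_sub_one, sub_add_cancel]

theorem Phi_up (hg : 2 ≤ g) (hG : ∀ i, G i ∈ arcCC (D.P i) (D.P (i + 1)))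
    {u w : Circle} {m : ZMod (8 * g - 4)} (h : (u, w) ∈ D.OmegaGeo) (h' : (u, w) ∉ D.OmegaArith G)
    (hu : u ∈ arcCC (D.P (m - 1)) (D.P m)) (hw : w ∈ arcCC (D.Q m) (D.Q (m + 1))) :
    D.Phi G (u, w) = onPair (D.U (tauIdx g m)) (u, w) := by
  obtain ⟨b1, b2, b3⟩ := D.bulge_up hg hG h h' hu hw
  -- `Phi` tests the lower bulges first, so these must be excluded.
  have hnex : ¬ ∃ i, (u, w) ∈ D.lowerBulge G i := by
    rintro ⟨i, -, h1, h2⟩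
    simp only at h1 h2
    obtain ⟨-, c2, -⟩ := D.bulge_low hg hG (m := i + 1) h h'
      (by rwa [show i + 1 + 1 = i + 2 by ring]) (by rwa [add_sub_cancel_right])
    rw [add_sub_cancel_right] at c2
    refine D.low_up_disjoint hg hu b2 (n := i + 1) ?_ ?_
    · rwa [show i + 1 + 1 = i + 2 by ring]
    · rwa [add_sub_cancel_right]
  have hex : ∃ i, (u, w) ∈ D.upperBulge G i := ⟨m, ⟨h, h'⟩, hu, hw⟩
  rw [Phi, if_neg (fun hh => h' hh.2), dif_neg hnex, dif_pos hex]
  have h2 := (hex.choose_spec.2).2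
  rw [D.index_eq_of_Q hg h2 b2]

end SurfacePolygon

/-! ### Openness and one-sided perturbation of pairs. -/

theorem isOpen_ccw (a b : Circle) : IsOpen {x | CCW a x b} := by
  unfold CCW
  refine isOpen_lt continuous_const ?_
  exact Complex.continuous_im.comp (by fun_prop)

theorem continuous_sideFn_pair (z : ℂ) :
    Continuous fun p : Circle × Circle => sideFn p.1 p.2 z := by
  unfold sideFn
  exact Complex.continuous_im.comp (by fun_prop)

theorem exists_snd_mem_interior {S : Set (Circle × Circle)} {u w : Circle}
    (h : (u, w) ∈ interior S) {C : Set Circle} (hC : w ∈ closure C) :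
    ∃ x ∈ C, (u, x) ∈ interior S := by
  have ho : IsOpen {x | (u, x) ∈ interior S} := isOpen_interior.preimage (by fun_prop)
  obtain ⟨x, h1, h2⟩ := mem_closure_iff.1 hC _ ho h
  exact ⟨x, h2, h1⟩

theorem exists_fst_mem_interior {S : Set (Circle × Circle)} {u w : Circle}
    (h : (u, w) ∈ interior S) {C : Set Circle} (hC : u ∈ closure C) :
    ∃ x ∈ C, (x, w) ∈ interior S := by
  have ho : IsOpen {x | (x, w) ∈ interior S} := isOpen_interior.preimage (by fun_prop)
  obtain ⟨x, h1, h2⟩ := mem_closure_iff.1 hC _ ho h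
  exact ⟨x, h2, h1⟩

namespace SurfacePolygon

variable {g : ℕ} (D : SurfacePolygon g) {G : ZMod (8 * g - 4) → Circle}

/-! ### The action of `U` on the bulges -/

variable (G) in
/-- The interior of the part of the geometric domain outside the arithmetic one, at the lower side of
`V m`. -/
def geoLow (m : ZMod (8 * g - 4)) : Set (Circle × Circle) :=
  {p | CCW (D.Q m) p.1 (D.H G m) ∧ CCW (D.P (m - 1)) p.2 (D.P m) ∧ 0 < sideFn p.1 p.2 (D.V m)}

variable (G) in
/-- The interior of the part of the geometric domain outside the arithmetic one, at the upper side of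
`V m`. -/
def geoUp (m : ZMod (8 * g - 4)) : Set (Circle × Circle) :=
  {p | CCW (G (m - 1)) p.1 (D.P m) ∧ CCW (D.Q m) p.2 (D.Q (m + 1)) ∧ sideFn p.1 p.2 (D.V m) < 0}

variable (G) in
/-- The interior of the part of the arithmetic domain outside the geometric one, at the lower side of
`V m`. -/
def arithLow (m : ZMod (8 * g - 4)) : Set (Circle × Circle) :=
  {p | CCW (D.H G m) p.1 (D.Q (m + 1)) ∧ CCW (D.P (m - 1)) p.2 (D.P m) ∧
    sideFn p.1 p.2 (D.V m) < 0}

variable (G) in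
/-- The interior of the part of the arithmetic domain outside the geometric one, at the upper side of
`V m`. -/
def arithUp (m : ZMod (8 * g - 4)) : Set (Circle × Circle) :=
  {p | CCW (D.P (m - 1)) p.1 (G (m - 1)) ∧ CCW (D.Q m) p.2 (D.Q (m + 1)) ∧
    0 < sideFn p.1 p.2 (D.V m)}

theorem U_tau_P_pred (hg : 2 ≤ g) (m : ZMod (8 * g - 4)) :
    onCircle (D.U (tauIdx g m)) (D.P (m - 1)) = D.Q (tauIdx g m) := by
  have := D.U_P_tau_pred hg (tauIdx g m)
  rwa [tau_tau hg] at this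

theorem U_tau_P (hg : 2 ≤ g) (m : ZMod (8 * g - 4)) :
    onCircle (D.U (tauIdx g m)) (D.P m) = D.Q (tauIdx g m + 1) := by
  have := D.U_P_tau hg (tauIdx g m)
  rwa [tau_tau hg] at this

theorem U_tau_Q (hg : 2 ≤ g) (m : ZMod (8 * g - 4)) :
    onCircle (D.U (tauIdx g m)) (D.Q m) = D.P (tauIdx g m - 1) := by
  have := D.U_Q_tau hg (tauIdx g m)
  rwa [tau_tau hg] at this

theorem U_tau_Q_succ (hg : 2 ≤ g) (m : ZMod (8 * g - 4)) :
    onCircle (D.U (tauIdx g m)) (D.Q (m + 1)) = D.P (tauIdx g m) := by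
  have := D.U_Q_tau_succ hg (tauIdx g m)
  rwa [tau_tau hg] at this

theorem U_tau_V (hg : 2 ≤ g) (m : ZMod (8 * g - 4)) :
    mob (D.U (tauIdx g m)) (D.V m) = D.V (tauIdx g m) := by
  have := D.U_V hg (tauIdx g m)
  rwa [tau_tau hg] at this

theorem U_tau_G (hg : 2 ≤ g) (m : ZMod (8 * g - 4)) :
    onCircle (D.U (tauIdx g m)) (G (m - 1)) = D.H G (tauIdx g m) := by
  rw [H, tau_tau hg]

/-- All data bounding the region at `V m` are mapped to the data bounding the region at `V (τ m)`,
so the correspondence is exact. -/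
theorem onPair_U_mem_arithUp (hg : 2 ≤ g) {p : Circle × Circle} {m : ZMod (8 * g - 4)} :
    onPair (D.U (tauIdx g m)) p ∈ D.arithUp G (tauIdx g m) ↔ p ∈ D.geoLow G m := by
  simp only [arithUp, geoLow, mem_ofPred_eq, onPair]
  rw [← D.U_tau_Q hg, ← D.U_tau_P_pred hg, ← D.U_tau_P hg, ← D.U_tau_V hg, ← D.U_tau_H hg (G := G),
    SU11.ccw_iff (D.U (tauIdx g m)), SU11.ccw_iff (D.U (tauIdx g m)), SU11.sideFn_mob_pos _ (D.norm_V_lt m)]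

theorem onPair_U_mem_arithLow (hg : 2 ≤ g) {p : Circle × Circle} {m : ZMod (8 * g - 4)} :
    onPair (D.U (tauIdx g m)) p ∈ D.arithLow G (tauIdx g m) ↔ p ∈ D.geoUp G m := by
  simp only [arithLow, geoUp, mem_ofPred_eq, onPair]
  rw [← D.U_tau_Q hg, ← D.U_tau_Q_succ hg, ← D.U_tau_P hg, ← D.U_tau_V hg, ← D.U_tau_G hg,
    SU11.ccw_iff (D.U (tauIdx g m)), SU11.ccw_iff (D.U (tauIdx g m)), SU11.sideFn_mob_neg _ (D.norm_V_lt m)]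

theorem onPair_U_U_tau (hg : 2 ≤ g) (m : ZMod (8 * g - 4)) (p : Circle × Circle) :
    onPair (D.U m) (onPair (D.U (tauIdx g m)) p) = p := by
  simp only [onPair, D.U_U_tau hg]

theorem onPair_U_mem_geoUp (hg : 2 ≤ g) {p : Circle × Circle} {m : ZMod (8 * g - 4)} :
    onPair (D.U (tauIdx g m)) p ∈ D.geoUp G (tauIdx g m) ↔ p ∈ D.arithLow G m := by
  rw [← D.onPair_U_mem_arithLow hg, tau_tau hg, D.onPair_U_U_tau hg]

theorem onPair_U_mem_geoLow (hg : 2 ≤ g) {p : Circle × Circle} {m : ZMod (8 * g - 4)} :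
    onPair (D.U (tauIdx g m)) p ∈ D.geoLow G (tauIdx g m) ↔ p ∈ D.arithUp G m := by
  rw [← D.onPair_U_mem_arithUp hg, tau_tau hg, D.onPair_U_U_tau hg]

theorem mapsTo_Phi (hg : 2 ≤ g) (hG : ∀ i, G i ∈ arcCC (D.P i) (D.P (i + 1))) :
    Set.MapsTo (D.Phi G) D.OmegaGeo (D.OmegaArith G) := by
  rintro ⟨u, w⟩ h
  by_cases h' : (u, w) ∈ D.OmegaArith G
  · rwa [D.Phi_of_mem h h']
  obtain ⟨m, ⟨hu, hw⟩ | ⟨hu, hw⟩⟩ := D.mem_rect_of_not_mem_OmegaArith hg hG h h'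
  · rw [D.Phi_low hg hG h h' hu hw]
    obtain ⟨b1, b2, -⟩ := D.bulge_low hg hG h h' hu hw
    refine D.mem_OmegaArith_up hg hG (m := tauIdx g m) ?_ ?_
    · rw [← D.U_tau_Q hg, ← D.U_tau_H hg (G := G), SU11.arcCC_iff]
      exact Or.inr (Or.inr b1)
    · rwa [← D.U_tau_P_pred hg, ← D.U_tau_P hg, SU11.arcCC_iff]
  · rw [D.Phi_up hg hG h h' hu hw]
    obtain ⟨b1, b2, -⟩ := D.bulge_up hg hG h h' hu hw
    refine D.mem_OmegaArith_low hg hG (m := tauIdx g m) ?_ ?_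
    · rw [← D.U_tau_P hg, ← D.U_tau_G hg, SU11.arcCC_iff]
      exact Or.inr (Or.inr b1)
    · rwa [← D.U_tau_Q hg, ← D.U_tau_Q_succ hg, SU11.arcCC_iff]

/-! ### Interiors -/

theorem isOpen_geoLow (m : ZMod (8 * g - 4)) : IsOpen (D.geoLow G m) :=
  ((isOpen_ccw _ _).preimage continuous_fst).inter
    (((isOpen_ccw _ _).preimage continuous_snd).inter
      (isOpen_lt continuous_const (continuous_sideFn_pair _)))

theorem isOpen_geoUp (m : ZMod (8 * g - 4)) : IsOpen (D.geoUp G m) :=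
  ((isOpen_ccw _ _).preimage continuous_fst).inter
    (((isOpen_ccw _ _).preimage continuous_snd).inter
      (isOpen_lt (continuous_sideFn_pair _) continuous_const))

theorem isOpen_arithLow (m : ZMod (8 * g - 4)) : IsOpen (D.arithLow G m) :=
  ((isOpen_ccw _ _).preimage continuous_fst).inter
    (((isOpen_ccw _ _).preimage continuous_snd).inter
      (isOpen_lt (continuous_sideFn_pair _) continuous_const))

theorem isOpen_arithUp (m : ZMod (8 * g - 4)) : IsOpen (D.arithUp G m) :=
  ((isOpen_ccw _ _).preimage continuous_fst).inter
    (((isOpen_ccw _ _).preimage continuous_snd).inter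
      (isOpen_lt continuous_const (continuous_sideFn_pair _)))

theorem arc_of_geoLow (hg : 2 ≤ g) (hG : ∀ i, G i ∈ arcCC (D.P i) (D.P (i + 1))) {u w : Circle}
    {m : ZMod (8 * g - 4)} (h : (u, w) ∈ D.geoLow G m) : u ∈ arcCC (D.Q m) (D.Q (m + 1)) := by
  have h1 := h.1
  have hH := D.H_mem hg hG m
  obtain ⟨f, hf, hc, -, hh⟩ := D.exists_chain hg m
  clear h hG
  simp only [mem_arcCC, hc, ← hf.eq_iff] at *
  grind

theorem arc_of_arithLow (hg : 2 ≤ g) (hG : ∀ i, G i ∈ arcCC (D.P i) (D.P (i + 1))) {u w : Circle}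
    {m : ZMod (8 * g - 4)} (h : (u, w) ∈ D.arithLow G m) : u ∈ arcCC (D.Q m) (D.Q (m + 1)) := by
  have h1 := h.1
  have hH := D.H_mem hg hG m
  obtain ⟨f, hf, hc, -, hh⟩ := D.exists_chain hg m
  clear h hG
  simp only [mem_arcCC, hc, ← hf.eq_iff] at *
  grind

theorem arc_of_geoUp (hg : 2 ≤ g) (hG : ∀ i, G i ∈ arcCC (D.P i) (D.P (i + 1))) {u w : Circle}
    {m : ZMod (8 * g - 4)} (h : (u, w) ∈ D.geoUp G m) : u ∈ arcCC (D.P (m - 1)) (D.P m) := by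
  have h1 := h.1
  have hH := D.G_mem hG (i := m - 1) (j := m) (by ring)
  obtain ⟨f, hf, hc, -, hh⟩ := D.exists_chain hg m
  clear h hG
  simp only [mem_arcCC, hc, ← hf.eq_iff] at *
  grind

theorem arc_of_arithUp (hg : 2 ≤ g) (hG : ∀ i, G i ∈ arcCC (D.P i) (D.P (i + 1))) {u w : Circle}
    {m : ZMod (8 * g - 4)} (h : (u, w) ∈ D.arithUp G m) : u ∈ arcCC (D.P (m - 1)) (D.P m) := by
  have h1 := h.1
  have hH := D.G_mem hG (i := m - 1) (j := m) (by ring)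
  obtain ⟨f, hf, hc, -, hh⟩ := D.exists_chain hg m
  clear h hG
  simp only [mem_arcCC, hc, ← hf.eq_iff] at *
  grind

theorem geoLow_subset (hg : 2 ≤ g) (hG : ∀ i, G i ∈ arcCC (D.P i) (D.P (i + 1)))
    (m : ZMod (8 * g - 4)) : D.geoLow G m ⊆ D.OmegaGeo \ D.OmegaArith G := by
  rintro ⟨u, w⟩ h
  refine ⟨(D.mem_OmegaGeo_low_iff hg (D.arc_of_geoLow hg hG h) (Or.inr (Or.inr h.2.1))).2 h.2.2.le,
    fun h' => ?_⟩
  have h2 := D.lower_of_mem_OmegaArith hg hG h.2.1 h'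
  have h1 := h.1
  have hH := D.H_mem hg hG m
  obtain ⟨f, hf, hc, -, hh⟩ := D.exists_chain hg m
  clear h hG h'
  simp only [mem_arcCC, hc, ← hf.eq_iff] at *
  grind

theorem geoUp_subset (hg : 2 ≤ g) (hG : ∀ i, G i ∈ arcCC (D.P i) (D.P (i + 1)))
    (m : ZMod (8 * g - 4)) : D.geoUp G m ⊆ D.OmegaGeo \ D.OmegaArith G := by
  rintro ⟨u, w⟩ h
  refine ⟨(D.mem_OmegaGeo_up_iff hg (D.arc_of_geoUp hg hG h) (Or.inr (Or.inr h.2.1))).2 h.2.2.le,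
    fun h' => ?_⟩
  have h2 := D.upper_of_mem_OmegaArith hg hG h.2.1 h'
  have h1 := h.1
  have hH := D.G_mem hG (i := m - 1) (j := m) (by ring)
  obtain ⟨f, hf, hc, -, hh⟩ := D.exists_chain hg m
  clear h hG h'
  simp only [mem_arcCC, hc, ← hf.eq_iff] at *
  grind

theorem arithLow_subset (hg : 2 ≤ g) (hG : ∀ i, G i ∈ arcCC (D.P i) (D.P (i + 1)))
    (m : ZMod (8 * g - 4)) : D.arithLow G m ⊆ D.OmegaArith G \ D.OmegaGeo := by
  rintro ⟨u, w⟩ h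
  refine ⟨D.mem_OmegaArith_low hg hG (Or.inr (Or.inr h.1)) (Or.inr (Or.inr h.2.1)), fun h' => ?_⟩
  rw [D.mem_OmegaGeo_low_iff hg (D.arc_of_arithLow hg hG h) (Or.inr (Or.inr h.2.1))] at h'
  exact h'.not_gt h.2.2

theorem arithUp_subset (hg : 2 ≤ g) (hG : ∀ i, G i ∈ arcCC (D.P i) (D.P (i + 1)))
    (m : ZMod (8 * g - 4)) : D.arithUp G m ⊆ D.OmegaArith G \ D.OmegaGeo := by
  rintro ⟨u, w⟩ h
  refine ⟨D.mem_OmegaArith_up hg hG (Or.inr (Or.inr h.1)) (Or.inr (Or.inr h.2.1)), fun h' => ?_⟩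
  rw [D.mem_OmegaGeo_up_iff hg (D.arc_of_arithUp hg hG h) (Or.inr (Or.inr h.2.1))] at h'
  exact h'.not_gt h.2.2

/-- Moving `w` slightly forward puts it in the open cell; moving `u` slightly back then puts it
strictly before `H m`, against `lower_of_mem_OmegaArith`. -/
theorem not_mem_interior_low (hg : 2 ≤ g) (hG : ∀ i, G i ∈ arcCC (D.P i) (D.P (i + 1)))
    {u w : Circle} {m : ZMod (8 * g - 4)} (hw : w = D.P (m - 1) ∨ CCW (D.P (m - 1)) w (D.P m))
    (hu : u = D.H G m ∨ CCW w u (D.H G m)) : (u, w) ∉ interior (D.OmegaArith G) := by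
  intro h
  have hH := D.H_mem hg hG m
  obtain ⟨f, hf, hc, -, hh⟩ := D.exists_chain hg m
  -- `y` limits the motion of `w`: the new point must stay before `P m` and must not pass `u`.
  obtain ⟨y, hy⟩ : ∃ y, (CCW w u (D.P m) ∧ y = u) ∨ (¬ CCW w u (D.P m) ∧ y = D.P m) := by
    by_cases k : CCW w u (D.P m)
    · exact ⟨_, Or.inl ⟨k, rfl⟩⟩
    · exact ⟨_, Or.inr ⟨k, rfl⟩⟩
  have hyw : y ≠ w := by
    clear h hG
    simp only [mem_arcCC, hc, ← hf.eq_iff, Ne] at *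
    grind
  obtain ⟨w', hw', h1⟩ := exists_snd_mem_interior h (mem_closure_ccw_right hyw)
  simp only [mem_ofPred_eq] at hw'
  have hne : w' ≠ u := by
    clear h hG h1
    simp only [mem_arcCC, hc, ← hf.eq_iff, Ne] at *
    grind
  obtain ⟨u', hu', h2⟩ := exists_fst_mem_interior h1 (mem_closure_ccw_left hne)
  simp only [mem_ofPred_eq] at hu'
  have hw'2 : CCW (D.P (m - 1)) w' (D.P m) := by
    clear h hG h1 h2 hu'
    simp only [mem_arcCC, hc, ← hf.eq_iff, Ne] at *
    grind
  have h3 := D.lower_of_mem_OmegaArith hg hG hw'2 (interior_subset h2)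
  clear h hG h1 h2
  simp only [mem_arcCC, hc, ← hf.eq_iff, Ne] at *
  grind

theorem not_mem_interior_up (hg : 2 ≤ g) (hG : ∀ i, G i ∈ arcCC (D.P i) (D.P (i + 1)))
    {u w : Circle} {m : ZMod (8 * g - 4)} (hw : w = D.Q (m + 1) ∨ CCW (D.Q m) w (D.Q (m + 1)))
    (hu : u = G (m - 1) ∨ CCW (G (m - 1)) u w) : (u, w) ∉ interior (D.OmegaArith G) := by
  intro h
  have hH := D.G_mem hG (i := m - 1) (j := m) (by ring)
  obtain ⟨f, hf, hc, -, hh⟩ := D.exists_chain hg m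
  obtain ⟨y, hy⟩ : ∃ y, (CCW (D.Q m) u w ∧ y = u) ∨ (¬ CCW (D.Q m) u w ∧ y = D.Q m) := by
    by_cases k : CCW (D.Q m) u w
    · exact ⟨_, Or.inl ⟨k, rfl⟩⟩
    · exact ⟨_, Or.inr ⟨k, rfl⟩⟩
  have hyw : y ≠ w := by
    clear h hG
    simp only [mem_arcCC, hc, ← hf.eq_iff, Ne] at *
    grind
  obtain ⟨w', hw', h1⟩ := exists_snd_mem_interior h (mem_closure_ccw_left hyw)
  simp only [mem_ofPred_eq] at hw'
  have hne : w' ≠ u := by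
    clear h hG h1
    simp only [mem_arcCC, hc, ← hf.eq_iff, Ne] at *
    grind
  obtain ⟨u', hu', h2⟩ := exists_fst_mem_interior h1 (mem_closure_ccw_right hne)
  simp only [mem_ofPred_eq] at hu'
  have hw'2 : CCW (D.Q m) w' (D.Q (m + 1)) := by
    clear h hG h1 h2 hu'
    simp only [mem_arcCC, hc, ← hf.eq_iff, Ne] at *
    grind
  have h3 := D.upper_of_mem_OmegaArith hg hG hw'2 (interior_subset h2)
  clear h hG h1 h2
  simp only [mem_arcCC, hc, ← hf.eq_iff, Ne] at *
  grind

/-- Beyond `bulge_low` and `bulge_up` only strictness at `V m` is needed. If the geodesic passes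
through `V m`, moving `u` towards `Q m` or `P m`, respectively, makes it miss the polygon. -/
theorem mem_geo_of_mem_interior (hg : 2 ≤ g) (hG : ∀ i, G i ∈ arcCC (D.P i) (D.P (i + 1)))
    {p : Circle × Circle} (h : p ∈ interior D.OmegaGeo) (h' : p ∉ D.OmegaArith G) :
    ∃ m, p ∈ D.geoLow G m ∨ p ∈ D.geoUp G m := by
  obtain ⟨u, w⟩ := p
  have h0 := interior_subset h
  obtain ⟨m, ⟨hu, hw⟩ | ⟨hu, hw⟩⟩ := D.mem_rect_of_not_mem_OmegaArith hg hG h0 h'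
  · obtain ⟨b1, b2, b3⟩ := D.bulge_low hg hG h0 h' hu hw
    refine ⟨m, Or.inl ⟨b1, b2, lt_of_le_of_ne b3 fun e => ?_⟩⟩
    obtain ⟨α, β, hα, hβ, hcomb⟩ := geodesic_comb h0.1 (show D.V m ∈ geodesic u w from
      ⟨D.norm_V_lt m, e.symm⟩)
    have hH := D.H_mem hg hG m
    obtain ⟨f, hf, hc, -, hh⟩ := D.exists_chain hg m
    have hne : D.Q m ≠ u := by rintro rfl; rw [hc] at b1; grind
    obtain ⟨x, hx, hxi⟩ := exists_fst_mem_interior h (mem_closure_ccw_left hne)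
    simp only [mem_ofPred_eq] at hx
    have h1 := (D.mem_OmegaGeo_low_iff hg (m := m) (by
      clear hG h h' hxi
      simp only [mem_arcCC, hc, ← hf.eq_iff, Ne] at *
      grind) hw).1 (interior_subset hxi)
    rw [hcomb, (orient_eq_zero_iff).2 (Or.inr (Or.inl rfl)), mul_zero, add_zero] at h1
    have h2 : orient x w u < 0 := by
      rw [orient_neg_iff]
      clear hG h h' hxi h1 hcomb
      simp only [mem_arcCC, hc, ← hf.eq_iff, Ne] at *
      grind
    nlinarith
  · obtain ⟨b1, b2, b3⟩ := D.bulge_up hg hG h0 h' hu hw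
    refine ⟨m, Or.inr ⟨b1, b2, lt_of_le_of_ne b3 fun e => ?_⟩⟩
    obtain ⟨α, β, hα, hβ, hcomb⟩ := geodesic_comb h0.1 (show D.V m ∈ geodesic u w from
      ⟨D.norm_V_lt m, e⟩)
    have hH := D.G_mem hG (i := m - 1) (j := m) (by ring)
    obtain ⟨f, hf, hc, -, hh⟩ := D.exists_chain hg m
    have hne : D.P m ≠ u := by rintro rfl; rw [hc] at b1; grind
    obtain ⟨x, hx, hxi⟩ := exists_fst_mem_interior h (mem_closure_ccw_right hne)
    simp only [mem_ofPred_eq] at hx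
    have h1 := (D.mem_OmegaGeo_up_iff hg (m := m) (by
      clear hG h h' hxi
      simp only [mem_arcCC, hc, ← hf.eq_iff, Ne] at *
      grind) hw).1 (interior_subset hxi)
    rw [hcomb, (orient_eq_zero_iff).2 (Or.inr (Or.inl rfl)), mul_zero, add_zero] at h1
    have h2 : 0 < orient x w u := by
      rw [← ccw_iff]
      clear hG h h' hxi h1 hcomb
      simp only [mem_arcCC, hc, ← hf.eq_iff, Ne] at *
      grind
    nlinarith

/-- On the boundary of a rectangle the pair either is no interior point of the arithmetic domain or
its geodesic meets the polygon at `V m`. -/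
theorem mem_arith_of_mem_interior (hg : 2 ≤ g) (hG : ∀ i, G i ∈ arcCC (D.P i) (D.P (i + 1)))
    {p : Circle × Circle} (h : p ∈ interior (D.OmegaArith G)) (h' : p ∉ D.OmegaGeo) :
    ∃ m, p ∈ D.arithLow G m ∨ p ∈ D.arithUp G m := by
  obtain ⟨u, w⟩ := p
  obtain ⟨m, ⟨hu, hw⟩ | ⟨hu, hw⟩⟩ := D.mem_rect_of_not_mem_OmegaGeo hg hG (interior_subset h) h'
  · have hH := D.H_mem hg hG m
    have hH1 := D.H_mem' hg hG (i := m + 1) (j := m + 2) (by ring)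
    obtain ⟨f, hf, hc, -, hh⟩ := D.exists_chain hg m
    have hu2 : u ∈ arcCC (D.Q m) (D.Q (m + 1)) := by
      clear hG h h'
      simp only [mem_arcCC, hc, ← hf.eq_iff] at *
      grind
    rw [D.mem_OmegaGeo_low_iff hg hu2 hw, not_le] at h'
    have n1 : w ≠ D.P m := by
      rintro rfl
      refine D.not_mem_interior_low hg hG (m := m + 1) (Or.inl (by rw [add_sub_cancel_right])) ?_ h
      clear hG h h' hw
      simp only [mem_arcCC, hc, ← hf.eq_iff] at *
      grind
    have n2 : w ≠ D.P (m - 1) := by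
      rintro rfl
      obtain ⟨γ, δ, hγ, hδ, hV⟩ := D.V_comb_left hg m
      rw [hV, (orient_eq_zero_iff).2 (Or.inr (Or.inl rfl)), mul_zero, zero_add] at h'
      have : ¬ orient u (D.P (m - 1)) (D.Q m) < 0 := by
        rw [orient_neg_iff]
        clear hG h h' hw n1
        simp only [mem_arcCC, hc, ← hf.eq_iff] at *
        grind
      nlinarith
    have n3 : u ≠ D.Q (m + 1) := by
      rintro rfl
      obtain ⟨γ, δ, hγ, hδ, hV⟩ := D.V_comb_right hg m
      rw [hV, (orient_eq_zero_iff (b := w)).2 (Or.inr (Or.inr rfl)), mul_zero, add_zero] at h'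
      have : ¬ orient (D.Q (m + 1)) w (D.P m) < 0 := by
        rw [orient_neg_iff]
        clear hG h h' n1 n2
        simp only [mem_arcCC, hc, ← hf.eq_iff] at *
        grind
      nlinarith
    have hw2 : CCW (D.P (m - 1)) w (D.P m) := by
      rcases hw with hw | hw | hw
      · exact absurd hw n2
      · exact absurd hw n1
      · exact hw
    have n4 : u ≠ D.H G m := fun e =>
      D.not_mem_interior_low hg hG (Or.inr hw2) (Or.inl e) h
    refine ⟨m, Or.inl ⟨?_, hw2, h'⟩⟩
    rcases hu with hu | hu | hu
    · exact absurd hu n4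
    · exact absurd hu n3
    · exact hu
  · have hH := D.G_mem hG (i := m - 1) (j := m) (by ring)
    have hH1 := D.G_mem hG (i := m - 2) (j := m - 1) (by ring)
    obtain ⟨f, hf, hc, -, hh⟩ := D.exists_chain hg m
    have hu2 : u ∈ arcCC (D.P (m - 1)) (D.P m) := by
      clear hG h h'
      simp only [mem_arcCC, hc, ← hf.eq_iff] at *
      grind
    rw [D.mem_OmegaGeo_up_iff hg hu2 hw, not_le] at h'
    have n1 : w ≠ D.Q m := by
      rintro rfl
      refine D.not_mem_interior_up hg hG (m := m - 1) (Or.inl (by rw [sub_add_cancel])) ?_ h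
      rw [show m - 1 - 1 = m - 2 by ring]
      clear hG h h' hw
      simp only [mem_arcCC, hc, ← hf.eq_iff] at *
      grind
    have n2 : w ≠ D.Q (m + 1) := by
      rintro rfl
      obtain ⟨γ, δ, hγ, hδ, hV⟩ := D.V_comb_right hg m
      rw [hV, (orient_eq_zero_iff).2 (Or.inr (Or.inl rfl)), mul_zero, add_zero] at h'
      have : ¬ 0 < orient u (D.Q (m + 1)) (D.P m) := by
        rw [← ccw_iff]
        clear hG h h' hw n1
        simp only [mem_arcCC, hc, ← hf.eq_iff] at *
        grind
      nlinarith
    have n3 : u ≠ D.P (m - 1) := by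
      rintro rfl
      obtain ⟨γ, δ, hγ, hδ, hV⟩ := D.V_comb_left hg m
      rw [hV, (orient_eq_zero_iff (b := w)).2 (Or.inr (Or.inr rfl)), mul_zero, zero_add] at h'
      have : ¬ 0 < orient (D.P (m - 1)) w (D.Q m) := by
        rw [← ccw_iff]
        clear hG h h' n1 n2
        simp only [mem_arcCC, hc, ← hf.eq_iff] at *
        grind
      nlinarith
    have hw2 : CCW (D.Q m) w (D.Q (m + 1)) := by
      rcases hw with hw | hw | hw
      · exact absurd hw n1
      · exact absurd hw n2
      · exact hw
    have n4 : u ≠ G (m - 1) := fun e =>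
      D.not_mem_interior_up hg hG (Or.inr hw2) (Or.inl e) h
    refine ⟨m, Or.inr ⟨?_, hw2, h'⟩⟩
    rcases hu with hu | hu | hu
    · exact absurd hu n3
    · exact absurd hu n4
    · exact hu

end SurfacePolygon

/-! ### Points of the disc with proportional lifts. -/

theorem eq_of_lift {u w : Circle} {z z' : ℂ} {α β α' β' : ℝ} (hz : ‖z‖ < 1) (hz' : ‖z'‖ < 1)
    (hα : 0 < α) (hα' : 0 < α') (h1 : 2 * z = α * u + β * w) (h2 : 1 + ‖z‖ ^ 2 = α + β)
    (h1' : 2 * z' = α' * u + β' * w) (h2' : 1 + ‖z'‖ ^ 2 = α' + β') (h : α * β' = α' * β) :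
    z = z' := by
  obtain ⟨c, hc⟩ : ∃ c, c = α' / α := ⟨_, rfl⟩
  have hc0 : 0 < c := hc ▸ div_pos hα' hα
  have e1 : α' = c * α := by rw [hc]; field_simp
  have e2 : β' = c * β := by
    rw [hc]; field_simp; linarith
  have e3 : z' = c * z := by
    have : (2 : ℂ) * z' = 2 * (c * z) := by
      rw [h1', e1, e2]; push_cast; linear_combination (-(c : ℂ)) * h1
    exact mul_left_cancel₀ two_ne_zero this
  have e4 : ‖z'‖ = c * ‖z‖ := by
    rw [e3, norm_mul, Complex.norm_real, Real.norm_of_nonneg hc0.le]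
  have e5 : (c - 1) * (c * ‖z‖ ^ 2 - 1) = 0 := by
    rw [e1, e2, ← mul_add, ← h2, e4] at h2'
    linear_combination h2'
  have hn := norm_nonneg z
  -- The second factor belongs to the mirror image of `z` in the unit circle, which lies outside the
  -- disc.
  rcases mul_eq_zero.1 e5 with h | h
  · rw [e3, sub_eq_zero.1 h]; simp
  · exfalso
    rw [e4] at hz'
    nlinarith

theorem eq_of_mem_geodesic {u w a b : Circle} (h : u ≠ w) {z z' : ℂ} (hz : z ∈ geodesic u w)
    (hz' : z' ∈ geodesic u w) (h0 : sideFn a b z = 0) (h0' : sideFn a b z' = 0)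
    (hne : orient a b u ≠ 0) : z = z' := by
  obtain ⟨α, β, hα, hβ, h1, h2⟩ := geodesic_lift h hz
  obtain ⟨α', β', hα', hβ', h1', h2'⟩ := geodesic_lift h hz'
  refine eq_of_lift hz.1 hz'.1 hα hα' h1 h2 h1' h2' (mul_right_cancel₀ hne ?_)
  rw [sideFn_of_circle_lift a b h1 h2] at h0
  rw [sideFn_of_circle_lift a b h1' h2'] at h0'
  linear_combination β' * h0 - β * h0'

namespace SurfacePolygon

variable {g : ℕ} (D : SurfacePolygon g) {A G : ZMod (8 * g - 4) → Circle}

/-! ### The bijection -/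

theorem Phi_geoLow (hg : 2 ≤ g) (hG : ∀ i, G i ∈ arcCC (D.P i) (D.P (i + 1))) {p : Circle × Circle}
    {m : ZMod (8 * g - 4)} (h : p ∈ D.geoLow G m) :
    D.Phi G p = onPair (D.U (tauIdx g m)) p :=
  have h' := D.geoLow_subset hg hG m h
  D.Phi_low hg hG h'.1 h'.2 (D.arc_of_geoLow hg hG h) (Or.inr (Or.inr h.2.1))

theorem Phi_geoUp (hg : 2 ≤ g) (hG : ∀ i, G i ∈ arcCC (D.P i) (D.P (i + 1))) {p : Circle × Circle}
    {m : ZMod (8 * g - 4)} (h : p ∈ D.geoUp G m) :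
    D.Phi G p = onPair (D.U (tauIdx g m)) p :=
  have h' := D.geoUp_subset hg hG m h
  D.Phi_up hg hG h'.1 h'.2 (D.arc_of_geoUp hg hG h) (Or.inr (Or.inr h.2.1))

theorem onPair_injective (M : SU11) : Function.Injective (onPair M) := fun p q h =>
  Prod.ext (SU11.onCircle_injective M (congrArg Prod.fst h))
    (SU11.onCircle_injective M (congrArg Prod.snd h))

theorem tau_injective (hg : 2 ≤ g) {m n : ZMod (8 * g - 4)} (h : tauIdx g m = tauIdx g n) :
    m = n := by
  rw [← tau_tau hg m, h, tau_tau hg]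

theorem arithLow_arithUp_disjoint (hg : 2 ≤ g) (hG : ∀ i, G i ∈ arcCC (D.P i) (D.P (i + 1)))
    {p : Circle × Circle} {m n : ZMod (8 * g - 4)} (h : p ∈ D.arithLow G m)
    (h' : p ∈ D.arithUp G n) : False :=
  D.low_up_disjoint hg (D.arc_of_arithUp hg hG h') h'.2.1 (D.arc_of_arithLow hg hG h) h.2.1

theorem arithLow_unique (hg : 2 ≤ g) {p : Circle × Circle} {m n : ZMod (8 * g - 4)}
    (h : p ∈ D.arithLow G m) (h' : p ∈ D.arithLow G n) : m = n := by
  have h1 := h.2.1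
  have h2 := h'.2.1
  rw [← sub_add_cancel m 1] at h1
  rw [← sub_add_cancel n 1] at h2
  simp only [add_sub_cancel_right] at h1 h2
  have := D.index_eq_of_P hg (Or.inr (Or.inr h1)) h2
  exact sub_left_injective this

theorem arithUp_unique (hg : 2 ≤ g) {p : Circle × Circle} {m n : ZMod (8 * g - 4)}
    (h : p ∈ D.arithUp G m) (h' : p ∈ D.arithUp G n) : m = n :=
  D.index_eq_of_Q hg (Or.inr (Or.inr h.2.1)) h'.2.1

theorem Phi_mem_arith (hg : 2 ≤ g) (hG : ∀ i, G i ∈ arcCC (D.P i) (D.P (i + 1)))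
    {p : Circle × Circle} (h : p ∈ interior D.OmegaGeo) (h' : p ∉ D.OmegaArith G) :
    ∃ m, D.Phi G p = onPair (D.U (tauIdx g m)) p ∧
      (D.Phi G p ∈ D.arithUp G (tauIdx g m) ∨ D.Phi G p ∈ D.arithLow G (tauIdx g m)) := by
  obtain ⟨m, h1 | h1⟩ := D.mem_geo_of_mem_interior hg hG h h'
  · have e := D.Phi_geoLow hg hG h1
    exact ⟨m, e, Or.inl (e ▸ (D.onPair_U_mem_arithUp hg).2 h1)⟩
  · have e := D.Phi_geoUp hg hG h1
    exact ⟨m, e, Or.inr (e ▸ (D.onPair_U_mem_arithLow hg).2 h1)⟩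

theorem not_mem_frontier_of_disjoint {X : Type*} [TopologicalSpace X] {S O : Set X} {x : X}
    (hO : IsOpen O) (hx : x ∈ O) (h : Disjoint O S) : x ∉ frontier S := fun hf => by
  obtain ⟨y, h1, h2⟩ := mem_closure_iff.1 (frontier_subset_closure hf) O hO hx
  exact disjoint_left.1 h h1 h2

theorem mem_interior_of_not_mem_frontier {X : Type*} [TopologicalSpace X] {S : Set X} {x : X}
    (h : x ∈ S) (h' : x ∉ frontier S) : x ∈ interior S := by
  by_contra hx
  exact h' ⟨subset_closure h, hx⟩

/-- On the common part `Φ` is the identity. Elsewhere it exchanges the open bulges with the open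
missing corners, and the image determines the vertex because distinct corners are disjoint. -/
theorem bijOn_Phi (hg : 2 ≤ g) (hG : ∀ i, G i ∈ arcCC (D.P i) (D.P (i + 1))) :
    Set.BijOn (D.Phi G) (interior D.OmegaGeo \ frontier (D.OmegaArith G))
      (interior (D.OmegaArith G) \ frontier D.OmegaGeo) := by
  have hLow : ∀ {q m}, q ∈ D.arithLow G m →
      q ∈ interior (D.OmegaArith G) \ frontier D.OmegaGeo := fun {q m} h =>
    ⟨interior_maximal (fun x hx => (D.arithLow_subset hg hG m hx).1) (D.isOpen_arithLow m) h,
      not_mem_frontier_of_disjoint (D.isOpen_arithLow m) h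
        (disjoint_left.2 fun x hx => (D.arithLow_subset hg hG m hx).2)⟩
  have hUp : ∀ {q m}, q ∈ D.arithUp G m →
      q ∈ interior (D.OmegaArith G) \ frontier D.OmegaGeo := fun {q m} h =>
    ⟨interior_maximal (fun x hx => (D.arithUp_subset hg hG m hx).1) (D.isOpen_arithUp m) h,
      not_mem_frontier_of_disjoint (D.isOpen_arithUp m) h
        (disjoint_left.2 fun x hx => (D.arithUp_subset hg hG m hx).2)⟩
  have hnot : ∀ {p}, p ∈ interior D.OmegaGeo → p ∉ D.OmegaArith G → D.Phi G p ∉ D.OmegaGeo := by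
    intro p h h'
    obtain ⟨m, -, h1 | h1⟩ := D.Phi_mem_arith hg hG h h'
    · exact (D.arithUp_subset hg hG _ h1).2
    · exact (D.arithLow_subset hg hG _ h1).2
  refine ⟨?_, ?_, ?_⟩
  · rintro p ⟨h1, h2⟩
    by_cases h' : p ∈ D.OmegaArith G
    · rw [D.Phi_of_mem (interior_subset h1) h']
      exact ⟨mem_interior_of_not_mem_frontier h' h2, disjoint_interior_frontier.notMem_of_mem_left h1⟩
    · obtain ⟨m, -, h | h⟩ := D.Phi_mem_arith hg hG h1 h'
      · exact hUp h
      · exact hLow h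
  · rintro p ⟨h1, -⟩ q ⟨h2, -⟩ he
    by_cases hp : p ∈ D.OmegaArith G
    · have ep := D.Phi_of_mem (interior_subset h1) hp
      by_cases hq : q ∈ D.OmegaArith G
      · rwa [ep, D.Phi_of_mem (interior_subset h2) hq] at he
      · exact absurd (he ▸ ep.symm ▸ interior_subset h1) (hnot h2 hq)
    · by_cases hq : q ∈ D.OmegaArith G
      · have eq := D.Phi_of_mem (interior_subset h2) hq
        exact absurd (he.symm ▸ eq.symm ▸ interior_subset h2) (hnot h1 hp)
      · obtain ⟨m, em, hm⟩ := D.Phi_mem_arith hg hG h1 hp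
        obtain ⟨n, en, hn⟩ := D.Phi_mem_arith hg hG h2 hq
        rw [← he] at hn
        have hmn : m = n := by
          apply tau_injective hg
          rcases hm with hm | hm <;> rcases hn with hn | hn
          · exact D.arithUp_unique hg hm hn
          · exact (D.arithLow_arithUp_disjoint hg hG hn hm).elim
          · exact (D.arithLow_arithUp_disjoint hg hG hm hn).elim
          · exact D.arithLow_unique hg hm hn
        subst hmn
        exact onPair_injective _ (em.symm.trans (he.trans en))
  · rintro q ⟨h1, h2⟩
    by_cases h' : q ∈ D.OmegaGeo
    · exact ⟨q, ⟨mem_interior_of_not_mem_frontier h' h2,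
        disjoint_interior_frontier.notMem_of_mem_left h1⟩, D.Phi_of_mem h' (interior_subset h1)⟩
    · obtain ⟨m, h | h⟩ := D.mem_arith_of_mem_interior hg hG h1 h'
      · have h3 := (D.onPair_U_mem_geoUp hg).2 h
        refine ⟨_, ⟨interior_maximal (fun x hx => (D.geoUp_subset hg hG _ hx).1)
          (D.isOpen_geoUp _) h3, not_mem_frontier_of_disjoint (D.isOpen_geoUp _) h3
            (disjoint_left.2 fun x hx => (D.geoUp_subset hg hG _ hx).2)⟩, ?_⟩
        rw [D.Phi_geoUp hg hG h3, tau_tau hg, D.onPair_U_U_tau hg]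
      · have h3 := (D.onPair_U_mem_geoLow hg).2 h
        refine ⟨_, ⟨interior_maximal (fun x hx => (D.geoLow_subset hg hG _ hx).1)
          (D.isOpen_geoLow _) h3, not_mem_frontier_of_disjoint (D.isOpen_geoLow _) h3
            (disjoint_left.2 fun x hx => (D.geoLow_subset hg hG _ hx).2)⟩, ?_⟩
        rw [D.Phi_geoLow hg hG h3, tau_tau hg, D.onPair_U_U_tau hg]

/-! ### The exit side -/

/-- For sides that are not adjacent, both ends of one extended side lie strictly in front of the
other. -/
theorem eq_vertex_of_mem_sides (hg : 2 ≤ g) {i k : ZMod (8 * g - 4)} {z : ℂ} (hi : z ∈ D.side i)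
    (hk : z ∈ D.side k) (hik : i ≠ k) : ∃ j, z = D.V j := by
  have n1 := one_ne_zero_index hg
  have key : ∀ i, z ∈ D.side i → z ∈ D.side (i + 1) → z = D.V (i + 1) := fun i hi hk => by
    have hV := D.V_mem (i + 1)
    rw [add_sub_cancel_right] at hV
    refine eq_of_mem_geodesic (D.P_ne_Q hg i) hi.2 hV.1 hk.2.2 hV.2.2 ?_
    have : CCW (D.P (i + 1)) (D.Q (i + 1 + 1)) (D.P i) := by
      obtain ⟨f, hf, hc, -, hh⟩ := D.exists_chain hg i
      rw [show i + 1 + 1 = i + 2 by ring, hc]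
      grind
    exact (ccw_iff.1 this).ne'
  by_cases h1 : k = i + 1
  · subst h1; exact ⟨_, key i hi hk⟩
  by_cases h2 : i = k + 1
  · subst h2; exact ⟨_, key k hk hi⟩
  exfalso
  obtain ⟨α, β, hα, hβ, h⟩ := geodesic_comb (D.P_ne_Q hg i) hi.2
  have h0 := h (D.P k) (D.Q (k + 1))
  rw [hk.2.2] at h0
  have p1 := ccw_iff.1 (D.ccw_P_outside hg hik h2)
  have p2 := ccw_iff.1 (D.ccw_Q_outside hg (k := k) (m := i + 1) (fun e => h1 e.symm)
    fun e => hik (add_right_cancel e))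
  have := mul_pos hα p1
  have := mul_pos hβ p2
  linarith

theorem exists_neg_side (hg : 2 ≤ g) (w : Circle) : ∃ k, orient (D.P k) (D.Q (k + 1)) w < 0 := by
  obtain ⟨i, hi⟩ := D.exists_cell hg w
  obtain ⟨f, hf, hc, -, hh⟩ := D.exists_chain hg i
  rcases hi with rfl | hi
  · refine ⟨i - 1, ?_⟩
    rw [orient_neg_iff, sub_add_cancel, hc]
    grind
  · refine ⟨i, ?_⟩
    rw [orient_neg_iff]
    rw [hc] at hi ⊢
    grind

/-- The exit point of a geodesic meeting the polygon lies on a side beyond which its endpoint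
lies. -/
theorem exists_exitPoint (hg : 2 ≤ g) {u w : Circle} (h : (u, w) ∈ D.OmegaGeo) :
    ∃ k, ∃ z ∈ D.side k, D.IsExitPoint (u, w) z ∧ orient (D.P k) (D.Q (k + 1)) w < 0 := by
  have := neZero_index hg
  obtain ⟨hne, z₀, hz₀, hF₀⟩ := h
  simp only at hne hz₀
  obtain ⟨l, hl⟩ : ∃ l : ZMod (8 * g - 4) → Circle → ℝ,
    ∀ k x, l k x = orient (D.P k) (D.Q (k + 1)) x := ⟨_, fun _ _ => rfl⟩
  have hne' : (Finset.univ.filter fun k => l k w < 0).Nonempty := by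
    obtain ⟨k, hk⟩ := D.exists_neg_side hg w
    exact ⟨k, Finset.mem_filter.2 ⟨Finset.mem_univ _, by rwa [hl]⟩⟩
  -- The ratio test of linear programming. Along `u + t w` only the constraints negative at `w` fail
  -- as `t` grows, and the first to fail gives the exit point.
  obtain ⟨k, hk, hmin⟩ := Finset.exists_min_image _ (fun k => l k u / (-l k w)) hne'
  have hkw := (Finset.mem_filter.1 hk).2
  obtain ⟨t, ht⟩ : ∃ t, t = l k u / (-l k w) := ⟨_, rfl⟩
  have htk : l k u = t * (-l k w) := by
    rw [ht, div_mul_cancel₀]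
    linarith
  have hbound : ∀ z ∈ geodesic u w ∩ D.F, ∀ α β : ℝ, 0 < α → 0 < β → 2 * z = α * u + β * w →
      1 + ‖z‖ ^ 2 = α + β → β ≤ α * t := by
    rintro z ⟨-, hF⟩ α β hα hβ h1 h2
    have := hF.2 k
    rw [sideFn_of_circle_lift _ _ h1 h2, ← hl, ← hl, htk] at this
    have h3 : 0 ≤ (-l k w) * (α * t - β) := by linarith
    linarith [nonneg_of_mul_nonneg_right h3 (by linarith : 0 < -l k w)]
  obtain ⟨α₀, β₀, hα₀, hβ₀, h1₀, h2₀⟩ := geodesic_lift hne hz₀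
  have hb₀ := hbound z₀ ⟨hz₀, hF₀⟩ α₀ β₀ hα₀ hβ₀ h1₀ h2₀
  have ht0 : 0 < t := pos_of_mul_pos_right (hβ₀.trans_le hb₀) hα₀.le
  obtain ⟨z, hz, c, hc, h1, h2, h3⟩ := exists_mem_geodesic hne one_pos ht0
  have hside : ∀ j, 0 ≤ l j u + t * l j w := by
    intro j
    rcases lt_or_ge (l j w) 0 with hj | hj
    · have := hmin j (Finset.mem_filter.2 ⟨Finset.mem_univ _, hj⟩)
      rw [← ht, le_div_iff₀ (by linarith)] at this
      linarith
    · have hF := hF₀.2 j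
      rw [sideFn_of_circle_lift _ _ h1₀ h2₀, ← hl, ← hl] at hF
      have : 0 ≤ α₀ * (l j u + t * l j w) := by nlinarith
      exact nonneg_of_mul_nonneg_right this hα₀
  have hzF : z ∈ D.F := by
    refine ⟨hz.1, fun j => ?_⟩
    rw [h3, ← hl, ← hl, one_mul]
    exact mul_nonneg hc.le (hside j)
  refine ⟨k, z, ⟨hzF, hz.1, ?_⟩, ⟨⟨hz, hzF⟩, fun z' hz' => ?_⟩, by rwa [← hl]⟩
  · rw [h3, ← hl, ← hl, htk]; ring
  · obtain ⟨α', β', hα', hβ', h1', h2'⟩ := geodesic_lift hne hz'.1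
    have hb := hbound z' hz' α' β' hα' hβ' h1' h2'
    rw [mul_one] at h1 h2
    rw [lift_lt_of_norm_le hne hz.1 hz'.1.1 hc (mul_pos hc ht0) hα' hβ' h1 h2 h1' h2']
    nlinarith

theorem exitPoint_unique {u w : Circle} (hne : u ≠ w) {z z' : ℂ} (h : D.IsExitPoint (u, w) z)
    (h' : D.IsExitPoint (u, w) z') : z = z' := by
  obtain ⟨α, β, hα, hβ, h1, h2⟩ := geodesic_lift hne h.1.1
  obtain ⟨α', β', hα', hβ', h1', h2'⟩ := geodesic_lift hne h'.1.1
  have l1 := h.2 z' h'.1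
  have l2 := h'.2 z h.1
  rw [lift_lt_of_norm_le hne h.1.1.1 h'.1.1.1 hα hβ hα' hβ' h1 h2 h1' h2'] at l1
  rw [lift_lt_of_norm_le hne h'.1.1.1 h.1.1.1 hα' hβ' hα hβ h1' h2' h1 h2] at l2
  exact eq_of_lift h.1.1.1 h'.1.1.1 hα hα' h1 h2 h1' h2' (le_antisymm l1 l2)

theorem FGeo_eq (hg : 2 ≤ g) {u w : Circle} (h : (u, w) ∈ D.OmegaGeo) :
    ∃ i, ∃ z ∈ D.side i, D.IsExitPoint (u, w) z ∧ D.FGeo (u, w) = onPair (D.T i) (u, w) := by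
  obtain ⟨k, z, hz, hex, -⟩ := D.exists_exitPoint hg h
  have hE : ∃ i, (u, w) ∈ D.exitSet i := ⟨k, h.1, z, hz, hex⟩
  obtain ⟨-, z', hz', hex'⟩ := hE.choose_spec
  exact ⟨hE.choose, z', hz', hex', dif_pos hE⟩

/-- Two sides share only vertices, so the side chosen by `FGeo` is the one from `exists_exitPoint`,
and `w` lies behind it. -/
theorem FGeo_eq_of_not_vertex (hg : 2 ≤ g) {u w : Circle} (h : (u, w) ∈ D.OmegaGeo)
    (hv : ∀ i, ¬ D.IsExitPoint (u, w) (D.V i)) :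
    ∃ i, ∃ z ∈ D.side i, z ∈ geodesic u w ∧ CCW (D.P i) w (D.Q (i + 1)) ∧
      D.FGeo (u, w) = onPair (D.T i) (u, w) := by
  obtain ⟨k, z, hz, hex, hk⟩ := D.exists_exitPoint hg h
  obtain ⟨i, z', hz', hex', hF⟩ := D.FGeo_eq hg h
  obtain rfl := D.exitPoint_unique h.1 hex hex'
  have hik : i = k := by
    by_contra hne
    obtain ⟨j, rfl⟩ := D.eq_vertex_of_mem_sides hg hz' hz hne
    exact hv j hex
  subst hik
  refine ⟨i, z, hz, hex.1.1, ?_, hF⟩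
  rw [orient_neg_iff] at hk
  exact ccw_rotate.1 (ccw_rotate.1 (ccw_rotate.1 (by
    have := ccw_rotate.1 hk
    exact this)))

/-- The half-planes of sides `σ i + 1` and `σ i - 1` are images of those of `i - 1` and `i + 1`. For
the sides other than `σ i` and its neighbours, both ends of the extended side `σ i` lie in front. -/
theorem mob_T_mem_F (hg : 2 ≤ g) {i : ZMod (8 * g - 4)} {z : ℂ} (hz : z ∈ D.side i) :
    mob (D.T i) z ∈ D.F := by
  have hn := hz.2.1
  refine ⟨SU11.norm_mob_lt _ hn, fun k => ?_⟩
  obtain ⟨s, hs⟩ : ∃ s, s = sigmaIdx g i := ⟨_, rfl⟩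
  have hpos : ∀ a b, 0 ≤ sideFn a b z →
      0 ≤ sideFn (onCircle (D.T i) a) (onCircle (D.T i) b) (mob (D.T i) z) := fun a b h =>
    not_lt.1 fun hlt => h.not_gt ((SU11.sideFn_mob_neg _ hn).1 hlt)
  have hg1 := SU11.mob_mem_geodesic (D.T i) hz.2
  rw [D.T_P hg, D.T_Q_succ hg, ← hs] at hg1
  by_cases k1 : k = s
  · rw [k1, sideFn_swap, hg1.2, neg_zero]
  by_cases k2 : k = s + 1
  · have := hpos (D.P (i - 1)) (D.Q i) (by simpa using hz.1.2 (i - 1))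
    rw [D.T_P_pred hg, D.T_Q hg, ← hs] at this
    rwa [k2, show s + 1 + 1 = s + 2 by ring]
  by_cases k3 : k = s - 1
  · have := hpos (D.P (i + 1)) (D.Q (i + 2)) (by
      have := hz.1.2 (i + 1); rwa [show i + 1 + 1 = i + 2 by ring] at this)
    rw [D.T_P_succ hg, D.T_Q_succ_succ hg, ← hs] at this
    rwa [k3, sub_add_cancel]
  obtain ⟨α, β, hα, hβ, h⟩ := geodesic_comb (D.P_ne_Q hg s).symm hg1
  rw [h]
  have p1 := ccw_iff.1 (D.ccw_P_outside hg (k := k) (m := s) (Ne.symm k1)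
    fun e => k3 (by rw [e]; ring))
  have p2 := ccw_iff.1 (D.ccw_Q_outside hg (k := k) (m := s + 1) (fun e => k2 e.symm)
    fun e => k1 (add_right_cancel e).symm)
  positivity

theorem mapsTo_FGeo (hg : 2 ≤ g) : Set.MapsTo D.FGeo D.OmegaGeo D.OmegaGeo := by
  rintro ⟨u, w⟩ h
  obtain ⟨i, z, hz, hex, hF⟩ := D.FGeo_eq hg h
  rw [hF]
  exact ⟨fun e => h.1 (SU11.onCircle_injective _ e), _,
    SU11.mob_mem_geodesic (D.T i) hex.1.1, D.mob_T_mem_F hg hz⟩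

/-- The exit point is on side `i` and not behind side `i + 1`, while `w` is behind the first and not
in front of the second. So `u` is in front of the first and not behind the second. -/
theorem exit_right (hg : 2 ≤ g) {u w : Circle} {i : ZMod (8 * g - 4)} {z : ℂ} (h : u ≠ w)
    (hz : z ∈ D.side i) (hzg : z ∈ geodesic u w) (hw : w ∈ arcCO (D.P (i + 1)) (D.Q (i + 1))) :
    u ∈ arcCC (D.Q (i + 2)) (D.P i) := by
  obtain ⟨α, β, hα, hβ, hcomb⟩ := geodesic_comb h hzg
  have z0 := hz.2.2
  have z1 := hz.1.2 (i + 1)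
  rw [hcomb] at z0 z1
  rw [show i + 1 + 1 = i + 2 by ring] at z1
  obtain ⟨f, hf, hc, -, hh⟩ := D.exists_chain hg i
  simp only [arcCO, mem_ofPred_eq, hc, ← hf.eq_iff] at hw
  have k0 : orient (D.P i) (D.Q (i + 1)) w < 0 := by rw [orient_neg_iff, hc]; grind
  have k1 : ¬ 0 < orient (D.P (i + 1)) (D.Q (i + 2)) w := by rw [← ccw_iff, hc]; grind
  have l0 : 0 < orient (D.P i) (D.Q (i + 1)) u := by nlinarith
  have l1 : ¬ orient (D.P (i + 1)) (D.Q (i + 2)) u < 0 := by nlinarith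
  rw [← ccw_iff, hc] at l0
  rw [orient_neg_iff, hc] at l1
  simp only [mem_arcCC, hc, ← hf.eq_iff]
  grind

theorem exit_left (hg : 2 ≤ g) {u w : Circle} {i : ZMod (8 * g - 4)} {z : ℂ} (h : u ≠ w)
    (hz : z ∈ D.side i) (hzg : z ∈ geodesic u w) (hw : CCW (D.P i) w (D.Q i)) :
    u ∈ arcCC (D.Q (i + 1)) (D.P (i - 1)) := by
  obtain ⟨α, β, hα, hβ, hcomb⟩ := geodesic_comb h hzg
  have z0 := hz.2.2
  have z1 := hz.1.2 (i - 1)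
  rw [hcomb] at z0 z1
  rw [sub_add_cancel] at z1
  obtain ⟨f, hf, hc, -, hh⟩ := D.exists_chain hg i
  rw [hc] at hw
  have k0 : orient (D.P i) (D.Q (i + 1)) w < 0 := by rw [orient_neg_iff, hc]; grind
  have k1 : ¬ 0 < orient (D.P (i - 1)) (D.Q i) w := by rw [← ccw_iff, hc]; grind
  have l0 : 0 < orient (D.P i) (D.Q (i + 1)) u := by nlinarith
  have l1 : ¬ orient (D.P (i - 1)) (D.Q i) u < 0 := by nlinarith
  rw [← ccw_iff, hc] at l0
  rw [orient_neg_iff, hc] at l1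
  simp only [mem_arcCC, hc, ← hf.eq_iff]
  grind

end SurfacePolygon

/-- In a linear coordinate an arc not containing the cut is an interval. -/
theorem mem_arcCC_iff_of_le {f : Circle → ℝ} (hf : Function.Injective f)
    (hc : ∀ x y z, CCW x y z ↔
      (f x < f y ∧ f y < f z) ∨ (f y < f z ∧ f z < f x) ∨ (f z < f x ∧ f x < f y))
    {a b x : Circle} (h : f a ≤ f b) : x ∈ arcCC a b ↔ f a ≤ f x ∧ f x ≤ f b := by
  rw [mem_arcCC, hc, ← hf.eq_iff, ← hf.eq_iff]
  grind

/-- In a linear coordinate an arc containing the cut is the complement of an interval. -/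
theorem mem_arcCC_iff_of_lt {f : Circle → ℝ} (hf : Function.Injective f)
    (hc : ∀ x y z, CCW x y z ↔
      (f x < f y ∧ f y < f z) ∨ (f y < f z ∧ f z < f x) ∨ (f z < f x ∧ f x < f y))
    {a b x : Circle} (h : f b < f a) : x ∈ arcCC a b ↔ f a ≤ f x ∨ f x ≤ f b := by
  rw [mem_arcCC, hc, ← hf.eq_iff, ← hf.eq_iff]
  grind

namespace SurfacePolygon

variable {g : ℕ} (D : SurfacePolygon g) {A G : ZMod (8 * g - 4) → Circle}

/-! ### The arithmetic map -/

theorem arcCO_unique (hg : 2 ≤ g) (hA : D.IsExtremal A) {w : Circle} {i j : ZMod (8 * g - 4)}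
    (hi : w ∈ arcCO (A i) (A (i + 1))) (hj : w ∈ arcCO (A j) (A (j + 1))) : i = j := by
  have := neZero_index hg
  have hmono : ∀ j, ∃ f : Circle → ℝ, Function.Injective f ∧ (∀ x y z, CCW x y z ↔
      (f x < f y ∧ f y < f z) ∨ (f y < f z ∧ f z < f x) ∨ (f z < f x ∧ f x < f y)) ∧
      ∀ s t : ℕ, s < t → t < 8 * g - 4 → f (A (j + s)) < f (A (j + t)) := by
    intro j
    obtain ⟨f, hf, hn, hc, hPQ, hQP⟩ := D.exists_cut_index hg j
    refine ⟨f, hf, hc, fun s t hst ht => ?_⟩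
    have h1 := hPQ s (by omega)
    have h2 := hPQ t ht
    have h3 := hQP s t hst ht
    rcases hA (j + s) with e | e <;> rcases hA (j + t) with e' | e' <;> rw [e, e'] <;> linarith
  rcases hj with hj | hj
  · rcases hi with hi | hi
    · obtain ⟨f, hf, hc, hm⟩ := hmono j
      obtain ⟨t, ht⟩ : ∃ t, t = (i - j).val := ⟨_, rfl⟩
      have htN : t < 8 * g - 4 := by rw [ht]; exact ZMod.val_lt _
      have e : i = j + (t : ℕ) := by rw [ht, ZMod.natCast_zmod_val]; ring
      rcases Nat.eq_zero_or_pos t with h0 | h0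
      · rw [e, h0]; simp
      · have := hm 0 t h0 htN
        rw [← e, ← hi, Nat.cast_zero, add_zero, ← hj] at this
        exact absurd this (lt_irrefl _)
    · obtain ⟨f, hf, hc, hm⟩ := hmono i
      exact (cell_unique hf hc hm (by omega) (Or.inl hj) hi).symm
  · obtain ⟨f, hf, hc, hm⟩ := hmono j
    refine cell_unique hf hc hm (by omega) ?_ hj
    exact hi.imp id Or.inr

theorem FArith_eq (hg : 2 ≤ g) (hA : D.IsExtremal A) {u w : Circle} {j : ZMod (8 * g - 4)}
    (hw : w ∈ arcCO (A j) (A (j + 1))) : D.FArith A (u, w) = onPair (D.T j) (u, w) := by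
  have hex : ∃ i, (u, w).2 ∈ arcCO (A i) (A (i + 1)) := ⟨j, hw⟩
  rw [FArith, dif_pos hex, D.arcCO_unique hg hA hex.choose_spec hw]

/-- Moving `A k` between `P k` and `Q k` reassigns only the arc between them, where the arcs behind
sides `k - 1` and `k` overlap. -/
theorem arcCO_cases (hg : 2 ≤ g) (hA : D.IsExtremal A) {w : Circle} {i : ZMod (8 * g - 4)}
    (hw : CCW (D.P i) w (D.Q (i + 1))) :
    w ∈ arcCO (A i) (A (i + 1)) ∨
    (w ∈ arcCO (A (i + 1)) (A (i + 2)) ∧ w ∈ arcCO (D.P (i + 1)) (D.Q (i + 1))) ∨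
    (w ∈ arcCO (A (i - 1)) (A i) ∧ CCW (D.P i) w (D.Q i)) := by
  obtain ⟨f, hf, hc, -, hh⟩ := D.exists_chain hg i
  have h1 := hA (i - 1)
  have h2 := hA i
  have h3 := hA (i + 1)
  have h4 := hA (i + 2)
  clear hA
  simp only [arcCO, mem_ofPred_eq, hc, ← hf.eq_iff] at *
  grind

theorem upper_of_mem_OmegaArith_P (hg : 2 ≤ g) (hG : ∀ i, G i ∈ arcCC (D.P i) (D.P (i + 1)))
    {u w : Circle} {i : ZMod (8 * g - 4)} (hw : CCW (D.P i) w (D.P (i + 1)))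
    (h : (u, w) ∈ D.OmegaArith G) : u ∈ arcCC (D.H G (i + 1)) (G (i - 1)) ∧
      (CCW (D.P i) w (D.Q i) → u ∈ arcCC (D.H G (i + 1)) (G (i - 2))) := by
  rw [mem_OmegaArith] at h
  obtain ⟨k, h⟩ := h
  obtain rfl : k = i := by
    refine D.index_eq_of_P hg (w := w) ?_ hw
    obtain ⟨f, hf, hc, -, hh⟩ := D.exists_chain hg k
    clear hG hw
    simp only [mem_arcCC, hc, ← hf.eq_iff] at *
    grind
  have hH := D.H_mem' hg hG (i := k + 1) (j := k + 2) (by ring)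
  have hG1 := D.G_mem hG (i := k - 2) (j := k - 1) (by ring)
  have hG2 := D.G_mem hG (i := k - 1) (j := k) (by ring)
  obtain ⟨f, hf, hc, -, hh⟩ := D.exists_chain hg k
  clear hG
  simp only [mem_arcCC, hc, ← hf.eq_iff] at *
  grind

/-- `P i` lies in strips of the two indices `i - 1` and `i`; the first arc of the former contains
that of the latter. -/
theorem arc_of_mem_OmegaArith_vertex (hg : 2 ≤ g) (hG : ∀ i, G i ∈ arcCC (D.P i) (D.P (i + 1)))
    {u : Circle} {i : ZMod (8 * g - 4)} (h : (u, D.P i) ∈ D.OmegaArith G) :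
    u ∈ arcCC (D.H G i) (G (i - 2)) := by
  rw [mem_OmegaArith] at h
  obtain ⟨k, h⟩ := h
  have hk : i - 1 = k - 1 ∨ i - 1 = k := by
    have key : CCW (D.Q (k - 1)) (D.P i) (D.Q (k - 1 + 1)) ∨ CCW (D.Q k) (D.P i) (D.Q (k + 1)) := by
      rw [sub_add_cancel]
      have hne := D.P_ne_Q_self hg k
      have hne' : D.P i ≠ D.Q k := fun e => by
        by_cases hik : i = k
        · exact D.P_ne_Q_self hg k (hik ▸ e)
        · by_cases hik' : i = k + 1
          · obtain ⟨f, hf, hc, -, hh⟩ := D.exists_chain hg k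
            have := congrArg f (hik' ▸ e)
            grind
          · have h1 := D.ccw_P_outside hg hik hik'
            rw [e] at h1
            obtain ⟨f, hf, hc, -, hh⟩ := D.exists_chain hg k
            rw [hc] at h1
            grind
      obtain ⟨f, hf, hc, -, hh⟩ := D.exists_chain hg k
      clear hG
      simp only [mem_arcCC, hc, ← hf.eq_iff, Ne] at *
      grind
    have hiQ : D.P i ∈ arcCC (D.Q (i - 1)) (D.Q (i - 1 + 1)) := by
      obtain ⟨f, hf, hc, -, hh⟩ := D.exists_chain hg i
      rw [sub_add_cancel]
      simp only [mem_arcCC, hc, ← hf.eq_iff]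
      grind
    exact key.imp (D.index_eq_of_Q hg hiQ) (D.index_eq_of_Q hg hiQ)
  have hH := D.H_mem hg hG i
  have hH1 := D.H_mem' hg hG (i := i + 1) (j := i + 2) (by ring)
  have hG2 := D.G_mem hG (i := i - 2) (j := i - 1) (by ring)
  have hG3 := D.G_mem hG (i := i - 3) (j := i - 2) (by ring)
  rcases hk with hk | hk
  · obtain rfl : i = k := sub_left_injective hk
    obtain ⟨f, hf, hc, -, hh⟩ := D.exists_chain hg i
    clear hG
    simp only [mem_arcCC, hc, ← hf.eq_iff] at *
    grind
  · subst hk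
    rw [sub_add_cancel, show i - 1 - 1 = i - 2 by ring, show i - 1 - 2 = i - 3 by ring] at h
    obtain ⟨f, hf, hc, -, hh⟩ := D.exists_chain hg i
    clear hG
    simp only [mem_arcCC, hc, ← hf.eq_iff] at *
    grind

/-- The case of `mem_OmegaArith_core` in which the strip of `w` is near `s`. For `k = s` and `k = s
+ 1` the position of `w` is impossible; for `k = s - 1` it must be `P (s - 1)`, which the strip of
index `s - 2` also contains. -/
theorem not_mem_OmegaArith_near (hg : 2 ≤ g) (hG : ∀ i, G i ∈ arcCC (D.P i) (D.P (i + 1)))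
    {u w : Circle} {s k : ZMod (8 * g - 4)} (hu : u ∈ arcCC (D.H G (s - 1)) (G (s + 1)))
    (hw : w ∈ arcCC (D.Q (s + 2)) (D.P (s - 1)))
    (hk : w ∈ arcCC (D.P k) (D.Q k) ∨ w ∈ arcCC (D.Q k) (D.P (k + 1)))
    (hks : k = s ∨ k = s + 1 ∨ k = s + 2 ∨ k = s + 3 ∨ k = s - 2 ∨ k = s - 1)
    (h : ∀ i, (u ∈ arcCC (D.H G (i + 1)) (G (i - 2)) → w ∉ arcCC (D.P i) (D.Q i)) ∧
      (u ∈ arcCC (D.H G (i + 1)) (G (i - 1)) → w ∉ arcCC (D.Q i) (D.P (i + 1)))) : False := by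
  have hH1 := D.H_mem' hg hG (i := s - 1) (j := s) (by ring)
  have hG1 := D.G_mem hG (i := s + 1) (j := s + 2) (by ring)
  obtain ⟨f, hf, hc, -, hh⟩ := D.exists_chain hg s
  rw [mem_arcCC_iff_of_le hf hc (by grind)] at hH1 hG1
  rw [mem_arcCC_iff_of_le hf hc (by grind)] at hu
  have hw : f (D.Q (s + 2)) ≤ f w ∨ f w ≤ f (D.P (s - 1)) := by
    clear h hG hk hks
    simp only [mem_arcCC, hc, ← hf.eq_iff] at *
    grind
  have hle : ∀ {a b x : Circle}, f a ≤ f b → x ∈ arcCC a b → f a ≤ f x ∧ f x ≤ f b :=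
    fun h => (mem_arcCC_iff_of_le hf hc h).1
  have hlt : ∀ {a b x : Circle}, f b < f a → f a ≤ f x ∨ f x ≤ f b → x ∈ arcCC a b :=
    fun h => (mem_arcCC_iff_of_lt hf hc h).2
  rcases hks with rfl | rfl | rfl | rfl | rfl | rfl
  · rcases hk with hk | hk <;> have hk := hle (by linarith) hk <;> rcases hw with hw | hw <;>
      linarith
  · rw [show s + 1 + 1 = s + 2 by ring] at hk
    rcases hk with hk | hk <;> have hk := hle (by linarith) hk <;> rcases hw with hw | hw <;>
      linarith
  · have h := (h (s + 2)).2
    have hH2 := hle (by linarith) (D.H_mem' hg hG (i := s + 3) (j := s + 4) (by ring))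
    rw [show s + 2 + 1 = s + 3 by ring] at hk
    rw [show s + 2 + 1 = s + 3 by ring, show s + 2 - 1 = s + 1 by ring] at h
    refine h (hlt (by linarith) (Or.inr hu.2)) ?_
    rcases hk with hk | hk
    · have hk := hle (by linarith) hk
      exact Or.inl (hf (le_antisymm hk.2 (by rcases hw with hw | hw <;> linarith)))
    · exact hk
  · have h := h (s + 3)
    have hH2 := hle (by linarith) (D.H_mem' hg hG (i := s + 4) (j := s + 5) (by ring))
    have hG2 := hle (by linarith) (D.G_mem hG (i := s + 2) (j := s + 3) (by ring))
    rw [show s + 3 + 1 = s + 4 by ring] at hk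
    rw [show s + 3 + 1 = s + 4 by ring, show s + 3 - 1 = s + 2 by ring,
      show s + 3 - 2 = s + 1 by ring] at h
    rcases hk with hk | hk
    · exact h.1 (hlt (by linarith) (Or.inr hu.2)) hk
    · exact h.2 (hlt (by linarith) (Or.inr (by linarith))) hk
  · have h := h (s - 2)
    have hG2 := hle (by linarith) (D.G_mem hG (i := s - 4) (j := s - 3) (by ring))
    have hG3 := hle (by linarith) (D.G_mem hG (i := s - 3) (j := s - 2) (by ring))
    rw [show s - 2 + 1 = s - 1 by ring] at hk
    rw [show s - 2 + 1 = s - 1 by ring, show s - 2 - 1 = s - 3 by ring,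
      show s - 2 - 2 = s - 4 by ring] at h
    rcases hk with hk | hk
    · exact h.1 (hlt (by linarith) (Or.inl hu.1)) hk
    · exact h.2 (hlt (by linarith) (Or.inl hu.1)) hk
  · have h := (h (s - 2)).2
    have hG3 := hle (by linarith) (D.G_mem hG (i := s - 3) (j := s - 2) (by ring))
    rw [show s - 1 + 1 = s by ring] at hk
    rw [show s - 2 + 1 = s - 1 by ring, show s - 2 - 1 = s - 3 by ring] at h
    refine h (hlt (by linarith) (Or.inl hu.1)) (Or.inr (Or.inl (hf (le_antisymm ?_ ?_))))
    · rcases hk with hk | hk <;> have hk := hle (by linarith) hk <;> rcases hw with hw | hw <;>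
        linarith
    · rcases hk with hk | hk <;> have hk := hle (by linarith) hk <;> linarith

/-- For the strips far from `s` the whole arc `[Q (s - 1), P (s + 2)]` fits into the first arc of
the strip. -/
theorem mem_OmegaArith_core (hg : 2 ≤ g) (hG : ∀ i, G i ∈ arcCC (D.P i) (D.P (i + 1)))
    {u w : Circle} {s : ZMod (8 * g - 4)} (hu : u ∈ arcCC (D.H G (s - 1)) (G (s + 1)))
    (hw : w ∈ arcCC (D.Q (s + 2)) (D.P (s - 1))) : (u, w) ∈ D.OmegaArith G := by
  have := neZero_index hg
  obtain ⟨k, hk⟩ := D.exists_cell_PQ hg w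
  have hH1 := D.H_mem' hg hG (i := s - 1) (j := s) (by ring)
  have hG1 := D.G_mem hG (i := s + 1) (j := s + 2) (by ring)
  by_contra h
  rw [mem_OmegaArith] at h
  push Not at h
  obtain ⟨t, ht⟩ : ∃ t, t = (k - s).val := ⟨_, rfl⟩
  have htN : t < 8 * g - 4 := by rw [ht]; exact ZMod.val_lt _
  have e : k = s + (t : ℕ) := by rw [ht, ZMod.natCast_zmod_val]; ring
  have hsmall := fun h' => D.not_mem_OmegaArith_near hg hG hu hw hk h' h
  have hN : ((8 * g - 4 : ℕ) : ZMod (8 * g - 4)) = 0 := ZMod.natCast_self _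
  have t1 : 4 ≤ t := by
    by_contra hlt
    apply hsmall
    have : t = 0 ∨ t = 1 ∨ t = 2 ∨ t = 3 := by omega
    rcases this with rfl | rfl | rfl | rfl <;> simp [e]
  have t2 : t + 3 ≤ 8 * g - 4 := by
    by_contra hlt
    apply hsmall
    have : t + 2 = 8 * g - 4 ∨ t + 1 = 8 * g - 4 := by omega
    rcases this with h' | h'
    · have : (t : ZMod (8 * g - 4)) + 2 = 0 := by rw [← hN, ← h']; push_cast; rfl
      right; right; right; right; left
      rw [e]; linear_combination this
    · have : (t : ZMod (8 * g - 4)) + 1 = 0 := by rw [← hN, ← h']; push_cast; rfl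
      right; right; right; right; right
      rw [e]; linear_combination this
  clear hsmall
  have h := h k
  obtain ⟨r, rfl⟩ : ∃ r, t = r + 4 := ⟨t - 4, by omega⟩
  push_cast at e
  have i1 : k + 1 = s + ((r + 5 : ℕ) : ZMod (8 * g - 4)) := by rw [e]; push_cast; ring
  have i2 : k + 2 = s + ((r + 6 : ℕ) : ZMod (8 * g - 4)) := by rw [e]; push_cast; ring
  have i3 : k - 1 = s + ((r + 3 : ℕ) : ZMod (8 * g - 4)) := by rw [e]; push_cast; ring
  have i4 : k - 2 = s + ((r + 2 : ℕ) : ZMod (8 * g - 4)) := by rw [e]; push_cast; ring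
  have i0 : k = s + ((r + 4 : ℕ) : ZMod (8 * g - 4)) := by rw [e]; push_cast; ring
  have i5 : s - 1 = s + ((8 * g - 4 - 1 : ℕ) : ZMod (8 * g - 4)) := by
    rw [Nat.cast_sub (by omega), hN]; push_cast; ring
  have hH2 := D.H_mem' hg hG (i := k + 1) (j := k + 2) (by ring)
  have hG2 := D.G_mem hG (i := k - 2) (j := k - 1) (by ring)
  have hG3 := D.G_mem hG (i := k - 1) (j := k) (by ring)
  have hsQ : arcCC (D.H G (s - 1)) (G (s + 1)) ⊆ arcCC (D.Q (s - 1)) (D.P (s + 2)) := by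
    intro x hx
    obtain ⟨f, hf, hc, -, hh⟩ := D.exists_chain hg s
    clear h hG hk hu hw hH2 hG2 hG3
    simp only [mem_arcCC, hc, ← hf.eq_iff] at *
    grind
  have hu := hsQ hu
  clear hsQ hH1 hG1 hG ht e
  obtain ⟨f, hf, hn, hc, hPQ, hQP⟩ := D.exists_cut_index hg s
  have m0 := hQP 2 (r + 4) (by omega) (by omega)
  have m1 : f (D.P (s + 2)) ≤ f (D.P (k - 2)) := by
    rcases Nat.eq_zero_or_pos r with rfl | hr
    · rw [i4]; simp
    · have a := hPQ 2 (by omega)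
      have b := hQP 2 (r + 2) (by omega) (by omega)
      rw [← i4] at b
      push_cast at a b
      linarith
  have m2 : f (D.Q (k + 2)) ≤ f (D.Q (s - 1)) := by
    rcases (show r + 6 ≤ 8 * g - 4 - 1 by omega).eq_or_lt with hr | hr
    · rw [i2, i5, hr]
    · have a := hPQ (8 * g - 4 - 1) (by omega)
      have b := hQP (r + 6) (8 * g - 4 - 1) hr (by omega)
      rw [← i2, ← i5] at b
      rw [← i5] at a
      linarith
  have n1 := hPQ (r + 2) (by omega)
  have n2 := hQP (r + 2) (r + 3) (by omega) (by omega)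
  have n3 := hPQ (r + 3) (by omega)
  have n4 := hQP (r + 3) (r + 4) (by omega) (by omega)
  have n5 := hPQ (r + 4) (by omega)
  have n6 := hQP (r + 4) (r + 5) (by omega) (by omega)
  have n7 := hPQ (r + 5) (by omega)
  have n8 := hQP (r + 5) (r + 6) (by omega) (by omega)
  have n9 := hPQ (r + 6) (by omega)
  rw [← i4] at n1 n2
  rw [← i3] at n2 n3 n4
  rw [← i0] at n4 n5 n6
  rw [← i1] at n6 n7 n8
  rw [← i2] at n8 n9
  rw [mem_arcCC_iff_of_le hf hc (by linarith)] at hH2 hG2 hG3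
  have hs := hPQ 2 (by omega)
  push_cast at hs
  rw [mem_arcCC_iff_of_lt hf hc (by linarith)] at hu
  have hlt : ∀ {a b x : Circle}, f b < f a → f a ≤ f x ∨ f x ≤ f b → x ∈ arcCC a b :=
    fun h => (mem_arcCC_iff_of_lt hf hc h).2
  rcases hk with hk | hk
  · exact h.1 (hlt (by linarith) (hu.imp (fun _ => by linarith) fun _ => by linarith)) hk
  · exact h.2 (hlt (by linarith) (hu.imp (fun _ => by linarith) fun _ => by linarith)) hk

/-- The arithmetic map preserves the arithmetic domain. -/
theorem onPair_T_mem_OmegaArith (hg : 2 ≤ g) (hA : D.IsExtremal A) (h : D.IsCornerSystem A G)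
    {u w : Circle} {i : ZMod (8 * g - 4)} (hp : (u, w) ∈ D.OmegaArith G)
    (hw : w ∈ arcCO (A i) (A (i + 1))) (hu : w = D.P i → u ∈ arcCC (D.Q (i + 1)) (D.P i)) :
    onPair (D.T i) (u, w) ∈ D.OmegaArith G := by
  have hG := h.mem
  obtain ⟨s, hs⟩ : ∃ s, s = sigmaIdx g i := ⟨_, rfl⟩
  have hH0 := D.H_mem hg hG i
  have hH1 := D.H_mem' hg hG (i := i + 1) (j := i + 2) (by ring)
  have hH2 := D.H_mem' hg hG (i := i + 2) (j := i + 3) (by ring)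
  have hG1 := D.G_mem hG (i := i - 1) (j := i) (by ring)
  have hG2 := D.G_mem hG (i := i - 2) (j := i - 1) (by ring)
  -- The strip below `Q i` is involved only if `A i = P i`, the one above `P (i + 1)` only if `A (i
  -- + 1) = Q (i + 1)`. This matches the cases of the corner equations.
  have hcases : (A i = D.P i ∧ w ∈ arcCC (D.P i) (D.Q i) ∧ u ∈ arcCC (D.Q (i + 1)) (G (i - 2))) ∨
      (w ∈ arcCC (D.Q i) (D.P (i + 1)) ∧ u ∈ arcCC (D.H G (i + 1)) (G (i - 1))) ∨
      (A (i + 1) = D.Q (i + 1) ∧ w ∈ arcCC (D.P (i + 1)) (D.Q (i + 1)) ∧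
        u ∈ arcCC (D.H G (i + 2)) (G (i - 1))) := by
    have l1 : w = D.P i → u ∈ arcCC (D.H G i) (G (i - 2)) := fun e =>
      D.arc_of_mem_OmegaArith_vertex hg hG (e ▸ hp)
    have l2 : w = D.P (i + 1) → u ∈ arcCC (D.H G (i + 1)) (G (i - 1)) := fun e => by
      have := D.arc_of_mem_OmegaArith_vertex hg hG (e ▸ hp)
      rwa [show i + 1 - 2 = i - 1 by ring] at this
    have l3 : CCW (D.P i) w (D.P (i + 1)) → u ∈ arcCC (D.H G (i + 1)) (G (i - 1)) ∧
      (CCW (D.P i) w (D.Q i) → u ∈ arcCC (D.H G (i + 1)) (G (i - 2))) := fun k =>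
      D.upper_of_mem_OmegaArith_P hg hG k hp
    have l4 : CCW (D.P (i + 1)) w (D.P (i + 2)) →
      (CCW (D.P (i + 1)) w (D.Q (i + 1)) → u ∈ arcCC (D.H G (i + 2)) (G (i - 1))) := fun k => by
      have := (D.upper_of_mem_OmegaArith_P hg hG (i := i + 1)
        (by rwa [show i + 1 + 1 = i + 2 by ring]) hp).2
      rwa [show i + 1 + 1 = i + 2 by ring, show i + 1 - 2 = i - 1 by ring] at this
    have a1 := hA i
    have a2 := hA (i + 1)
    clear hG hA hp h hs
    have hwc : (A i = D.P i ∧ w = D.P i) ∨ (A i = D.P i ∧ CCW (D.P i) w (D.Q i)) ∨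
        w = D.Q i ∨ CCW (D.Q i) w (D.P (i + 1)) ∨ w = D.P (i + 1) ∨
        (A (i + 1) = D.Q (i + 1) ∧ CCW (D.P (i + 1)) w (D.Q (i + 1))) := by
      clear l1 l2 l3 l4 hu hH0 hH1 hH2 hG1 hG2
      obtain ⟨f, hf, hc, -, hh⟩ := D.exists_chain hg i
      simp only [arcCO, mem_ofPred_eq, hc, ← hf.eq_iff] at *
      grind
    clear hw
    obtain ⟨f, hf, hc, -, hh⟩ := D.exists_chain hg i
    rcases hwc with k | k | k | k | k | k
    -- The strip of index `i - 1` also contains `w = P i` and allows `u` from `H i` on; `hu` removes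
    -- the part before `Q (i + 1)`.
    · have l1 := l1 k.2
      have hu := hu k.2
      refine Or.inl ⟨k.1, Or.inl k.2, ?_⟩
      clear l2 l3 l4 hH1 hH2 hG1 k a1 a2
      simp only [mem_arcCC, hc, ← hf.eq_iff] at *
      grind
    · have l3 := (l3 (by rw [hc] at k ⊢; grind)).2 k.2
      refine Or.inl ⟨k.1, Or.inr (Or.inr k.2), ?_⟩
      clear l1 l2 l4 hH0 hH2 hG1 k a1 a2 hu
      simp only [mem_arcCC, hc, ← hf.eq_iff] at *
      grind
    · exact Or.inr (Or.inl ⟨Or.inl k, (l3 (by rw [k, hc]; grind)).1⟩)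
    · exact Or.inr (Or.inl ⟨Or.inr (Or.inr k), (l3 (by rw [hc] at k ⊢; grind)).1⟩)
    · exact Or.inr (Or.inl ⟨Or.inr (Or.inl k), l2 k⟩)
    · exact Or.inr (Or.inr ⟨k.1, Or.inr (Or.inr k.2), l4 (by rw [hc] at k ⊢; grind) k.2⟩)
  have tP := D.T_P hg i
  have tQ1 := D.T_Q_succ hg i
  have tP0 := D.T_P_pred hg i
  have tQ := D.T_Q hg i
  have tP1 := D.T_P_succ hg i
  have tQ2 := D.T_Q_succ_succ hg i
  rw [← hs] at tP tQ1 tP0 tQ tP1 tQ2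
  rw [onPair]
  rcases hcases with ⟨ha, hw', hu'⟩ | ⟨hw', hu'⟩ | ⟨ha, hw', hu'⟩
  · rw [← SU11.arcCC_iff (D.T i)] at hw' hu'
    rw [tP, tQ] at hw'
    rw [tQ1, ← h.eq_of_P _ ha, ← hs] at hu'
    refine D.mem_OmegaArith_up hg hG (m := s + 1) ?_ ?_
    · rwa [add_sub_cancel_right]
    · rwa [show s + 1 + 1 = s + 2 by ring]
  · refine D.mem_OmegaArith_core hg hG (s := s) ?_ (by
      rw [← tQ, ← tP1]; exact (SU11.arcCC_iff (D.T i)).2 hw')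
    rw [← SU11.arcCC_iff (D.T i)] at hu' hH1 hG1
    rw [tQ1, tQ2] at hH1
    rw [tP0, tP] at hG1
    -- The image of `H (i + 1)` lies in `[P s, Q s]`. Depending on `A (τ i + 2)`, `H (s - 1)` equals
    -- it or lies in `[Q (s - 1), P s]`, hence not after it.
    have b1 : D.H G (s - 1) = onCircle (D.T i) (D.H G (i + 1)) ∨
        D.H G (s - 1) ∈ arcCC (D.Q (s - 1)) (D.P s) := by
      obtain ⟨y, hy⟩ : ∃ y, y = tauIdx g i + 1 := ⟨_, rfl⟩
      have e : sigmaIdx g y = s - 1 := by rw [hy, hs, sigma_tau_add_one hg]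
      rcases hA (y + 1) with k | k
      · left
        rw [← e, D.H_sigma_of_P hg h k, D.T_H_succ hg, hy, add_sub_cancel_right]
      · right
        have hm : D.H G (y + 2) ∈ arcCC (D.Q (y + 2)) (D.P (y - 1)) := by
          have hH3 := D.H_mem' hg hG (i := y + 2) (j := y + 3) (by ring)
          clear hG hA hp h hs hH0 hH1 hH2 hG1 hG2
          obtain ⟨f, hf, hc, -, hh⟩ := D.exists_chain hg y
          simp only [mem_arcCC, hc, ← hf.eq_iff] at *
          grind
        rw [← SU11.arcCC_iff (D.T y), D.T_Q_succ_succ hg, D.T_P_pred hg,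
          ← D.H_sigma_of_Q hg h k, e, sub_add_cancel] at hm
        exact hm
    -- The image of `G (i - 1)` lies in `[P (s + 1), Q (s + 1)]`. Depending on `A (τ i - 1)`, `G (s
    -- + 1)` equals it or lies in `[Q (s + 1), P (s + 2)]`, hence not before it.
    have b2 : G (s + 1) = onCircle (D.T i) (G (i - 1)) ∨
        G (s + 1) ∈ arcCC (D.Q (s + 1)) (D.P (s + 2)) := by
      obtain ⟨y, hy⟩ : ∃ y, y = tauIdx g i - 1 := ⟨_, rfl⟩
      have e : sigmaIdx g y = s + 1 := by rw [hy, hs, ← sigma_sigma_add_one hg, sigma_sigma hg]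
      rcases hA y with k | k
      · right
        have hm : G (y - 2) ∈ arcCC (D.Q (y + 2)) (D.P (y - 1)) := by
          have hG3 := D.G_mem hG (i := y - 2) (j := y - 1) (by ring)
          clear hG hA hp h hs hH0 hH1 hH2 hG1 hG2
          obtain ⟨f, hf, hc, -, hh⟩ := D.exists_chain hg y
          simp only [mem_arcCC, hc, ← hf.eq_iff] at *
          grind
        rw [← SU11.arcCC_iff (D.T y), D.T_Q_succ_succ hg, D.T_P_pred hg,
          ← h.eq_of_P _ k, e, show s + 1 + 1 = s + 2 by ring] at hm
        exact hm
      · left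
        rw [← e, h.eq_of_Q _ k, hy, tau_sub_one, tau_tau hg, sub_add_cancel]
    have hH3 := D.H_mem' hg hG (i := s - 1) (j := s) (by ring)
    have hG3 := D.G_mem hG (i := s + 1) (j := s + 2) (by ring)
    obtain ⟨f, hf, hc, -, hh⟩ := D.exists_chain hg s
    rw [mem_arcCC_iff_of_le hf hc (by grind)] at hH1 hG1 hH3 hG3 b1 b2
    rw [mem_arcCC_iff_of_le hf hc (by linarith)] at hu' ⊢
    have c1 : f (D.H G (s - 1)) ≤ f (onCircle (D.T i) (D.H G (i + 1))) :=
      b1.elim (fun e => (congrArg f e).le) fun e => by linarith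
    have c2 : f (onCircle (D.T i) (G (i - 1))) ≤ f (G (s + 1)) :=
      b2.elim (fun e => (congrArg f e).ge) fun e => by linarith
    exact ⟨by linarith, by linarith⟩
  · refine D.mem_OmegaArith_low hg hG (m := s) ?_ (by
      rw [← tP1, ← tQ1]; exact (SU11.arcCC_iff (D.T i)).2 hw')
    rw [← SU11.arcCC_iff (D.T i)] at hu' hG1
    rw [tP0, tP] at hG1
    have hm : D.H G (i + 2) ∈ arcCC (D.Q (i + 2)) (D.P (i - 1)) := by
      obtain ⟨f, hf, hc, -, hh⟩ := D.exists_chain hg i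
      rw [mem_arcCC_iff_of_le hf hc (by linarith)] at hH2
      exact (mem_arcCC_iff_of_lt hf hc (by linarith)).2 (Or.inl (by linarith))
    rw [← SU11.arcCC_iff (D.T i), tQ2, tP0, ← D.H_sigma_of_Q hg h ha, ← hs] at hm
    rw [← D.H_sigma_of_Q hg h ha, ← hs] at hu'
    obtain ⟨f, hf, hc, -, hh⟩ := D.exists_chain hg s
    rw [mem_arcCC_iff_of_le hf hc (by grind)] at hG1 hm
    rw [mem_arcCC_iff_of_le hf hc (by linarith)] at hu' ⊢
    exact ⟨by linarith, by linarith⟩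

end SurfacePolygon

namespace SurfacePolygon

variable {g : ℕ} (D : SurfacePolygon g) {A G : ZMod (8 * g - 4) → Circle}

/-! ### The conjugacy -/

theorem onPair_U_T (hg : 2 ≤ g) (i : ZMod (8 * g - 4)) (p : Circle × Circle) :
    onPair (D.U (tauIdx g (sigmaIdx g i))) (onPair (D.T i) p) = onPair (D.T (i + 1)) p := by
  simp only [onPair, D.U_tau_sigma_T hg]

theorem onPair_U_succ_T (hg : 2 ≤ g) (i : ZMod (8 * g - 4)) (p : Circle × Circle) :
    onPair (D.U (tauIdx g (sigmaIdx g i + 1))) (onPair (D.T i) p) = onPair (D.T (i - 1)) p := by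
  simp only [onPair, D.U_tau_sigma_succ_T hg]

theorem onPair_T_tau_U (hg : 2 ≤ g) (m : ZMod (8 * g - 4)) (p : Circle × Circle) :
    onPair (D.T (tauIdx g m)) (onPair (D.U (tauIdx g m)) p) = onPair (D.T (m - 1)) p := by
  simp only [onPair, D.T_tau_U_tau hg]

theorem onPair_T_tau_pred_U (hg : 2 ≤ g) (m : ZMod (8 * g - 4)) (p : Circle × Circle) :
    onPair (D.T (tauIdx g m - 1)) (onPair (D.U (tauIdx g m)) p) = onPair (D.T m) p := by
  simp only [onPair, D.T_tau_pred_U_tau hg]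

/-- Since the pair moved by `U` is in the arithmetic domain, the first coordinate before that move
is not past `H s`. No interior point of the arithmetic domain has this form, so off the frontier the
pair is in a lower bulge and `Φ` applies exactly this `U`. -/
theorem Phi_T_right (hg : 2 ≤ g) (hG : ∀ i, G i ∈ arcCC (D.P i) (D.P (i + 1))) {u w : Circle}
    {i : ZMod (8 * g - 4)} (hw : w ∈ arcCO (D.P (i + 1)) (D.Q (i + 1)))
    (hu : u ∈ arcCC (D.Q (i + 2)) (D.P i))
    (h1 : onPair (D.T (i + 1)) (u, w) ∈ D.OmegaArith G)
    (h2 : onPair (D.T i) (u, w) ∈ D.OmegaGeo)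
    (h3 : onPair (D.T i) (u, w) ∉ frontier (D.OmegaArith G)) :
    D.Phi G (onPair (D.T i) (u, w)) = onPair (D.T (i + 1)) (u, w) := by
  rw [← D.onPair_U_T hg] at h1 ⊢
  obtain ⟨s, hs⟩ : ∃ s, s = sigmaIdx g i := ⟨_, rfl⟩
  have hw' : onCircle (D.T i) w = D.P (s - 1) ∨
      CCW (D.P (s - 1)) (onCircle (D.T i) w) (D.P s) := by
    rw [hs, ← D.T_P_succ hg, ← D.T_Q_succ hg, SU11.ccw_iff, (SU11.onCircle_injective _).eq_iff]
    exact hw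
  rw [← SU11.arcCC_iff (D.T i), D.T_Q_succ_succ hg, D.T_P hg] at hu
  rw [← hs] at hu h1 ⊢
  simp only [onPair] at h1 h2 h3 ⊢
  generalize onCircle (D.T i) u = u' at *
  generalize onCircle (D.T i) w = w' at *
  have hw2 : w' ∈ arcCC (D.P (s - 1)) (D.P s) := hw'.imp id Or.inr
  have hu2 : onCircle (D.U (tauIdx g s)) u' ∈ arcCC (D.P (tauIdx g s - 1)) (D.P (tauIdx g s)) := by
    rw [← D.U_tau_Q hg, ← D.U_tau_Q_succ hg, SU11.arcCC_iff]; exact hu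
  have hu3 : onCircle (D.U (tauIdx g s)) u' ∈ arcCC (D.Q (tauIdx g s + 1)) (G (tauIdx g s - 1)) ∨
      onCircle (D.U (tauIdx g s)) u' ∈
        arcCC (D.H G (tauIdx g s + 1)) (G (tauIdx g s - 1)) := by
    rcases hw' with e | e
    · right
      refine (D.upper_of_mem_OmegaArith_P hg hG ?_ h1).1
      rw [e, D.U_tau_P_pred hg]
      obtain ⟨f, hf, hc, -, hh⟩ := D.exists_chain hg (tauIdx g s)
      rw [hc]; grind
    · left
      refine D.upper_of_mem_OmegaArith hg hG ?_ h1
      rwa [← D.U_tau_P_pred hg, ← D.U_tau_P hg, SU11.ccw_iff]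
  have hu4 : onCircle (D.U (tauIdx g s)) u' ∈ arcCC (D.P (tauIdx g s - 1)) (G (tauIdx g s - 1)) := by
    have hG1 := D.G_mem hG (i := tauIdx g s - 1) (j := tauIdx g s) (by ring)
    have hH1 := D.H_mem' hg hG (i := tauIdx g s + 1) (j := tauIdx g s + 2) (by ring)
    generalize tauIdx g s = t at *
    obtain ⟨f, hf, hc, -, hh⟩ := D.exists_chain hg t
    rw [mem_arcCC_iff_of_le hf hc (by linarith)] at hu2 hG1 hH1
    rw [mem_arcCC_iff_of_lt hf hc (by linarith), mem_arcCC_iff_of_lt hf hc (by linarith)] at hu3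
    rw [mem_arcCC_iff_of_le hf hc (by linarith)]
    refine ⟨hu2.1, ?_⟩
    rcases hu3 with (k | k) | (k | k) <;> linarith
  rw [← D.U_tau_Q hg, ← D.U_tau_H hg (G := G), SU11.arcCC_iff] at hu4
  have hnot : (u', w') ∉ D.OmegaArith G := fun hA' => by
    refine D.not_mem_interior_low hg hG hw' ?_ (mem_interior_of_not_mem_frontier hA' h3)
    have hH1 := D.H_mem hg hG s
    clear h1 h2 h3 hG hA' hu2 hu3
    obtain ⟨f, hf, hc, -, hh⟩ := D.exists_chain hg s
    rw [mem_arcCC_iff_of_le hf hc (by linarith)] at hH1 hw2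
    rw [mem_arcCC_iff_of_le hf hc (by linarith)] at hu4
    rw [hc, ← hf.eq_iff]
    grind
  exact D.Phi_low hg hG h2 hnot hu hw2

theorem Phi_T_left (hg : 2 ≤ g) (hG : ∀ i, G i ∈ arcCC (D.P i) (D.P (i + 1))) {u w : Circle}
    {i : ZMod (8 * g - 4)} (hw : CCW (D.P i) w (D.Q i))
    (hu : u ∈ arcCC (D.Q (i + 1)) (D.P (i - 1)))
    (h1 : onPair (D.T (i - 1)) (u, w) ∈ D.OmegaArith G)
    (h2 : onPair (D.T i) (u, w) ∈ D.OmegaGeo)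
    (h3 : onPair (D.T i) (u, w) ∉ frontier (D.OmegaArith G)) :
    D.Phi G (onPair (D.T i) (u, w)) = onPair (D.T (i - 1)) (u, w) := by
  rw [← D.onPair_U_succ_T hg] at h1 ⊢
  obtain ⟨m, hm⟩ : ∃ m, m = sigmaIdx g i + 1 := ⟨_, rfl⟩
  have hw' : CCW (D.Q m) (onCircle (D.T i) w) (D.Q (m + 1)) := by
    rw [hm, show sigmaIdx g i + 1 + 1 = sigmaIdx g i + 2 by ring, ← D.T_P hg, ← D.T_Q hg,
      SU11.ccw_iff]
    exact hw
  rw [← SU11.arcCC_iff (D.T i), D.T_Q_succ hg, D.T_P_pred hg,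
    show sigmaIdx g i = m - 1 by rw [hm]; ring, sub_add_cancel] at hu
  rw [← hm] at h1 ⊢
  simp only [onPair] at h1 h2 h3 ⊢
  generalize onCircle (D.T i) u = u' at *
  generalize onCircle (D.T i) w = w' at *
  have hu2 : onCircle (D.U (tauIdx g m)) u' ∈ arcCC (D.Q (tauIdx g m)) (D.Q (tauIdx g m + 1)) := by
    rw [← D.U_tau_P_pred hg, ← D.U_tau_P hg, SU11.arcCC_iff]; exact hu
  have hu3 : onCircle (D.U (tauIdx g m)) u' ∈ arcCC (D.H G (tauIdx g m)) (D.P (tauIdx g m - 1)) := by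
    refine D.lower_of_mem_OmegaArith hg hG ?_ h1
    rwa [← D.U_tau_Q hg, ← D.U_tau_Q_succ hg, SU11.ccw_iff]
  have hu4 : onCircle (D.U (tauIdx g m)) u' ∈ arcCC (D.H G (tauIdx g m)) (D.Q (tauIdx g m + 1)) := by
    have hH1 := D.H_mem hg hG (tauIdx g m)
    generalize tauIdx g m = t at *
    obtain ⟨f, hf, hc, -, hh⟩ := D.exists_chain hg t
    rw [mem_arcCC_iff_of_le hf hc (by linarith)] at hu2 hH1
    rw [mem_arcCC_iff_of_lt hf hc (by linarith)] at hu3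
    rw [mem_arcCC_iff_of_le hf hc (by linarith)]
    refine ⟨?_, hu2.2⟩
    rcases hu3 with k | k <;> linarith
  rw [← D.U_tau_G hg, ← D.U_tau_P hg, SU11.arcCC_iff] at hu4
  have hnot : (u', w') ∉ D.OmegaArith G := fun hA' => by
    refine D.not_mem_interior_up hg hG (Or.inr hw') ?_ (mem_interior_of_not_mem_frontier hA' h3)
    have hG1 := D.G_mem hG (i := m - 1) (j := m) (by ring)
    clear h1 h2 h3 hG hA' hu2 hu3
    obtain ⟨f, hf, hc, -, hh⟩ := D.exists_chain hg m
    rw [mem_arcCC_iff_of_le hf hc (by linarith)] at hG1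
    rw [mem_arcCC_iff_of_le hf hc (by linarith)] at hu4
    rw [hc] at hw'
    rw [hc, ← hf.eq_iff]
    grind
  exact D.Phi_up hg hG h2 hnot hu (Or.inr (Or.inr hw'))

/-- If the arithmetic index is `i`, both maps agree and `Φ` does nothing after them. If it is `i +
1` or `i - 1`, the pair leaves the arithmetic domain under `T i` and `Φ` supplies the missing `U`.
-/
theorem conj_of_mem (hg : 2 ≤ g) (hA : D.IsExtremal A) (h : D.IsCornerSystem A G) {u w : Circle}
    {i : ZMod (8 * g - 4)} {z : ℂ} (hp : (u, w) ∈ D.OmegaArith G) (hne : u ≠ w)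
    (hz : z ∈ D.side i) (hzg : z ∈ geodesic u w) (hw : CCW (D.P i) w (D.Q (i + 1)))
    (h2 : onPair (D.T i) (u, w) ∈ D.OmegaGeo)
    (h3 : onPair (D.T i) (u, w) ∉ frontier (D.OmegaArith G)) :
    D.Phi G (onPair (D.T i) (u, w)) = D.FArith A (u, w) := by
  rcases D.arcCO_cases hg hA hw with k | ⟨k, k'⟩ | ⟨k, k'⟩
  · rw [D.FArith_eq hg hA k]
    refine D.Phi_of_mem h2 (D.onPair_T_mem_OmegaArith hg hA h hp k fun e => ?_)
    subst e
    obtain ⟨f, hf, hc, -, hh⟩ := D.exists_chain hg i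
    rw [hc] at hw
    grind
  · rw [show i + 2 = i + 1 + 1 by ring] at k
    rw [D.FArith_eq hg hA k]
    have hu := D.exit_right hg hne hz hzg k'
    refine D.Phi_T_right hg h.mem k' hu
      (D.onPair_T_mem_OmegaArith hg hA h hp k fun _ => ?_) h2 h3
    rw [show i + 1 + 1 = i + 2 by ring]
    obtain ⟨f, hf, hc, -, hh⟩ := D.exists_chain hg i
    rw [mem_arcCC_iff_of_lt hf hc (by linarith)] at hu ⊢
    exact hu.imp id fun _ => by linarith
  · have k2 : w ∈ arcCO (A (i - 1)) (A (i - 1 + 1)) := by rwa [sub_add_cancel]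
    rw [D.FArith_eq hg hA k2]
    refine D.Phi_T_left hg h.mem k' (D.exit_left hg hne hz hzg k')
      (D.onPair_T_mem_OmegaArith hg hA h hp k2 fun e => ?_) h2 h3
    subst e
    obtain ⟨f, hf, hc, -, hh⟩ := D.exists_chain hg i
    rw [hc] at k'
    grind

/-- The exit side is `m - 1` or `m - 2`, and the arithmetic index of the moved pair is `τ m` or `τ m
+ 1`. As `T (τ m) U (τ m) = T (m - 1)`, at most one shift remains to be corrected once the double
shift is excluded. -/
theorem conj_low (hg : 2 ≤ g) (hA : D.IsExtremal A) (h : D.IsCornerSystem A G) {u w : Circle}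
    {i m : ZMod (8 * g - 4)} (hp : (u, w) ∈ D.OmegaGeo) (hp' : (u, w) ∉ D.OmegaArith G)
    (hu : u ∈ arcCC (D.Q m) (D.Q (m + 1))) (hw : w ∈ arcCC (D.P (m - 1)) (D.P m))
    (hi : CCW (D.P i) w (D.Q (i + 1))) (h2 : onPair (D.T i) (u, w) ∈ D.OmegaGeo)
    (h3 : onPair (D.T i) (u, w) ∉ frontier (D.OmegaArith G)) :
    D.Phi G (onPair (D.T i) (u, w)) = D.FArith A (D.Phi G (u, w)) := by
  have hG := h.mem
  obtain ⟨b1, b2, -⟩ := D.bulge_low hg hG hp hp' hu hw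
  have hq := D.mapsTo_Phi hg hG hp
  rw [D.Phi_low hg hG hp hp' hu hw] at hq ⊢
  have hi' : i = m - 1 ∨ (i + 1 = m - 1 ∧ w ∈ arcCO (D.P (i + 1)) (D.Q (i + 1))) := by
    have key : w ∈ arcCC (D.P i) (D.P (i + 1)) ∨ (w ∈ arcCC (D.P (i + 1)) (D.P (i + 1 + 1)) ∧
        w ∈ arcCO (D.P (i + 1)) (D.Q (i + 1))) := by
      obtain ⟨f, hf, hc, -, hh⟩ := D.exists_chain hg i
      rw [show i + 1 + 1 = i + 2 by ring]
      clear hG hA b1 b2 hu hw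
      simp only [arcCO, mem_ofPred_eq, mem_arcCC, hc, ← hf.eq_iff] at *
      grind
    rw [show D.P m = D.P (m - 1 + 1) by rw [sub_add_cancel]] at b2
    exact key.imp (fun k => D.index_eq_of_P hg k b2)
      fun k => ⟨D.index_eq_of_P hg k.1 b2, k.2⟩
  have hwU : CCW (D.Q (tauIdx g m)) (onCircle (D.U (tauIdx g m)) w) (D.Q (tauIdx g m + 1)) := by
    rwa [← D.U_tau_P_pred hg, ← D.U_tau_P hg, SU11.ccw_iff]
  have huU : onCircle (D.U (tauIdx g m)) u ∈ arcCC (D.P (tauIdx g m - 1)) (D.P (tauIdx g m)) := by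
    rwa [← D.U_tau_Q hg, ← D.U_tau_Q_succ hg, SU11.arcCC_iff]
  obtain ⟨t, ht⟩ : ∃ t, t = tauIdx g m := ⟨_, rfl⟩
  have hwU2 : CCW (D.P t) (onCircle (D.U t) w) (D.Q (t + 1)) := by
    rw [← ht] at hwU
    obtain ⟨f, hf, hc, -, hh⟩ := D.exists_chain hg t
    rw [hc] at hwU ⊢
    grind
  rcases D.arcCO_cases hg hA hwU2 with k | ⟨k, k'⟩ | ⟨k, k'⟩
  · rw [ht] at k
    have hmem := D.onPair_T_mem_OmegaArith hg hA h hq k fun e => by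
      simp only at e
      rw [← ht] at hwU e
      rw [e] at hwU
      obtain ⟨f, hf, hc, -, hh⟩ := D.exists_chain hg t
      rw [hc] at hwU
      grind
    have hF : D.FArith A (onPair (D.U (tauIdx g m)) (u, w)) =
        onPair (D.T (tauIdx g m)) (onPair (D.U (tauIdx g m)) (u, w)) := D.FArith_eq hg hA k
    have e := D.onPair_T_tau_U hg m (u, w)
    rw [hF, e]
    change onPair (D.T (tauIdx g m)) (onPair (D.U (tauIdx g m)) (u, w)) ∈ _ at hmem
    rw [e] at hmem
    rcases hi' with rfl | ⟨hi', hw'⟩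
    · exact D.Phi_of_mem h2 hmem
    · rw [← hi'] at hmem ⊢
      refine D.Phi_T_right hg hG hw' ?_ hmem h2 h3
      obtain rfl : m = i + 2 := by linear_combination -hi'
      rw [show i + 2 + 1 = i + 3 by ring] at hu
      obtain ⟨f, hf, hc, -, hh⟩ := D.exists_chain hg i
      rw [mem_arcCC_iff_of_le hf hc (by linarith)] at hu
      rw [mem_arcCC_iff_of_lt hf hc (by linarith)]
      exact Or.inl hu.1
  -- Index `τ m + 1` places `w` at or after `U m (P (τ m + 1))`, hence after `Q (m - 1)`; exit
  -- through side `m - 2` would require it before `Q (m - 1)`.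
  · have hi2 : i = m - 1 := by
      refine hi'.resolve_right fun ⟨e, hw'⟩ => ?_
      have l1 := D.U_P_tau_succ_mem hg m
      rw [← ht] at l1
      have l2 : onCircle (D.U m) (D.P (t + 1)) = w ∨
          CCW (onCircle (D.U m) (D.P (t + 1))) w (D.P m) := by
        have k2 := k'
        rw [ht] at k2 ⊢
        rw [arcCO, mem_ofPred_eq, ← D.U_tau_P hg] at k2
        rcases k2 with k2 | k2
        · left; rw [← k2, D.U_U_tau hg]
        · right
          rw [← SU11.ccw_iff (D.U m), D.U_U_tau hg, D.U_U_tau hg] at k2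
          exact k2
      rw [e] at hw'
      clear hG hA hp hp' h hq k k' h2 h3 hu hw hi hi'
      generalize onCircle (D.U m) (D.P (t + 1)) = x at *
      obtain ⟨f, hf, hc, -, hh⟩ := D.exists_chain hg m
      simp only [arcCO, mem_ofPred_eq, hc, ← hf.eq_iff] at *
      grind
    subst hi2
    rw [show t + 2 = t + 1 + 1 by ring] at k
    rw [ht] at k k'
    have hF : D.FArith A (onPair (D.U (tauIdx g m)) (u, w)) =
        onPair (D.T (tauIdx g m + 1)) (onPair (D.U (tauIdx g m)) (u, w)) := D.FArith_eq hg hA k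
    have e := D.onPair_T_tau_U hg m (u, w)
    rw [← e] at h2 h3 ⊢
    rw [hF]
    have hu1 : onCircle (D.U (tauIdx g m)) u ∈ arcCC (D.Q (tauIdx g m + 2)) (D.P (tauIdx g m)) := by
      rw [← ht] at huU ⊢
      obtain ⟨f, hf, hc, -, hh⟩ := D.exists_chain hg t
      rw [mem_arcCC_iff_of_le hf hc (by linarith)] at huU
      rw [mem_arcCC_iff_of_lt hf hc (by linarith)]
      exact Or.inr huU.2
    refine D.Phi_T_right hg hG k' hu1
      (D.onPair_T_mem_OmegaArith hg hA h hq k fun _ => ?_) h2 h3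
    simp only
    rw [← ht] at huU ⊢
    rw [show t + 1 + 1 = t + 2 by ring]
    obtain ⟨f, hf, hc, -, hh⟩ := D.exists_chain hg t
    rw [mem_arcCC_iff_of_le hf hc (by linarith)] at huU
    rw [mem_arcCC_iff_of_lt hf hc (by linarith)]
    exact Or.inr (by linarith)
  · exfalso
    rw [← ht] at hwU
    obtain ⟨f, hf, hc, -, hh⟩ := D.exists_chain hg t
    rw [hc] at hwU k'
    grind

theorem conj_up (hg : 2 ≤ g) (hA : D.IsExtremal A) (h : D.IsCornerSystem A G) {u w : Circle}
    {i m : ZMod (8 * g - 4)} (hp : (u, w) ∈ D.OmegaGeo) (hp' : (u, w) ∉ D.OmegaArith G)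
    (hu : u ∈ arcCC (D.P (m - 1)) (D.P m)) (hw : w ∈ arcCC (D.Q m) (D.Q (m + 1)))
    (hi : CCW (D.P i) w (D.Q (i + 1))) (h2 : onPair (D.T i) (u, w) ∈ D.OmegaGeo)
    (h3 : onPair (D.T i) (u, w) ∉ frontier (D.OmegaArith G)) :
    D.Phi G (onPair (D.T i) (u, w)) = D.FArith A (D.Phi G (u, w)) := by
  have hG := h.mem
  obtain ⟨b1, b2, -⟩ := D.bulge_up hg hG hp hp' hu hw
  have hq := D.mapsTo_Phi hg hG hp
  rw [D.Phi_up hg hG hp hp' hu hw] at hq ⊢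
  have hi' : i = m ∨ (i - 1 = m ∧ CCW (D.P i) w (D.Q i)) := by
    have key : w ∈ arcCC (D.Q i) (D.Q (i + 1)) ∨ (w ∈ arcCC (D.Q (i - 1)) (D.Q (i - 1 + 1)) ∧
        CCW (D.P i) w (D.Q i)) := by
      obtain ⟨f, hf, hc, -, hh⟩ := D.exists_chain hg i
      rw [sub_add_cancel]
      clear hG hA b1 b2 hu hw
      simp only [mem_arcCC, hc, ← hf.eq_iff] at *
      grind
    exact key.imp (fun k => D.index_eq_of_Q hg k b2)
      fun k => ⟨D.index_eq_of_Q hg k.1 b2, k.2⟩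
  have hwU : CCW (D.P (tauIdx g m - 1)) (onCircle (D.U (tauIdx g m)) w) (D.P (tauIdx g m)) := by
    rwa [← D.U_tau_Q hg, ← D.U_tau_Q_succ hg, SU11.ccw_iff]
  have huU : onCircle (D.U (tauIdx g m)) u ∈ arcCC (D.Q (tauIdx g m)) (D.Q (tauIdx g m + 1)) := by
    rwa [← D.U_tau_P_pred hg, ← D.U_tau_P hg, SU11.arcCC_iff]
  obtain ⟨t, ht⟩ : ∃ t, t = tauIdx g m := ⟨_, rfl⟩
  have hwU2 : CCW (D.P (t - 1)) (onCircle (D.U t) w) (D.Q (t - 1 + 1)) := by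
    rw [← ht] at hwU
    rw [sub_add_cancel]
    obtain ⟨f, hf, hc, -, hh⟩ := D.exists_chain hg t
    rw [hc] at hwU ⊢
    grind
  rcases D.arcCO_cases hg hA hwU2 with k | ⟨k, k'⟩ | ⟨k, k'⟩
  · rw [ht] at k
    have hmem := D.onPair_T_mem_OmegaArith hg hA h hq k fun e => by
      simp only at e
      rw [← ht] at hwU e
      rw [e] at hwU
      obtain ⟨f, hf, hc, -, hh⟩ := D.exists_chain hg t
      rw [hc] at hwU
      grind
    have hF : D.FArith A (onPair (D.U (tauIdx g m)) (u, w)) =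
        onPair (D.T (tauIdx g m - 1)) (onPair (D.U (tauIdx g m)) (u, w)) := D.FArith_eq hg hA k
    have e := D.onPair_T_tau_pred_U hg m (u, w)
    rw [hF, e]
    change onPair (D.T (tauIdx g m - 1)) (onPair (D.U (tauIdx g m)) (u, w)) ∈ _ at hmem
    rw [e] at hmem
    rcases hi' with rfl | ⟨hi', hw'⟩
    · exact D.Phi_of_mem h2 hmem
    · rw [← hi'] at hmem ⊢
      refine D.Phi_T_left hg hG hw' ?_ hmem h2 h3
      subst hi'
      rw [show i - 1 - 1 = i - 2 by ring] at hu
      obtain ⟨f, hf, hc, -, hh⟩ := D.exists_chain hg i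
      rw [mem_arcCC_iff_of_le hf hc (by linarith)] at hu
      rw [mem_arcCC_iff_of_lt hf hc (by linarith)]
      exact Or.inr hu.2
  · exfalso
    rw [← ht] at hwU
    rw [sub_add_cancel] at k'
    obtain ⟨f, hf, hc, -, hh⟩ := D.exists_chain hg t
    simp only [arcCO, mem_ofPred_eq, hc, ← hf.eq_iff] at hwU k'
    grind
  -- Exit through side `m + 1` places `w` after `P (m + 1)`, whose image under `U (τ m)` is already
  -- past `Q (τ m - 1)`; arithmetic index `τ m - 2` would require the image of `w` before that
  -- point.
  · have hi2 : i = m := by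
      refine hi'.resolve_right fun ⟨e, hw'⟩ => ?_
      have l1 := D.U_P_tau_succ_mem hg (tauIdx g m)
      rw [tau_tau hg] at l1
      have l2 : CCW (D.P (m + 1)) w (D.Q (m + 1)) := by
        rwa [← e, sub_add_cancel]
      have l3 : CCW (D.P (m + 1)) w (D.Q (m + 1)) ∧ CCW w (D.Q (m + 1)) (D.P (m + 1)) :=
        ⟨l2, ccw_rotate.1 l2⟩
      rw [← SU11.ccw_iff (D.U (tauIdx g m)), D.U_tau_Q_succ hg] at l2
      rw [← ht] at l1 l2 hwU
      clear hG hA hp hp' h hq h2 h3 hu hw hi hi' huU k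
      generalize onCircle (D.U t) (D.P (m + 1)) = x at *
      generalize onCircle (D.U t) w = y at *
      obtain ⟨f, hf, hc, -, hh⟩ := D.exists_chain hg t
      rw [hc] at l1 l2 k' hwU
      grind
    subst hi2
    have k2 : onCircle (D.U t) w ∈ arcCO (A (t - 1 - 1)) (A (t - 1 - 1 + 1)) := by
      rwa [sub_add_cancel]
    rw [ht] at k2 k'
    have hF : D.FArith A (onPair (D.U (tauIdx g i)) (u, w)) =
        onPair (D.T (tauIdx g i - 1 - 1)) (onPair (D.U (tauIdx g i)) (u, w)) :=
      D.FArith_eq hg hA k2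
    have e := D.onPair_T_tau_pred_U hg i (u, w)
    rw [← e] at h2 h3 ⊢
    rw [hF]
    have hu1 : onCircle (D.U (tauIdx g i)) u ∈
        arcCC (D.Q (tauIdx g i - 1 + 1)) (D.P (tauIdx g i - 1 - 1)) := by
      rw [← ht] at huU ⊢
      rw [sub_add_cancel, show t - 1 - 1 = t - 2 by ring]
      obtain ⟨f, hf, hc, -, hh⟩ := D.exists_chain hg t
      rw [mem_arcCC_iff_of_le hf hc (by linarith)] at huU
      rw [mem_arcCC_iff_of_lt hf hc (by linarith)]
      exact Or.inl huU.1
    refine D.Phi_T_left hg hG k' hu1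
      (D.onPair_T_mem_OmegaArith hg hA h hq k2 fun e' => ?_) h2 h3
    exfalso
    simp only at e'
    rw [e', ← ht, show t - 1 - 1 = t - 2 by ring] at k'
    obtain ⟨f, hf, hc, -, hh⟩ := D.exists_chain hg t
    rw [hc] at k'
    grind

end SurfacePolygon

end

theorem mainTheorem6 {g : ℕ} (hg : 2 ≤ g) (D : SurfacePolygon g)
    (A : ZMod (8 * g - 4) → Circle) (hA : D.IsExtremal A) :
    (∃! G : ZMod (8 * g - 4) → Circle, D.IsCornerSystem A G) ∧
    ∀ G : ZMod (8 * g - 4) → Circle, D.IsCornerSystem A G →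
      Set.MapsTo D.FGeo D.OmegaGeo D.OmegaGeo ∧
      Set.MapsTo (D.Phi G) D.OmegaGeo (D.OmegaArith G) ∧
      Set.BijOn (D.Phi G)
        (interior D.OmegaGeo \ frontier (D.OmegaArith G))
        (interior (D.OmegaArith G) \ frontier D.OmegaGeo) ∧
      ∀ p ∈ D.OmegaGeo, (∀ i, ¬ D.IsExitPoint p (D.V i)) →
        p ∉ frontier (D.OmegaArith G) → D.FGeo p ∉ frontier (D.OmegaArith G) →
        D.Phi G (D.FGeo p) = D.FArith A (D.Phi G p) := by
  refine ⟨D.existsUnique_cornerSystem hg hA, fun G h => ⟨D.mapsTo_FGeo hg, D.mapsTo_Phi hg h.mem,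
    D.bijOn_Phi hg h.mem, ?_⟩⟩
  rintro ⟨u, w⟩ hp hv - h3
  obtain ⟨i, z, hz, hzg, hw, hF⟩ := D.FGeo_eq_of_not_vertex hg hp hv
  have h2 := D.mapsTo_FGeo hg hp
  rw [hF] at h2 h3 ⊢
  by_cases hp' : (u, w) ∈ D.OmegaArith G
  · rw [D.Phi_of_mem hp hp']
    exact D.conj_of_mem hg hA h hp' hp.1 hz hzg hw h2 h3
  obtain ⟨m, ⟨hu, hwm⟩ | ⟨hu, hwm⟩⟩ := D.mem_rect_of_not_mem_OmegaArith hg h.mem hp hp'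
  · exact D.conj_low hg hA h hp hp' hu hwm hw h2 h3
  · exact D.conj_up hg hA h hp hp' hu hwm hw h2 h3
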